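/- For a connected finite simple graph $G=(V,E)$ with at least two vertices and distance function $d_G$, the minimum line-distortion ${\sf ld}(G)$ is the smallest $k$ for which there is a map $f:V\to\mathbb{R}$ with $d_G(x,y)\le|f(x)-f(y)|\le k\,d_G(x,y)$ for all $x,y\in V$; such a map is called an embedding of $G$ into the line with distortion at most $k$. The graph $G$ is AT-free if it has no three distinct, pairwise non-adjacent vertices such that each two of them are joined by a path that avoids the neighborhood of the third. There is a linear-time algorithm, that is, one with running time $O(|V|+|E|)$ on a random access machine that receives $G$ by its adjacency lists, which computes for every connected AT-free graph $G=(V,E)$ with $|V|>1$ an embedding $f:V\to\mathbb{N}$ of $G$ into the line with distortion at most $8\cdot{\sf ld}(G)$. Moreover, the embedding computed has the following form. There is a dominating path $\pi=(v_0,\dots,v_k)$ of $G$ (every vertex of $G$ lies on $\pi$ or is adjacent to a vertex of $\pi$) such that, for the BFS layers $L_i=\{u\in V: d_G(u,v_0)=i\}$, the non-empty layers are exactly $L_0,\dots,L_k$, $v_i\in L_i$ for $0\le i\le k$, and every $u\in L_i$ with $i\ge1$ is adjacent to $v_i$ or to $v_{i-1}$. With $X_i=\{x\in L_i: v_ix\in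 E\}$ and $\overline{X}_i=L_i\setminus(\{v_i\}\cup X_i)$, the map $f$ places the vertices on the line in the order $(v_0,\overline{X}_1,X_1,v_1,\dots,\overline{X}_k,X_k,v_k)$, with some order inside each set $X_i$ and $\overline{X}_i$, and any two vertices $x,y$ that are consecutive on the line satisfy $|f(x)-f(y)|=d_G(x,y)$. -/

import Mathlib

/-! ### A random access machine with a step count

Programs over natural number variables and natural number arrays (random access, computed
indices).  Arithmetic is limited to successor and predecessor, so a run of `t` steps can only
create numbers, and only address cells, up to the largest input number plus a constant times `t`:
unit cost per operation is honest also for words of logarithmic length. -/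

namespace RAM

/-- Memory: variables `var x` and arrays `arr a`, with names in `ℕ` (a program, being a finite
term, mentions only finitely many names). -/
structure State where
  var : ℕ → ℕ
  arr : ℕ → ℕ → ℕ

/-- Expressions: literals, variables, array reads `a[e]`, successor and predecessor. -/
inductive Expr where
  | lit (c : ℕ)
  | var (x : ℕ)
  | get (a : ℕ) (e : Expr)
  | succ (e : Expr)
  | pred (e : Expr)

/-- The value of an expression (the predecessor of `0` is `0`). -/
def Expr.eval (s : State) : Expr → ℕ
  | .lit c => c
  | .var x => s.var x
  | .get a e => s.arr a (e.eval s)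
  | .succ e => e.eval s + 1
  | .pred e => e.eval s - 1

/-- Evaluating an expression costs one step per node. -/
def Expr.cost : Expr → ℕ
  | .lit _ => 1
  | .var _ => 1
  | .get _ e => e.cost + 1
  | .succ e => e.cost + 1
  | .pred e => e.cost + 1

/-- Tests. -/
inductive Test where
  | eq (e₁ e₂ : Expr)
  | lt (e₁ e₂ : Expr)
  | not (b : Test)
  | and (b₁ b₂ : Test)

/-- The truth value of a test. -/
def Test.eval (s : State) : Test → Bool
  | .eq e₁ e₂ => decide (e₁.eval s = e₂.eval s)
  | .lt e₁ e₂ => decide (e₁.eval s < e₂.eval s)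
  | .not b => !(b.eval s)
  | .and b₁ b₂ => b₁.eval s && b₂.eval s

/-- Evaluating a test costs one step per node. -/
def Test.cost : Test → ℕ
  | .eq e₁ e₂ => e₁.cost + e₂.cost + 1
  | .lt e₁ e₂ => e₁.cost + e₂.cost + 1
  | .not b => b.cost + 1
  | .and b₁ b₂ => b₁.cost + b₂.cost + 1

/-- Programs: `x := e`, `a[i] := e`, sequencing, branching and while loops. -/
inductive Prog where
  | skip
  | assign (x : ℕ) (e : Expr)
  | store (a : ℕ) (i e : Expr)
  | seq (p q : Prog)
  | ite (b : Test) (p q : Prog)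
  | loop (b : Test) (p : Prog)

/-- The state after `x := k`. -/
def State.setVar (s : State) (x k : ℕ) : State :=
  { s with var := Function.update s.var x k }

/-- The state after `a[i] := k`. -/
def State.setArr (s : State) (a i k : ℕ) : State :=
  { s with arr := Function.update s.arr a (Function.update (s.arr a) i k) }

/-- `Exec p s t s'`: started in state `s`, the program `p` halts after exactly `t` steps, in
state `s'`. -/
inductive Exec : Prog → State → ℕ → State → Prop where
  | skip (s : State) : Exec .skip s 1 s
  | assign (x : ℕ) (e : Expr) (s : State) :
      Exec (.assign x e) s (e.cost + 1) (s.setVar x (e.eval s))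
  | store (a : ℕ) (i e : Expr) (s : State) :
      Exec (.store a i e) s (i.cost + e.cost + 1) (s.setArr a (i.eval s) (e.eval s))
  | seq {p q : Prog} {s s' s'' : State} {t t' : ℕ} (hp : Exec p s t s') (hq : Exec q s' t' s'') :
      Exec (.seq p q) s (t + t') s''
  | iteTrue {b : Test} {p q : Prog} {s s' : State} {t : ℕ} (hb : b.eval s = true)
      (hp : Exec p s t s') : Exec (.ite b p q) s (b.cost + 1 + t) s'
  | iteFalse {b : Test} {p q : Prog} {s s' : State} {t : ℕ} (hb : b.eval s = false)
      (hq : Exec q s t s') : Exec (.ite b p q) s (b.cost + 1 + t) s'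
  | loopTrue {b : Test} {p : Prog} {s s' s'' : State} {t t' : ℕ} (hb : b.eval s = true)
      (hp : Exec p s t s') (hl : Exec (.loop b p) s' t' s'') :
      Exec (.loop b p) s (b.cost + 1 + t + t') s''
  | loopFalse {b : Test} {p : Prog} {s : State} (hb : b.eval s = false) :
      Exec (.loop b p) s (b.cost + 1) s

end RAM

/-! ### Adjacency lists as machine input -/

namespace SimpleGraph

/-- `adj` is an adjacency list representation of `G`: the list of `u` holds each neighbour of `u`
exactly once, in an arbitrary order. -/
def IsAdjLists {n : ℕ} (G : SimpleGraph (Fin n)) (adj : Fin n → List (Fin n)) : Prop :=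
  ∀ u, (adj u).Nodup ∧ ∀ v, v ∈ adj u ↔ G.Adj u v

end SimpleGraph

namespace RAM

/-- The initial memory for a graph with vertices `0, …, n - 1` and adjacency lists `adj`:
variable `0` holds `n`, array `1` holds the concatenation of the lists of `0, 1, …, n - 1`, and
array `0` holds at `i ≤ n` the position in array `1` where the list of `i` starts (at `n`: the
total length), so that the list of `i` fills the positions from `a₀[i]` to `a₀[i + 1] - 1`.
All other cells are `0`. -/
def graphInput {n : ℕ} (adj : Fin n → List (Fin n)) : State where
  var := Function.update (fun _ => 0) 0 n
  arr := Function.update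
    (Function.update (fun _ _ => 0) 0
      (fun i => if i ≤ n then ∑ j : Fin n with j.val < i, (adj j).length else 0))
    1 (fun p => (((List.ofFn adj).flatten).map Fin.val).getD p 0)

/-- The output convention: the position of vertex `u` on the line is cell `u` of array `2`. -/
def positions {n : ℕ} (s : State) (u : Fin n) : ℕ := s.arr 2 u.val

end RAM

/-! ### AT-free graphs and line embeddings -/

namespace SimpleGraph

/-- Some path from `a` to `b` avoids the neighbourhood of `c`. -/
def JoinedAvoidingNeighbors {V : Type*} (G : SimpleGraph V) (a b c : V) : Prop :=
  ∃ p : G.Walk a b, p.IsPath ∧ ∀ v ∈ p.support, ¬ G.Adj c v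

/-- Three distinct, pairwise non-adjacent vertices, each two of them joined by a path that avoids
the neighbourhood of the third. -/
structure IsAsteroidalTriple {V : Type*} (G : SimpleGraph V) (a b c : V) : Prop where
  ne_ab : a ≠ b
  ne_ac : a ≠ c
  ne_bc : b ≠ c
  not_adj_ab : ¬ G.Adj a b
  not_adj_ac : ¬ G.Adj a c
  not_adj_bc : ¬ G.Adj b c
  path_ab : G.JoinedAvoidingNeighbors a b c
  path_ac : G.JoinedAvoidingNeighbors a c b
  path_bc : G.JoinedAvoidingNeighbors b c a

/-- AT-free graphs: no asteroidal triple. -/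
def IsATFree {V : Type*} (G : SimpleGraph V) : Prop :=
  ∀ a b c : V, ¬ G.IsAsteroidalTriple a b c

/-- `f` is a non-contractive embedding of `G` into the line with distortion at most `k`. -/
def IsLineEmbedding {V : Type*} (G : SimpleGraph V) (f : V → ℝ) (k : ℝ) : Prop :=
  ∀ x y : V, (G.dist x y : ℝ) ≤ |f x - f y| ∧ |f x - f y| ≤ k * (G.dist x y : ℝ)

/-- The minimum line-distortion of `G` (meant for connected finite graphs with at least two
vertices, where the set is non-empty and bounded below by `1`). -/
noncomputable def lineDistortion {V : Type*} (G : SimpleGraph V) : ℝ :=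
  sInf {k : ℝ | ∃ f : V → ℝ, G.IsLineEmbedding f k}

/-- The walk `π = (v₀, …, v_k)` is a dominating path, it runs through the BFS layers
`L_i = {u | d(v₀, u) = i}`, `0 ≤ i ≤ k`, of its first vertex with `v_i ∈ L_i`, these are all the
layers, and every vertex of a layer `L_i`, `i ≥ 1`, is adjacent to `v_i` or to `v_{i-1}`. -/
structure IsLayeredDominatingPath {V : Type*} (G : SimpleGraph V) {a b : V} (π : G.Walk a b) :
    Prop where
  isPath : π.IsPath
  dominating : ∀ u : V, ∃ w ∈ π.support, u = w ∨ G.Adj u w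
  mem_layer : ∀ i ≤ π.length, G.dist a (π.getVert i) = i
  layers : ∀ u : V, G.dist a u ≤ π.length
  adj : ∀ (i : ℕ) (u : V), G.dist a u = i + 1 →
    G.Adj u (π.getVert (i + 1)) ∨ G.Adj u (π.getVert i)

/-- The set `X_i` of the vertices of layer `i` that are adjacent to `v_i`. -/
def nearGroup {V : Type*} (G : SimpleGraph V) {a b : V} (π : G.Walk a b) (i : ℕ) : Set V :=
  {x | G.dist a x = i ∧ G.Adj (π.getVert i) x}

/-- The set `L_i \ ({v_i} ∪ X_i)`. -/
def farGroup {V : Type*} (G : SimpleGraph V) {a b : V} (π : G.Walk a b) (i : ℕ) : Set V :=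
  {x | G.dist a x = i ∧ x ≠ π.getVert i ∧ ¬ G.Adj (π.getVert i) x}

/-- `f` places the vertices layer by layer, in layer `i` first the far group, then the near
group, then `v_i`, and two vertices that are placed next to each other are placed at a distance
that equals their distance in `G`. -/
structure IsLayeredArrangement {V : Type*} (G : SimpleGraph V) {a b : V} (π : G.Walk a b)
    (f : V → ℕ) : Prop where
  layer_lt : ∀ x y : V, G.dist a x < G.dist a y → f x < f y
  far_lt_near : ∀ i ≤ π.length, ∀ x ∈ G.farGroup π i, ∀ y ∈ G.nearGroup π i, f x < f y
  far_lt_path : ∀ i ≤ π.length, ∀ x ∈ G.farGroup π i, f x < f (π.getVert i)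
  near_lt_path : ∀ i ≤ π.length, ∀ x ∈ G.nearGroup π i, f x < f (π.getVert i)
  gap : ∀ x y : V, f x < f y → (∀ z : V, ¬ (f x < f z ∧ f z < f y)) → f y = f x + G.dist x y

end SimpleGraph

/-! ### Walks that avoid a neighbourhood -/

namespace SimpleGraph

section Avoiding

variable {V : Type*} {G : SimpleGraph V}

/-! Two facts carry the proof: in an AT-free graph some path `v 0, …, v k` descends the BFS layers
of `v 0` so that every vertex of layer `i + 1` is adjacent to `v (i + 1)` or `v i`; and the layout
along such a path stretches each edge by at most eight times the optimum.

The path. Run BFS from some `s` and take, in the last layer, a vertex `m` with fewest lower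
neighbours. The end class consists of the last-layer vertices whose lower neighbours are all lower
neighbours of `m`; within it let `r` have fewest neighbours in the rest of the layer. A
non-neighbour of `r` then either reaches `s` off N(r), that is, it is free, or lies in the end class
and has the same neighbours outside the class as `r` (`IsStart.free_or`). Two free vertices are
joined off N(r) through `s`, so AT-freeness forbids that each also reaches `r` off the neighbourhood
of the other (`IsStart.not_unrelated`). Hence non-adjacent free vertices in one layer of `r` have
nested sets of lower neighbours (`IsStart.nested`). Descend from the last layer of `r`, always to a
vertex with fewest lower neighbours: a free vertex missed by `v (i + 1)` and `v i` would have been a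
better choice than `v (i + 1)`, or would form an asteroidal triple with `v (i + 2)` and `r`. The
exceptions that are not free lie within distance two of `r`; a tie-break at distance one in favour
of vertices near `s` settles them (`IsStart.IsKeyPath.adj`).

The distortion. Placing consecutive vertices at their graph distance is non-contractive by the
triangle inequality. A step of length three occurs only from a far group to a near group, and a step
of length one into the far group pays for it. With `slack` as the potential, the stretch is at most
twice the difference in rank, plus one inside a layer (`IsSpine.dist_add_slack_le`). The vertices
between two adjacent ones fill at most one or two layers, a set of diameter at most 3 or 4; an
embedding of distortion κ allows at most κD + 1 vertices in a set of diameter D. So an edge is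
stretched by at most 6κ + 1 or 8κ.

The running time. Two breadth-first searches, a bounded number of passes over the adjacency lists
and a bucket sort yield the order. Consecutive vertices are at distance at most three, so testing
for an edge and for a common neighbour determines the distance. -/

theorem JoinedAvoidingNeighbors.of_walk {a b c : V} (p : G.Walk a b)
    (hp : ∀ v ∈ p.support, ¬ G.Adj c v) : G.JoinedAvoidingNeighbors a b c := by
  classical
  exact ⟨p.bypass, p.bypass_isPath, fun v hv => hp v (p.support_bypass_subset_support hv)⟩

theorem JoinedAvoidingNeighbors.refl {a c : V} (h : ¬ G.Adj c a) :
    G.JoinedAvoidingNeighbors a a c :=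
  .of_walk .nil (by simpa using h)

theorem JoinedAvoidingNeighbors.symm {a b c : V} (h : G.JoinedAvoidingNeighbors a b c) :
    G.JoinedAvoidingNeighbors b a c := by
  obtain ⟨p, -, hp⟩ := h
  exact .of_walk p.reverse (by simpa using hp)

theorem JoinedAvoidingNeighbors.trans {a b c d : V} (h : G.JoinedAvoidingNeighbors a b d)
    (h' : G.JoinedAvoidingNeighbors b c d) : G.JoinedAvoidingNeighbors a c d := by
  obtain ⟨p, -, hp⟩ := h
  obtain ⟨q, -, hq⟩ := h'
  refine .of_walk (p.append q) fun v hv => ?_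
  rcases (Walk.mem_support_append_iff p q).1 hv with h | h
  exacts [hp v h, hq v h]

theorem JoinedAvoidingNeighbors.cons {a b c d : V} (hab : G.Adj a b) (ha : ¬ G.Adj d a)
    (h : G.JoinedAvoidingNeighbors b c d) : G.JoinedAvoidingNeighbors a c d := by
  obtain ⟨p, -, hp⟩ := h
  refine .of_walk (p.cons hab) fun v hv => ?_
  rcases List.mem_cons.1 (by simpa using hv) with rfl | h
  exacts [ha, hp v h]

theorem Connected.dist_le_succ (hG : G.Connected) {u x : V} (h : G.Adj u x) (s : V) :
    G.dist s x ≤ G.dist s u + 1 := by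
  have := hG.dist_triangle (u := s) (v := u) (w := x)
  rwa [dist_eq_one_iff_adj.2 h] at this

theorem Connected.exists_adj_dist (hG : G.Connected) {s u : V} {j : ℕ} (h : G.dist s u = j + 1) :
    ∃ x, G.Adj u x ∧ G.dist s x = j := by
  obtain ⟨p, hp⟩ := hG.exists_walk_length_eq_dist u s
  rw [dist_comm, h] at hp
  cases p with
  | nil => simp at hp
  | @cons _ x _ hx q =>
    refine ⟨x, hx, ?_⟩
    have h1 := dist_le q
    rw [Walk.length_cons] at hp
    have h2 := hG.dist_le_succ hx.symm s
    rw [dist_comm] at h1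
    omega

/-- A vertex of layer `i` is joined to the centre of the layers by a path that avoids the
neighbourhood of any non-neighbour in a layer `≥ i` whose neighbours are all in layers `≥ i`. -/
theorem Connected.joined_of_dist (hG : G.Connected) {r c : V} :
    ∀ {i : ℕ} {u : V}, G.dist r u = i → ¬ G.Adj c u → (∀ x, G.Adj c x → i ≤ G.dist r x) →
      G.JoinedAvoidingNeighbors u r c := by
  intro i
  induction i with
  | zero =>
    intro u hu hc _
    rw [hG.dist_eq_zero_iff] at hu
    subst hu
    exact .refl hc
  | succ i ih =>
    intro u hu hc h
    obtain ⟨x, hx, hxi⟩ := hG.exists_adj_dist hu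
    refine .cons hx hc (ih hxi (fun hcx => ?_) fun y hy => ?_)
    · have := h x hcx
      omega
    · have := h y hy
      omega

end Avoiding

/-! ### Layers -/

section Layers

variable {V : Type*} [Fintype V] (G : SimpleGraph V)

open Classical in
/-- The neighbours of `u` that are nearer to `s`. -/
noncomputable def downSet (s u : V) : Finset V :=
  Finset.univ.filter fun x => G.Adj u x ∧ G.dist s x < G.dist s u

variable {G}

@[simp] theorem mem_downSet {s u x : V} :
    x ∈ G.downSet s u ↔ G.Adj u x ∧ G.dist s x < G.dist s u := by
  simp [downSet]

theorem Connected.dist_of_mem_downSet (hG : G.Connected) {s u x : V} (h : x ∈ G.downSet s u) :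
    G.dist s x + 1 = G.dist s u := by
  rw [mem_downSet] at h
  have := hG.dist_le_succ h.1.symm s
  omega

/-- Two non-adjacent vertices that reach `r` without meeting the neighbourhood of each other. -/
def Unrelated (G : SimpleGraph V) (r u w : V) : Prop :=
  u ≠ w ∧ ¬ G.Adj u w ∧ G.JoinedAvoidingNeighbors u r w ∧ G.JoinedAvoidingNeighbors w r u

/-- Each vertex steps to its private lower neighbour and descends from there. The other one has no
neighbours below that layer, so the descent could meet its neighbourhood only at the first vertex,
which is private. -/
theorem Connected.unrelated_of_same_layer (hG : G.Connected) {r u w a b : V}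
    (huw : ¬ G.Adj u w) (hd : G.dist r u = G.dist r w)
    (ha : a ∈ G.downSet r u) (ha' : a ∉ G.downSet r w)
    (hb : b ∈ G.downSet r w) (hb' : b ∉ G.downSet r u) : G.Unrelated r u w := by
  have key : ∀ {u w a : V}, ¬ G.Adj u w → G.dist r u = G.dist r w → a ∈ G.downSet r u →
      a ∉ G.downSet r w → G.JoinedAvoidingNeighbors u r w := by
    intro u w a huw hd ha ha'
    have h1 := hG.dist_of_mem_downSet ha
    rw [mem_downSet] at ha ha'
    refine .cons ha.1 (fun h => huw h.symm) (hG.joined_of_dist rfl ?_ fun x hx => ?_)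
    · intro h
      exact ha' ⟨h, by omega⟩
    · have := hG.dist_le_succ hx.symm r
      omega
  refine ⟨?_, huw, key huw hd ha ha', key (fun h => huw h.symm) hd.symm hb hb'⟩
  rintro rfl
  exact ha' ha

/-- The neighbours of `u` lie no lower than the layer of `b`, so `w`, `a`, `b` and any further
descent miss them. The neighbours of `w` lie no lower than the layer of `u`, so a descent from `u`
misses them. -/
theorem Connected.unrelated_of_next_layer (hG : G.Connected) {r u w a b : V}
    (hd : G.dist r w = G.dist r u + 1) (huw : ¬ G.Adj u w)
    (ha : a ∈ G.downSet r w) (hua : ¬ G.Adj u a) (hb : b ∈ G.downSet r a) (hub : ¬ G.Adj u b) :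
    G.Unrelated r u w := by
  have h1 := hG.dist_of_mem_downSet ha
  have h2 := hG.dist_of_mem_downSet hb
  rw [mem_downSet] at ha hb
  refine ⟨?_, huw, hG.joined_of_dist rfl (fun h => huw h.symm) fun x hx => ?_,
    .cons ha.1 huw (.cons hb.1 hua (hG.joined_of_dist rfl hub fun x hx => ?_))⟩
  · rintro rfl
    omega
  · have := hG.dist_le_succ hx.symm r
    omega
  · have := hG.dist_le_succ hx.symm r
    omega

/-! ### A good start vertex -/

/-- The vertices of the last layer of `s` (the one that holds `m`) all of whose lower neighbours
are lower neighbours of `m`. -/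
def endClass (G : SimpleGraph V) (s m : V) : Set V :=
  {u | G.dist s u = G.dist s m ∧ ∀ x ∈ G.downSet s u, x ∈ G.downSet s m}

open Classical in
/-- The neighbours of `u` in the last layer of `s` that are outside the end class. -/
noncomputable def outSet (G : SimpleGraph V) (s m u : V) : Finset V :=
  Finset.univ.filter fun x => G.Adj u x ∧ G.dist s x = G.dist s m ∧ x ∉ G.endClass s m

@[simp] theorem mem_outSet {s m u x : V} :
    x ∈ G.outSet s m u ↔ G.Adj u x ∧ G.dist s x = G.dist s m ∧ x ∉ G.endClass s m := by
  simp [outSet]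

/-- `r` is in the last layer of `s`, with the least number of lower neighbours and, among the
vertices with the same lower neighbours, with the least number of neighbours in the remainder of
the layer. -/
structure IsStart (G : SimpleGraph V) (s m r : V) : Prop where
  far : ∀ u, G.dist s u ≤ G.dist s m
  pos : 0 < G.dist s m
  down_min : ∀ u, G.dist s u = G.dist s m → (G.downSet s m).card ≤ (G.downSet s u).card
  mem : r ∈ G.endClass s m
  out_min : ∀ u ∈ G.endClass s m, (G.outSet s m r).card ≤ (G.outSet s m u).card

namespace IsStart

variable {s m r : V}

theorem downSet_eq (h : G.IsStart s m r) {u : V} (hu : u ∈ G.endClass s m) :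
    G.downSet s u = G.downSet s m :=
  Finset.eq_of_subset_of_card_le (fun x hx => hu.2 x hx) (h.down_min u hu.1)

/-- The vertices outside the neighbourhood of `r` that are joined to `s` without meeting it. -/
def Free (G : SimpleGraph V) (s r u : V) : Prop :=
  ¬ G.Adj r u ∧ G.JoinedAvoidingNeighbors u s r

/-- A descent to `s` can be kept off N(r). From a lower layer the next vertex is at least two layers
below `r`; from the last layer one can leave through a lower neighbour that `m` lacks, and `r` has
the same lower neighbours as `m`. -/
theorem free_of_not_mem (h : G.IsStart s m r) (hG : G.Connected) {u : V} (hr : ¬ G.Adj r u)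
    (hu : u ∉ G.endClass s m) : Free G s r u := by
  refine ⟨hr, ?_⟩
  obtain ⟨i, hi⟩ : ∃ i, G.dist s u = i := ⟨_, rfl⟩
  induction i generalizing u with
  | zero =>
    rw [hG.dist_eq_zero_iff] at hi
    subst hi
    exact .refl hr
  | succ i ih =>
    have hle := h.far u
    by_cases hK : i + 1 = G.dist s m
    · have : ∃ x ∈ G.downSet s u, x ∉ G.downSet s m := by
        by_contra! hcon
        exact hu ⟨by omega, hcon⟩
      obtain ⟨x, hx, hxm⟩ := this
      have hxd := hG.dist_of_mem_downSet hx
      rw [mem_downSet] at hx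
      refine .cons hx.1 hr (ih (fun hrx => hxm ?_) (fun hxM => ?_) (by omega))
      · rw [← h.downSet_eq h.mem, mem_downSet]
        exact ⟨hrx, by rw [h.mem.1]; omega⟩
      · have := hxM.1
        omega
    · obtain ⟨x, hx, hxd⟩ := hG.exists_adj_dist hi
      refine .cons hx hr (ih (fun hrx => ?_) (fun hxM => ?_) hxd)
      · have := hG.dist_le_succ hrx.symm s
        rw [h.mem.1] at this
        omega
      · have := hxM.1
        omega

/-- A vertex that is not free has the same neighbours outside the end class as `r`. -/
theorem free_or (h : G.IsStart s m r) (hG : G.Connected) {u : V} (hr : ¬ G.Adj r u) :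
    Free G s r u ∨ (u ∈ G.endClass s m ∧ ∀ x, x ∉ G.endClass s m → (G.Adj u x ↔ G.Adj r x)) := by
  by_cases hu : u ∈ G.endClass s m
  swap
  · exact .inl (h.free_of_not_mem hG hr hu)
  by_cases hex : ∃ c, G.Adj u c ∧ ¬ G.Adj r c ∧ c ∉ G.endClass s m
  · obtain ⟨c, huc, hrc, hc⟩ := hex
    exact .inl ⟨hr, .cons huc hr (h.free_of_not_mem hG hrc hc).2⟩
  push Not at hex
  right
  refine ⟨hu, fun x hx => ⟨fun hux => by_contra fun hrx => hx (hex x hux hrx), fun hrx => ?_⟩⟩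
  -- With no escape through a non-neighbour of `r`, all neighbours of `u` outside the class are
  -- neighbours of `r`; the minimality of `r` turns the inclusion into an equality.
  have hsub : G.outSet s m u ⊆ G.outSet s m r := by
    intro y hy
    rw [mem_outSet] at hy ⊢
    exact ⟨by_contra fun hry => hy.2.2 (hex y hy.1 hry), hy.2⟩
  have heq := Finset.eq_of_subset_of_card_le hsub (h.out_min u hu)
  by_cases hxK : G.dist s x = G.dist s m
  · have : x ∈ G.outSet s m u := by
      rw [heq, mem_outSet]
      exact ⟨hrx, hxK, hx⟩
    rw [mem_outSet] at this
    exact this.1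
  · have : x ∈ G.downSet s u := by
      rw [h.downSet_eq hu, ← h.downSet_eq h.mem, mem_downSet]
      refine ⟨hrx, ?_⟩
      have := h.far x
      rw [h.mem.1]
      omega
    rw [mem_downSet] at this
    exact this.1

/-- The triple is `u`, `w`, `r`: freeness joins `u` to `w` through `s` off N(r), and being unrelated
supplies the other two paths. -/
theorem not_unrelated {V : Type*} {G : SimpleGraph V} {s r : V} (hAT : G.IsATFree) {u w : V}
    (hu : Free G s r u) (hw : Free G s r w) : ¬ G.Unrelated r u w := by
  rintro ⟨hne, hadj, h1, h2⟩
  -- If `u = r`, the path from `w` off the neighbourhood of `u` ends at `u`, but its last vertex but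
  -- one is a neighbour of `u`.
  have hur : u ≠ r := by
    rintro rfl
    obtain ⟨p, -, hp⟩ := h2
    cases hp' : p.reverse with
    | nil => exact hne rfl
    | @cons _ x _ hx q =>
      refine hp x ?_ hx
      rw [← List.mem_reverse, ← Walk.support_reverse, hp']
      simp
  have hwr : w ≠ r := by
    rintro rfl
    obtain ⟨p, -, hp⟩ := h1
    cases hp' : p.reverse with
    | nil => exact hne rfl
    | @cons _ x _ hx q =>
      refine hp x ?_ hx
      rw [← List.mem_reverse, ← Walk.support_reverse, hp']
      simp
  exact hAT u w r ⟨hne, hur, hwr, hadj, fun h => hu.1 h.symm, fun h => hw.1 h.symm,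
    hu.2.trans hw.2.symm, h1, h2⟩

/-- A private lower neighbour on each side would make the pair unrelated. -/
theorem nested (hG : G.Connected) (hAT : G.IsATFree) {u w a : V}
    (hu : Free G s r u) (hw : Free G s r w) (huw : ¬ G.Adj u w) (hd : G.dist r u = G.dist r w)
    (ha : a ∈ G.downSet r u) (ha' : a ∉ G.downSet r w) : G.downSet r w ⊆ G.downSet r u := by
  intro b hb
  by_contra hb'
  exact not_unrelated hAT hu hw (hG.unrelated_of_same_layer huw hd ha ha' hb hb')

theorem adj_of_mem_down (h : G.IsStart s m r) {u x : V} (hu : u ∈ G.endClass s m)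
    (hx : x ∈ G.downSet s m) : G.Adj u x := by
  rw [← h.downSet_eq hu, mem_downSet] at hx
  exact hx.1

/-- A vertex at distance two from `r` with a neighbour in the end class that is adjacent to `r`
is adjacent to all lower neighbours of the end class. -/
theorem adj_down (h : G.IsStart s m r) (hG : G.Connected) (hAT : G.IsATFree) {u c x : V}
    (hu : G.dist r u = 2) (huc : G.Adj u c) (hrc : G.Adj r c) (hc : c ∈ G.endClass s m)
    (hx : x ∈ G.downSet s m) : G.Adj u x := by
  by_contra hux
  have hru : ¬ G.Adj r u := by
    intro hadj
    rw [dist_eq_one_iff_adj.2 hadj] at hu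
    omega
  have huM : u ∉ G.endClass s m := fun hM => hux (h.adj_of_mem_down hM hx)
  have hxd := hG.dist_of_mem_downSet hx
  have hrx := h.adj_of_mem_down h.mem hx
  -- Below the last layer `u` would be a lower neighbour of `c`, hence of every vertex of the end
  -- class, `r` included.
  have huK : G.dist s u = G.dist s m := by
    refine le_antisymm (h.far u) ?_
    by_contra! hlt
    refine hru (h.adj_of_mem_down h.mem ?_)
    rw [← h.downSet_eq hc, mem_downSet]
    exact ⟨huc.symm, by rw [hc.1]; exact hlt⟩
  -- If `x = s`, the last layer is layer one, where `s` is the only lower neighbour, and `u` would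
  -- be in the end class.
  have hpos : G.dist s x ≠ 0 := by
    intro h0
    refine huM ⟨huK, fun y hy => ?_⟩
    have hy' := hG.dist_of_mem_downSet hy
    have h1 : G.dist s y = 0 := by omega
    rw [hG.dist_eq_zero_iff] at h0 h1
    subst h0
    rwa [← h1]
  obtain ⟨j, hj⟩ := Nat.exists_eq_succ_of_ne_zero hpos
  -- Two layers below the last one, `b` is adjacent to none of `r`, `u`, `c`. So `b` and `u` are
  -- free, at distance two from `r`, with private lower neighbours `x` and `c`, against `nested`.
  obtain ⟨b, hxb, hbj⟩ := hG.exists_adj_dist hj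
  have hrb : ¬ G.Adj r b := by
    intro hadj
    have := hG.dist_le_succ hadj.symm s
    rw [h.mem.1] at this
    omega
  have hbM : b ∉ G.endClass s m := fun hM => by
    have := hM.1
    omega
  have hbr : b ≠ r := by
    rintro rfl
    exact hbM h.mem
  have hb2 : G.dist r b = 2 := by
    have h1 := hG.dist_le_succ hxb r
    rw [dist_eq_one_iff_adj.2 hrx] at h1
    have h2 : G.dist r b ≠ 1 := fun h => hrb (dist_eq_one_iff_adj.1 h)
    have h3 := hG.pos_dist_of_ne hbr.symm
    omega
  have hub : ¬ G.Adj b u := by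
    intro hadj
    have := hG.dist_le_succ hadj s
    omega
  have hbc : ¬ G.Adj b c := by
    intro hadj
    have := hG.dist_le_succ hadj s
    rw [hc.1] at this
    omega
  have hr1 := dist_eq_one_iff_adj.2 hrx
  have hr2 := dist_eq_one_iff_adj.2 hrc
  have := nested hG hAT (h.free_of_not_mem hG hrb hbM) (h.free_of_not_mem hG hru huM) hub
    (by omega) (a := x) (by rw [mem_downSet]; exact ⟨hxb.symm, by omega⟩)
    (by rw [mem_downSet]; exact fun h => hux h.1)
    (show c ∈ _ by rw [mem_downSet]; exact ⟨huc, by omega⟩)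
  rw [mem_downSet] at this
  exact hbc this.1

/-! ### Paths of least key -/

/-- The key by which the vertices of the path are chosen. -/
noncomputable def key (G : SimpleGraph V) (s r u : V) : ℕ :=
  (G.downSet r u).card + if G.dist r u ≤ 1 then G.dist s u + 1 else 0

/-- `v` descends from the last layer of `r`, always to a vertex of least key. -/
structure IsKeyPath (G : SimpleGraph V) (s r : V) (k : ℕ) (v : ℕ → V) : Prop where
  far : ∀ u, G.dist r u ≤ k
  dist_last : G.dist r (v k) = k
  last_min : ∀ u, G.dist r u = k → key G s r (v k) ≤ key G s r u
  mem : ∀ i < k, v i ∈ G.downSet r (v (i + 1))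
  min : ∀ i < k, ∀ x ∈ G.downSet r (v (i + 1)), key G s r (v i) ≤ key G s r x

theorem IsKeyPath.dist_eq {k : ℕ} {v : ℕ → V} (hG : G.Connected) (hv : IsKeyPath G s r k v)
    {i : ℕ} (hi : i ≤ k) : G.dist r (v i) = i := by
  induction hi using Nat.decreasingInduction with
  | self => exact hv.dist_last
  | of_succ j hj ih =>
    have := hG.dist_of_mem_downSet (hv.mem j hj)
    omega

theorem key_of_two_le {u : V} (h : 2 ≤ G.dist r u) : key G s r u = (G.downSet r u).card := by
  rw [key, if_neg (by omega), add_zero]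

/-- The only lower neighbour of a neighbour of `r` is `r`, so at distance one the key compares
distances from `s` alone; this is the tie-break. The `+ 1` inside the key agrees with the search,
which stores distances plus one. -/
theorem key_of_adj (hG : G.Connected) {u : V} (h : G.Adj r u) :
    key G s r u = G.dist s u + 2 := by
  have h1 := dist_eq_one_iff_adj.2 h
  have : G.downSet r u = {r} := by
    ext x
    rw [mem_downSet, Finset.mem_singleton]
    constructor
    · rintro ⟨-, hx⟩
      rw [h1, Nat.lt_one_iff, hG.dist_eq_zero_iff] at hx
      exact hx.symm
    · rintro rfl
      exact ⟨h.symm, by simp [h1]⟩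
  rw [key, if_pos h1.le, this, Finset.card_singleton]
  omega

/-- The lower neighbour of the path at distance one is in the lowest possible layer of `s`. -/
theorem IsKeyPath.first_mem {k : ℕ} {v : ℕ → V} (h : G.IsStart s m r) (hG : G.Connected)
    (hv : IsKeyPath G s r k v) (hk : 2 ≤ k) {x : V} (hx : x ∈ G.downSet s m)
    (hadj : G.Adj (v 2) x) : v 1 ∈ G.downSet s m := by
  have hrx := h.adj_of_mem_down h.mem hx
  have hr1 : G.Adj r (v 1) := dist_eq_one_iff_adj.1 (hv.dist_eq hG (by omega))
  have := hv.min 1 (by omega) x (by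
    rw [mem_downSet, hv.dist_eq hG (by omega : 1 + 1 ≤ k), dist_eq_one_iff_adj.2 hrx]
    exact ⟨hadj, by omega⟩)
  rw [key_of_adj hG hr1, key_of_adj hG hrx] at this
  have hxd := hG.dist_of_mem_downSet hx
  rw [← h.downSet_eq h.mem, mem_downSet, h.mem.1]
  exact ⟨hr1, by omega⟩

/-- Let `u` be missed by both. If `u` and `v (i + 1)` are free, the lower neighbours of `u` form a
proper subset of those of `v (i + 1)`, so `u` has the smaller key. If one of them is not free, it
agrees with `r` outside the end class; this forces `i = 1`, where `adj_down` and the tie-break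
decide. -/
theorem IsKeyPath.adj {k : ℕ} {v : ℕ → V} (h : G.IsStart s m r) (hG : G.Connected)
    (hAT : G.IsATFree) (hv : IsKeyPath G s r k v) {i : ℕ} {u : V} (hu : G.dist r u = i + 1) :
    G.Adj u (v (i + 1)) ∨ G.Adj u (v i) := by
  have hik : i + 1 ≤ k := hu ▸ hv.far u
  have hvi := hv.dist_eq hG (i := i) (by omega)
  have hvi1 := hv.dist_eq hG hik
  rcases Nat.eq_zero_or_pos i with rfl | hi
  · right
    rw [hG.dist_eq_zero_iff] at hvi
    rw [← hvi]
    exact (dist_eq_one_iff_adj.1 hu).symm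
  by_contra! hcon
  obtain ⟨hn1, hn0⟩ := hcon
  have hmem : v i ∈ G.downSet r (v (i + 1)) := hv.mem i (by omega)
  have hnmem : v i ∉ G.downSet r u := by
    rw [mem_downSet]
    exact fun h => hn0 h.1
  have hnadj : ∀ {x}, 2 ≤ G.dist r x → ¬ G.Adj r x := by
    intro x hx hadj
    rw [dist_eq_one_iff_adj.2 hadj] at hx
    omega
  -- In the last layer the choice of `v k` excludes such an inclusion: it would be proper, since `v
  -- i` is missing on the left.
  have hbad : ¬ G.downSet r u ⊆ G.downSet r (v (i + 1)) ∨ i + 1 < k := by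
    by_contra! hc
    obtain ⟨hsub, hle⟩ := hc
    obtain rfl : k = i + 1 := by omega
    have h1 := hv.last_min u hu
    rw [key_of_two_le (by omega), key_of_two_le (by omega)] at h1
    exact hnmem (Finset.eq_of_subset_of_card_le hsub h1 ▸ hmem)
  have hru := hnadj (x := u) (by omega)
  have hrv := hnadj (x := v (i + 1)) (by omega)
  have hS : ∃ a, a ∈ G.downSet s m := by
    obtain ⟨j, hj⟩ := Nat.exists_eq_succ_of_ne_zero h.pos.ne'
    obtain ⟨a, ha, haj⟩ := hG.exists_adj_dist hj
    exact ⟨a, by rw [mem_downSet]; exact ⟨ha, by omega⟩⟩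
  obtain ⟨a, ha⟩ := hS
  -- The end class shares the neighbour `a` with `r`, so nothing at distance three or more belongs
  -- to it.
  have hlow : ∀ {x}, x ∈ G.endClass s m → G.dist r x ≤ 2 := by
    intro x hx
    have h1 := h.adj_of_mem_down hx ha
    have h2 := hG.dist_le_succ h1.symm r
    rwa [dist_eq_one_iff_adj.2 (h.adj_of_mem_down h.mem ha)] at h2
  have hdown : ∀ {x}, x ∈ G.downSet s m → x ∉ G.endClass s m := by
    intro x hx hxM
    have := hG.dist_of_mem_downSet hx
    have := hxM.1
    omega
  rcases h.free_or hG hrv with hvf | ⟨hvM, hvB⟩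
  · rcases h.free_or hG hru with huf | ⟨huM, huB⟩
    · have hsub := nested hG hAT hvf huf (fun h => hn1 h.symm) (by omega) hmem hnmem
      rcases hbad with hbad | hlt
      · exact hbad hsub
      · have hnw : ¬ G.Adj u (v (i + 1 + 1)) := by
          intro hadj
          have h1 := hv.min (i + 1) hlt u (by
            rw [mem_downSet, hv.dist_eq hG (by omega : i + 1 + 1 ≤ k)]
            exact ⟨hadj.symm, by omega⟩)
          rw [key_of_two_le (by omega), key_of_two_le (by omega)] at h1
          exact hnmem (Finset.eq_of_subset_of_card_le hsub h1 ▸ hmem)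
        have hw := hv.dist_eq hG (by omega : i + 1 + 1 ≤ k)
        -- The partner of `u` is `v (i + 2)`, which descends through `v (i + 1)` and `v i`, both
        -- non-adjacent to `u`.
        refine not_unrelated hAT huf (h.free_of_not_mem hG (hnadj (by omega)) fun hM => ?_)
          (hG.unrelated_of_next_layer (by omega) hnw (hv.mem (i + 1) hlt) hn1 hmem hn0)
        have := hlow hM
        omega
    · have := hlow huM
      obtain rfl : i = 1 := by omega
      have hr1 : G.Adj r (v 1) := dist_eq_one_iff_adj.1 hvi
      -- Outside the class `u` and `r` have the same neighbours, and `v 1` is adjacent to `r` only.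
      -- But then `v 2` sees the lower neighbours of the class, and the tie-break would have chosen
      -- one of those.
      have hv1 : v 1 ∈ G.endClass s m := by
        by_contra hM
        exact hn0 ((huB _ hM).2 hr1)
      have hadj := h.adj_down hG hAT hvi1 (mem_downSet.1 hmem).1 hr1 hv1 ha
      exact hdown (hv.first_mem h hG (by omega) ha hadj) hv1
  · have := hlow hvM
    obtain rfl : i = 1 := by omega
    have hv1 := hv.first_mem h hG (by omega) ha (h.adj_of_mem_down hvM ha)
    -- Outside the class `v 2` has the neighbours of `r`. So it sees every lower neighbour `x` of
    -- `u`, since an `x` in the class would make `u` adjacent to `v 1`. And if `v 3` exists, it is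
    -- outside the class, so it would be adjacent to `r`.
    rcases hbad with hbad | hlt
    · refine hbad fun x hx => ?_
      have hxd := hG.dist_of_mem_downSet hx
      rw [mem_downSet] at hx ⊢
      have hrx : G.Adj r x := dist_eq_one_iff_adj.1 (by omega)
      refine ⟨(hvB x fun hxM => ?_).2 hrx, by omega⟩
      exact hn0 (h.adj_down hG hAT hu hx.1 hrx hxM hv1)
    · have hw := hv.dist_eq hG (by omega : 1 + 1 + 1 ≤ k)
      have hadj := (mem_downSet.1 (hv.mem (1 + 1) hlt)).1.symm
      refine hnadj (by omega) ((hvB (v (1 + 1 + 1)) fun hM => ?_).1 hadj)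
      have := hlow hM
      omega

end IsStart

end Layers

end SimpleGraph

namespace SimpleGraph

/-! ### The spine of the layers -/

section Spine

variable {V : Type*} {G : SimpleGraph V}

/-- A sequence `v 0, …, v k`, one vertex in each of the layers of `v 0`, with each vertex of
layer `i + 1` adjacent to `v (i + 1)` or to `v i`. -/
structure IsSpine (G : SimpleGraph V) (k : ℕ) (v : ℕ → V) : Prop where
  dist_eq : ∀ i ≤ k, G.dist (v 0) (v i) = i
  adj_succ : ∀ i < k, G.Adj (v i) (v (i + 1))
  far : ∀ u, G.dist (v 0) u ≤ k
  adj : ∀ i u, G.dist (v 0) u = i + 1 → G.Adj u (v (i + 1)) ∨ G.Adj u (v i)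

theorem exists_walk_of_adj {v : ℕ → V} {k : ℕ} (h : ∀ i < k, G.Adj (v i) (v (i + 1))) :
    ∃ π : G.Walk (v 0) (v k), π.length = k ∧ ∀ i ≤ k, π.getVert i = v i := by
  induction k generalizing v with
  | zero => exact ⟨.nil, rfl, fun i hi => by simp [Nat.le_zero.1 hi]⟩
  | succ k ih =>
    obtain ⟨π, hl, hπ⟩ := ih (v := fun i => v (i + 1)) fun i hi => h (i + 1) (by omega)
    refine ⟨.cons (h 0 (by omega)) π, by simp [hl], fun i hi => ?_⟩
    cases i with
    | zero => simp
    | succ i => exact (Walk.getVert_cons_succ ..).trans (hπ i (by omega))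

namespace IsSpine

variable {k : ℕ} {v : ℕ → V}

theorem isLayeredDominatingPath (h : G.IsSpine k v) (hG : G.Connected) {π : G.Walk (v 0) (v k)}
    (hl : π.length = k) (hπ : ∀ i ≤ k, π.getVert i = v i) : G.IsLayeredDominatingPath π where
  isPath := π.isPath_of_length_eq_dist (by rw [hl, h.dist_eq k le_rfl])
  dominating u := by
    have hu := h.far u
    have hmem : ∀ i ≤ k, v i ∈ π.support := fun i hi => hπ i hi ▸ π.getVert_mem_support i
    rcases Nat.eq_zero_or_eq_succ_pred (G.dist (v 0) u) with h0 | h0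
    · rw [hG.dist_eq_zero_iff] at h0
      exact ⟨v 0, hmem 0 (by omega), .inl h0.symm⟩
    · rcases h.adj _ u h0 with h1 | h1
      exacts [⟨_, hmem _ (by omega), .inr h1⟩, ⟨_, hmem _ (by omega), .inr h1⟩]
  mem_layer i hi := by rw [hπ i (hl ▸ hi), h.dist_eq i (hl ▸ hi)]
  layers u := hl.symm ▸ h.far u
  adj i u hu := by
    have := h.far u
    rw [hπ _ (by omega), hπ _ (by omega)]
    exact h.adj i u hu

/-! ### Rankings, placements and the slack estimate -/

/-- The place of a vertex in its layer: `0` for the far group, `1` for the near group and `2` for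
the vertex of the spine. -/
def IsClass (G : SimpleGraph V) (v : ℕ → V) (c : V → ℕ) : Prop :=
  ∀ u, (c u = 2 ∧ u = v (G.dist (v 0) u)) ∨
    (c u = 1 ∧ u ≠ v (G.dist (v 0) u) ∧ G.Adj (v (G.dist (v 0) u)) u) ∨
    (c u = 0 ∧ u ≠ v (G.dist (v 0) u) ∧ ¬ G.Adj (v (G.dist (v 0) u)) u)

/-- `rk` numbers the vertices layer by layer, and by class in each layer. -/
structure IsRanking (G : SimpleGraph V) (v : ℕ → V) (c rk : V → ℕ) : Prop where
  inj : Function.Injective rk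
  surj : ∀ u, ∀ j < rk u, ∃ w, rk w = j
  layer : ∀ x y, G.dist (v 0) x < G.dist (v 0) y → rk x < rk y
  cls : ∀ x y, G.dist (v 0) x = G.dist (v 0) y → c x < c y → rk x < rk y

variable {c rk f : V → ℕ}

theorem IsRanking.le_of_lt (hr : IsRanking G v c rk) {x y : V} (h : rk x < rk y) :
    G.dist (v 0) x ≤ G.dist (v 0) y := by
  by_contra! hlt
  have := hr.layer y x hlt
  omega

/-- The slack of a vertex. -/
noncomputable def slack (G : SimpleGraph V) (v : ℕ → V) (c : V → ℕ) (u : V) : ℕ :=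
  G.dist (v 0) u + if c u = 1 then 0 else 1

/-- The slack is a potential that grants two units per step. A step from the far to the near group
may cost three and lowers it by one. A step from the near group to the path vertex, or from the path
vertex to the next far group or the next path vertex, costs one and raises it by one. All other
steps cost at most two and leave it unchanged. -/
theorem dist_add_slack_le (h : G.IsSpine k v) (hG : G.Connected) (hc : IsClass G v c)
    (hr : IsRanking G v c rk) {x y : V} (hxy : rk y = rk x + 1) :
    G.dist x y + slack G v c y ≤ slack G v c x + 2 := by
  have hle := hr.le_of_lt (show rk x < rk y by omega)
  have hne : x ≠ y := by
    rintro rfl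
    omega
  have two : ∀ z, G.Adj x z → G.Adj y z → G.dist x y ≤ 2 := by
    intro z h1 h2
    have := hG.dist_triangle (u := x) (v := z) (w := y)
    rwa [dist_eq_one_iff_adj.2 h1, dist_eq_one_iff_adj.2 h2.symm] at this
  have hfx := h.far x
  have hfy := h.far y
  have hcx := hc x
  have hcy := hc y
  rcases hle.eq_or_lt with heq | hlt
  · have hcls : c x ≤ c y := by
      by_contra! hlt
      have := hr.cls y x heq.symm hlt
      omega
    rcases Nat.eq_zero_or_eq_succ_pred (G.dist (v 0) y) with h0 | h0
    · rw [h0] at heq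
      rw [hG.dist_eq_zero_iff] at heq h0
      exact absurd (heq.symm.trans h0) hne
    set i := (G.dist (v 0) y).pred with hi
    rw [heq, h0] at hcx
    rw [h0] at hcy
    have hax := h.adj i x (by omega)
    have hay := h.adj i y (by omega)
    have hsp := h.adj_succ i (by omega)
    rw [slack, slack, heq]
    -- Two near vertices meet at `v (i + 1)`; two far ones, or a far one and the path vertex, at `v
    -- i`; far to near goes through `v i` and `v (i + 1)`.
    rcases hcx with ⟨hx, hx'⟩ | ⟨hx, -, hx'⟩ | ⟨hx, -, hx'⟩ <;>
    rcases hcy with ⟨hy, hy'⟩ | ⟨hy, -, hy'⟩ | ⟨hy, -, hy'⟩ <;> simp only [hx, hy] at * <;>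
      norm_num at *
    · exact absurd (hx'.trans hy'.symm) hne
    · rw [hy', dist_eq_one_iff_adj.2 hx'.symm]
      omega
    · have := two _ hx'.symm hy'.symm
      omega
    · rw [← hy'] at hsp
      have hx2 : G.Adj x (v i) := hax.resolve_left fun h => hx' h.symm
      have := two _ hx2 hsp.symm
      omega
    · have hx2 : G.Adj x (v i) := hax.resolve_left fun h => hx' h.symm
      have h1 := hG.dist_triangle (u := x) (v := v i) (w := y)
      have h2 := hG.dist_triangle (u := v i) (v := v (i + 1)) (w := y)
      rw [dist_eq_one_iff_adj.2 hsp, dist_eq_one_iff_adj.2 hy'] at h2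
      rw [dist_eq_one_iff_adj.2 hx2] at h1
      omega
    · have := two _ (hax.resolve_left fun h => hx' h.symm) (hay.resolve_left fun h => hy' h.symm)
      omega
  · have hle1 : G.dist (v 0) y ≤ G.dist (v 0) x + 1 := by
      by_contra! hlt2
      have h1 := h.dist_eq (G.dist (v 0) x + 1) (by omega)
      have h2 := hr.layer x (v (G.dist (v 0) x + 1)) (by omega)
      have h3 := hr.layer (v (G.dist (v 0) x + 1)) y (by omega)
      omega
    obtain ⟨i, hi⟩ : ∃ i, G.dist (v 0) x = i := ⟨_, rfl⟩
    have hiy : G.dist (v 0) y = i + 1 := by omega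
    have hvi := h.dist_eq i (by omega)
    have hsp := h.adj_succ i (by omega)
    -- The path vertex comes last in its layer, so only it can precede a vertex of the next layer.
    have hx : x = v i := by
      by_contra hxv
      have h2 := hr.layer (v i) y (by omega)
      have h3 : rk x ≠ rk (v i) := fun h => hxv (hr.inj h)
      have h4 := hr.cls x (v i) (by omega)
      rw [hi] at hcx
      have h5 := hc (v i)
      rw [hvi] at h5
      simp only [hxv, ne_eq, not_true_eq_false, false_and, and_false, or_false, false_or] at hcx h5
      have h6 : c x < c (v i) := by rcases hcx with hcx | hcx <;> omega
      have := h4 h6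
      omega
    have hay := h.adj i y hiy
    rw [hi] at hcx
    rw [hiy] at hcy
    have hcx2 : c x = 2 := by
      simp only [← hx, ne_eq, not_true_eq_false, false_and, and_false, or_false] at hcx
      exact hcx.1
    rw [slack, slack, hi, hiy, hcx2]
    rcases hcy with ⟨hy, hy'⟩ | ⟨hy, -, hy'⟩ | ⟨hy, -, hy'⟩
    · rw [← hx, ← hy'] at hsp
      rw [dist_eq_one_iff_adj.2 hsp, hy]
      norm_num
      omega
    · rw [← hx] at hsp
      have := two _ hsp hy'.symm
      simp only [hy]
      norm_num
      omega
    · have := hay.resolve_left fun h => hy' h.symm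
      rw [← hx] at this
      rw [dist_eq_one_iff_adj.2 this.symm, hy]
      norm_num
      omega

/-- The slack falls by at most one in a step, because the layer does not fall. -/
theorem dist_le_three (h : G.IsSpine k v) (hG : G.Connected) (hc : IsClass G v c)
    (hr : IsRanking G v c rk) {x y : V} (hxy : rk y = rk x + 1) : G.dist x y ≤ 3 := by
  have h1 := h.dist_add_slack_le hG hc hr hxy
  have h2 := hr.le_of_lt (show rk x < rk y by omega)
  rw [slack, slack] at h1
  split_ifs at h1 <;> omega

/-- Consecutive vertices are placed at their distance. -/
def IsPlacement (G : SimpleGraph V) (rk f : V → ℕ) : Prop :=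
  ∀ x y, rk y = rk x + 1 → f y = f x + G.dist x y

/-- The ranks have no gaps, so a relation can be extended one rank at a time. -/
theorem IsPlacement.induct (hr : IsRanking G v c rk) {P : V → V → Prop} (h0 : ∀ x, P x x)
    (h : ∀ x y z, P x y → rk z = rk y + 1 → P x z) {x y : V} (hxy : rk x ≤ rk y) : P x y := by
  obtain ⟨d, hd⟩ := Nat.exists_eq_add_of_le hxy
  induction d generalizing y with
  | zero => exact hr.inj hd ▸ h0 x
  | succ d ih =>
    obtain ⟨w, hw⟩ := hr.surj y (rk x + d) (by omega)
    exact h x w y (ih (by omega) hw) (by omega)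

theorem IsPlacement.dist_le (hf : IsPlacement G rk f) (hG : G.Connected)
    (hr : IsRanking G v c rk) {x y : V} (hxy : rk x ≤ rk y) : f x + G.dist x y ≤ f y := by
  refine IsPlacement.induct (P := fun x y => f x + G.dist x y ≤ f y) hr (by simp) ?_ hxy
  intro x y z hP hz
  have h1 := hf y z hz
  have h2 := hG.dist_triangle (u := x) (v := y) (w := z)
  omega

theorem IsPlacement.lt_iff (hf : IsPlacement G rk f) (hG : G.Connected)
    (hr : IsRanking G v c rk) {x y : V} : f x < f y ↔ rk x < rk y := by
  have key : ∀ {x y}, rk x < rk y → f x < f y := by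
    intro x y hxy
    have h1 := hf.dist_le hG hr hxy.le
    have h2 := hG.pos_dist_of_ne (u := x) (v := y) (by rintro rfl; omega)
    omega
  refine ⟨fun h => ?_, key⟩
  rcases lt_trichotomy (rk x) (rk y) with h1 | h1 | h1
  · exact h1
  · rw [hr.inj h1] at h
    omega
  · have := key h1
    omega

theorem IsPlacement.le_slack (hf : IsPlacement G rk f) (h : G.IsSpine k v) (hG : G.Connected)
    (hc : IsClass G v c) (hr : IsRanking G v c rk) {x y : V} (hxy : rk x ≤ rk y) :
    f y + slack G v c y + 2 * rk x ≤ f x + slack G v c x + 2 * rk y := by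
  refine IsPlacement.induct (P := fun x y =>
    f y + slack G v c y + 2 * rk x ≤ f x + slack G v c x + 2 * rk y) hr (by simp) ?_ hxy
  intro x y z hP hz
  have h1 := hf y z hz
  have h2 := h.dist_add_slack_le hG hc hr hz
  omega

theorem isLayeredArrangement (h : G.IsSpine k v) (hG : G.Connected) (hc : IsClass G v c)
    (hr : IsRanking G v c rk) (hf : IsPlacement G rk f) {π : G.Walk (v 0) (v k)}
    (hl : π.length = k) (hπ : ∀ i ≤ k, π.getVert i = v i) : G.IsLayeredArrangement π f := by
  have cfar : ∀ i ≤ k, ∀ x ∈ G.farGroup π i, G.dist (v 0) x = i ∧ c x = 0 := by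
    rintro i hi x ⟨h1, h2, h3⟩
    have := hc x
    rw [hπ i hi] at h2 h3
    rw [h1] at this
    simp only [h2, h3, and_false, false_or] at this
    exact ⟨h1, this.1⟩
  have cnear : ∀ i ≤ k, ∀ x ∈ G.nearGroup π i, G.dist (v 0) x = i ∧ c x = 1 := by
    rintro i hi x ⟨h1, h3⟩
    have := hc x
    rw [hπ i hi] at h3
    have h2 := h3.ne'
    rw [h1] at this
    simp only [h2, h3, not_true_eq_false, and_false, false_or, or_false] at this
    exact ⟨h1, this.1⟩
  have cpath : ∀ i ≤ k, G.dist (v 0) (π.getVert i) = i ∧ c (π.getVert i) = 2 := by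
    intro i hi
    rw [hπ i hi]
    have := hc (v i)
    have h1 := h.dist_eq i hi
    rw [h1] at this
    simp only [ne_eq, not_true_eq_false, false_and, and_false, or_false] at this
    exact ⟨h1, this.1⟩
  refine ⟨fun x y hxy => (hf.lt_iff hG hr).2 (hr.layer x y hxy), ?_, ?_, ?_, ?_⟩
  · intro i hi' x hx y hy
    have hi := hi'.trans hl.le
    have h1 := cfar i hi x hx
    have h2 := cnear i hi y hy
    exact (hf.lt_iff hG hr).2 (hr.cls x y (by omega) (by omega))
  · intro i hi' x hx
    have hi := hi'.trans hl.le
    have h1 := cfar i hi x hx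
    have h2 := cpath i hi
    exact (hf.lt_iff hG hr).2 (hr.cls _ _ (by omega) (by omega))
  · intro i hi' x hx
    have hi := hi'.trans hl.le
    have h1 := cnear i hi x hx
    have h2 := cpath i hi
    exact (hf.lt_iff hG hr).2 (hr.cls _ _ (by omega) (by omega))
  · intro x y hxy hgap
    have h1 := (hf.lt_iff hG hr).1 hxy
    refine hf x y ?_
    by_contra hne
    obtain ⟨w, hw⟩ := hr.surj y (rk x + 1) (by omega)
    exact hgap w ⟨(hf.lt_iff hG hr).2 (by omega), (hf.lt_iff hG hr).2 (by omega)⟩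

/-! ### The distortion -/

/-- A set of diameter at most `D` has at most `k * D + 1` vertices if the graph has an embedding
with distortion `k`. -/
theorem _root_.SimpleGraph.IsLineEmbedding.card_le {g : V → ℝ} {κ : ℝ}
    (hg : G.IsLineEmbedding g κ) (hG : G.Connected) (hκ : 0 ≤ κ) {W : Finset V} {D : ℕ}
    (hW : W.Nonempty) (hD : ∀ x ∈ W, ∀ y ∈ W, G.dist x y ≤ D) : (W.card : ℝ) ≤ κ * D + 1 := by
  obtain ⟨a, ha, hmin⟩ := W.exists_min_image g hW
  -- Measured from the leftmost vertex `a`, the positions lie between 0 and κD and are pairwise at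
  -- least one apart, so their floors are distinct.
  have hmaps : ∀ w ∈ W, ⌊g w - g a⌋₊ ∈ Finset.range (⌊κ * D⌋₊ + 1) := by
    intro w hw
    rw [Finset.mem_range, Nat.lt_succ_iff]
    refine Nat.floor_le_floor ((le_abs_self _).trans ((hg w a).2.trans ?_))
    have : (G.dist w a : ℝ) ≤ D := by exact_mod_cast hD w hw a ha
    gcongr
  have hinj : Set.InjOn (fun w => ⌊g w - g a⌋₊) W := by
    intro x hx y hy hxy
    by_contra hne
    have h1 : (1 : ℝ) ≤ |g x - g y| := by
      refine le_trans ?_ (hg x y).1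
      exact_mod_cast hG.pos_dist_of_ne hne
    have hx0 := sub_nonneg.2 (hmin x hx)
    have hy0 := sub_nonneg.2 (hmin y hy)
    have h2 := Nat.floor_le hx0
    have h3 := Nat.lt_floor_add_one (g x - g a)
    have h4 := Nat.floor_le hy0
    have h5 := Nat.lt_floor_add_one (g y - g a)
    simp only at hxy
    rw [hxy] at h2 h3
    rcases le_abs.1 h1 with h | h <;> linarith
  have := Finset.card_le_card_of_injOn _ hmaps hinj
  rw [Finset.card_range] at this
  have h2 : (⌊κ * D⌋₊ : ℝ) ≤ κ * D := Nat.floor_le (by positivity)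
  have h3 : (W.card : ℝ) ≤ ⌊κ * D⌋₊ + 1 := by exact_mod_cast this
  linarith

theorem exists_near (h : G.IsSpine k v) (u : V) :
    ∃ j ≤ k, G.dist u (v j) ≤ 1 ∧ j ≤ G.dist (v 0) u ∧ G.dist (v 0) u ≤ j + 1 := by
  have hu := h.far u
  rcases Nat.eq_zero_or_eq_succ_pred (G.dist (v 0) u) with h0 | h0
  · refine ⟨0, by omega, ?_, by omega, by omega⟩
    rw [dist_comm]
    omega
  · rcases h.adj _ u h0 with h1 | h1
    · exact ⟨_, by omega, (dist_eq_one_iff_adj.2 h1).le, by omega, by omega⟩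
    · exact ⟨_, by omega, (dist_eq_one_iff_adj.2 h1).le, by omega, by omega⟩

theorem dist_le_sub (h : G.IsSpine k v) (hG : G.Connected) {i j : ℕ} (hij : i ≤ j) (hj : j ≤ k) :
    G.dist (v i) (v j) ≤ j - i := by
  induction j, hij using Nat.le_induction with
  | base => simp
  | succ j hij ih =>
    have h1 := ih (by omega)
    have h2 := dist_eq_one_iff_adj.2 (h.adj_succ j (by omega))
    have h3 := hG.dist_triangle (u := v i) (v := v j) (w := v (j + 1))
    omega

/-- Each vertex is within distance one of a path vertex in its own layer or the one below; the piece
of path between these has length at most `d + 1`. -/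
theorem dist_le_of_layers (h : G.IsSpine k v) (hG : G.Connected) {d i : ℕ} {x y : V}
    (hx : i ≤ G.dist (v 0) x) (hx' : G.dist (v 0) x ≤ i + d) (hy : i ≤ G.dist (v 0) y)
    (hy' : G.dist (v 0) y ≤ i + d) : G.dist x y ≤ d + 3 := by
  obtain ⟨a, hak, hxa, ha, ha'⟩ := h.exists_near x
  obtain ⟨b, hbk, hyb, hb, hb'⟩ := h.exists_near y
  have h1 := hG.dist_triangle (u := x) (v := v a) (w := y)
  have h2 := hG.dist_triangle (u := v a) (v := v b) (w := y)
  rw [dist_comm] at hyb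
  rcases le_total a b with hab | hab
  · have := h.dist_le_sub hG hab hbk
    omega
  · have := h.dist_le_sub hG hab hak
    rw [dist_comm] at this
    omega

/-- The vertices ranked from `x` to `y` lie in the layers of `x` and `y`, so their diameter is at
most 3 or 4 and the ranks differ by at most 3κ or 4κ. The slack bound doubles this, with one extra
unit in the case of one layer, which κ ≥ 1 absorbs. -/
theorem abs_sub_le_of_adj [Fintype V] (h : G.IsSpine k v) (hG : G.Connected)
    (hc : IsClass G v c) (hr : IsRanking G v c rk) (hf : IsPlacement G rk f) {g : V → ℝ} {κ : ℝ}
    (hg : G.IsLineEmbedding g κ) {x y : V} (hxy : G.Adj x y) :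
    |(f x : ℝ) - f y| ≤ 8 * κ := by
  wlog hlt : rk x < rk y generalizing x y
  · rw [abs_sub_comm]
    refine this hxy.symm (lt_of_le_of_ne (not_lt.1 hlt) fun he => ?_)
    exact hxy.ne (hr.inj he).symm
  have hκ : 1 ≤ κ := by
    have := (hg x y).1.trans (hg x y).2
    rw [dist_eq_one_iff_adj.2 hxy] at this
    simpa using this
  have hle := hr.le_of_lt hlt
  have hsucc := hG.dist_le_succ hxy (v 0)
  have hbound := hf.le_slack h hG hc hr hlt.le
  have hmono := (hf.lt_iff hG hr).2 hlt
  set W : Finset V := Finset.univ.filter fun w => rk x ≤ rk w ∧ rk w ≤ rk y with hWdef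
  have hWcard : W.card = rk y - rk x + 1 := by
    have : W.image rk = Finset.Icc (rk x) (rk y) := by
      ext j
      simp only [hWdef, Finset.mem_image, Finset.mem_filter, Finset.mem_univ, true_and,
        Finset.mem_Icc]
      constructor
      · rintro ⟨w, hw, rfl⟩
        exact hw
      · rintro ⟨h1, h2⟩
        rcases h2.eq_or_lt with rfl | h2
        · exact ⟨y, ⟨h1, le_rfl⟩, rfl⟩
        · obtain ⟨w, rfl⟩ := hr.surj y j h2
          exact ⟨w, ⟨h1, h2.le⟩, rfl⟩
    rw [← Finset.card_image_of_injective W hr.inj, this, Nat.card_Icc]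
    omega
  have hWlayer : ∀ w ∈ W, G.dist (v 0) x ≤ G.dist (v 0) w ∧
      G.dist (v 0) w ≤ G.dist (v 0) x + (G.dist (v 0) y - G.dist (v 0) x) := by
    intro w hw
    rw [hWdef, Finset.mem_filter] at hw
    obtain ⟨-, h1, h2⟩ := hw
    constructor
    · rcases h1.eq_or_lt with h1 | h1
      · rw [hr.inj h1]
      · exact hr.le_of_lt h1
    · have : G.dist (v 0) w ≤ G.dist (v 0) y := by
        rcases h2.eq_or_lt with h2 | h2
        · rw [hr.inj h2]
        · exact hr.le_of_lt h2
      omega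
  have hcard := hg.card_le hG (by linarith) (W := W) ⟨x, by simp [hWdef, hlt.le]⟩
    (fun a ha b hb => h.dist_le_of_layers hG (hWlayer a ha).1 (hWlayer a ha).2 (hWlayer b hb).1
      (hWlayer b hb).2)
  rw [hWcard] at hcard
  rw [abs_sub_comm, abs_of_nonneg (by simpa using (Nat.cast_le (α := ℝ)).2 hmono.le)]
  have hslx : slack G v c x ≤ G.dist (v 0) x + 1 := by
    rw [slack]
    split_ifs <;> omega
  have hsly : G.dist (v 0) y ≤ slack G v c y := by
    rw [slack]
    omega
  rcases hle.eq_or_lt with heq | hlt'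
  · have h1 : f y ≤ f x + 2 * (rk y - rk x) + 1 := by omega
    have h2 : (f y : ℝ) ≤ f x + 2 * ((rk y - rk x : ℕ) : ℝ) + 1 := by exact_mod_cast h1
    rw [heq, Nat.sub_self] at hcard
    push_cast at hcard h2
    linarith
  -- Between two layers no unit is lost: the slack of `x` is at most its layer plus one, the layer
  -- of `y`, and so at most the slack of `y`.
  · have h1 : f y ≤ f x + 2 * (rk y - rk x) := by omega
    have h2 : (f y : ℝ) ≤ f x + 2 * ((rk y - rk x : ℕ) : ℝ) := by exact_mod_cast h1
    have h3 : G.dist (v 0) y - G.dist (v 0) x = 1 := by omega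
    rw [h3] at hcard
    push_cast at hcard h2
    linarith

/-- The edge bound, summed along a shortest path, holds for every attainable κ. Passing to the
infimum comes last, so no optimal embedding has to exist. -/
theorem isLineEmbedding [Finite V] (h : G.IsSpine k v) (hG : G.Connected)
    (hc : IsClass G v c) (hr : IsRanking G v c rk) (hf : IsPlacement G rk f) :
    G.IsLineEmbedding (fun u => (f u : ℝ)) (8 * G.lineDistortion) := by
  have := Fintype.ofFinite V
  have hlow : ∀ x y, (G.dist x y : ℝ) ≤ |(f x : ℝ) - f y| := by
    intro x y
    wlog hxy : rk x ≤ rk y generalizing x y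
    · rw [abs_sub_comm, dist_comm]
      exact this y x (le_of_not_ge hxy)
    have h1 : (f x : ℝ) + G.dist x y ≤ f y := by exact_mod_cast hf.dist_le hG hr hxy
    rw [abs_sub_comm]
    exact le_abs.2 (.inl (by linarith))
  have hup : ∀ κ ∈ {κ : ℝ | ∃ g : V → ℝ, G.IsLineEmbedding g κ}, ∀ x y,
      |(f x : ℝ) - f y| ≤ 8 * κ * G.dist x y := by
    rintro κ ⟨g, hg⟩ x y
    obtain ⟨p, hp⟩ := hG.exists_walk_length_eq_dist x y
    rw [← hp]
    clear hp
    induction p with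
    | nil => simp
    | cons hadj p ih =>
      rename_i a b d
      have h1 := h.abs_sub_le_of_adj hG hc hr hf hg hadj
      have h2 := abs_sub_le (f a : ℝ) (f b) (f d)
      rw [Walk.length_cons]
      push_cast
      linarith
  refine fun x y => ⟨hlow x y, ?_⟩
  rcases eq_or_ne x y with rfl | hne
  · simp
  have hpos : (0 : ℝ) < G.dist x y := by exact_mod_cast hG.pos_dist_of_ne hne
  -- The infimum of an empty set would be 0. The placement itself attains some distortion: the sum
  -- of all differences is a crude constant.
  have hne' : {κ : ℝ | ∃ g : V → ℝ, G.IsLineEmbedding g κ}.Nonempty := by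
    refine ⟨∑ a, ∑ b, |(f a : ℝ) - f b|, fun u => f u, fun a b => ⟨hlow a b, ?_⟩⟩
    rcases eq_or_ne a b with rfl | hab
    · simp
    have h1 : (1 : ℝ) ≤ G.dist a b := by exact_mod_cast hG.pos_dist_of_ne hab
    have h2 : |(f a : ℝ) - f b| ≤ ∑ a, ∑ b, |(f a : ℝ) - f b| :=
      (Finset.single_le_sum (f := fun b => |(f a : ℝ) - f b|) (fun _ _ => abs_nonneg _)
        (Finset.mem_univ b)).trans
      (Finset.single_le_sum (f := fun a => ∑ b, |(f a : ℝ) - f b|)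
        (fun _ _ => Finset.sum_nonneg fun _ _ => abs_nonneg _) (Finset.mem_univ a))
    exact h2.trans (le_mul_of_one_le_right ((abs_nonneg _).trans h2) h1)
  have : |(f x : ℝ) - f y| / (8 * G.dist x y) ≤ G.lineDistortion := by
    refine le_csInf hne' fun κ hκ => ?_
    rw [div_le_iff₀ (by positivity)]
    have := hup κ hκ x y
    linarith
  rw [div_le_iff₀ (by positivity)] at this
  show |(f x : ℝ) - f y| ≤ _
  linarith

end IsSpine

end Spine

theorem IsStart.IsKeyPath.isSpine {V : Type*} [Fintype V] {G : SimpleGraph V} {s m r : V} {k : ℕ}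
    {v : ℕ → V} (h : G.IsStart s m r) (hG : G.Connected) (hAT : G.IsATFree)
    (hv : IsStart.IsKeyPath G s r k v) : G.IsSpine k v := by
  have h0 : v 0 = r := by
    have := hv.dist_eq hG (Nat.zero_le k)
    rw [hG.dist_eq_zero_iff] at this
    exact this.symm
  refine ⟨fun i hi => ?_, fun i hi => ?_, ?_, fun i u hu => ?_⟩
  · rw [h0]
    exact hv.dist_eq hG hi
  · have := hv.mem i hi
    rw [mem_downSet] at this
    exact this.1.symm
  · rw [h0]
    exact hv.far
  · rw [h0] at hu
    exact IsStart.IsKeyPath.adj h hG hAT hv hu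

/-- Distances up to three, by adjacency and common neighbours. -/
theorem Connected.dist_eq_ite {V : Type*} {G : SimpleGraph V} (hG : G.Connected) {x y : V}
    (hne : x ≠ y) (h3 : G.dist x y ≤ 3) [Decidable (G.Adj x y)]
    [Decidable (∃ z, G.Adj x z ∧ G.Adj y z)] :
    G.dist x y = if G.Adj x y then 1 else if ∃ z, G.Adj x z ∧ G.Adj y z then 2 else 3 := by
  have h0 := hG.pos_dist_of_ne hne
  have h1 := dist_eq_one_iff_adj (G := G) (u := x) (v := y)
  split_ifs with ha hz
  · exact h1.2 ha
  · obtain ⟨z, hxz, hyz⟩ := hz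
    have := hG.dist_le_succ hyz.symm x
    rw [dist_eq_one_iff_adj.2 hxz] at this
    have : G.dist x y ≠ 1 := fun h => ha (h1.1 h)
    omega
  · have h2 : G.dist x y ≠ 2 := by
      intro h2
      obtain ⟨z, hyz, hxz⟩ := hG.exists_adj_dist h2
      exact hz ⟨z, dist_eq_one_iff_adj.1 hxz, hyz⟩
    have : G.dist x y ≠ 1 := fun h => ha (h1.1 h)
    omega

end SimpleGraph

namespace RAM

/-! ### Program logic -/

/-- Whether `p` writes variable `y`. -/
def Prog.wv : Prog → ℕ → Bool
  | .skip, _ => false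
  | .assign x _, y => y == x
  | .store _ _ _, _ => false
  | .seq p q, y => p.wv y || q.wv y
  | .ite _ p q, y => p.wv y || q.wv y
  | .loop _ p, y => p.wv y

/-- Whether `p` writes array `a`. -/
def Prog.wa : Prog → ℕ → Bool
  | .skip, _ => false
  | .assign _ _, _ => false
  | .store b _ _, a => a == b
  | .seq p q, a => p.wa a || q.wa a
  | .ite _ p q, a => p.wa a || q.wa a
  | .loop _ p, a => p.wa a

/-- `s'` differs from `s` only in what `p` writes. -/
structure Frame (p : Prog) (s s' : State) : Prop where
  var : ∀ y, p.wv y = false → s'.var y = s.var y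
  arr : ∀ a, p.wa a = false → s'.arr a = s.arr a

theorem Frame.refl (p : Prog) (s : State) : Frame p s s := ⟨fun _ _ => rfl, fun _ _ => rfl⟩

theorem Frame.trans {p : Prog} {s s' s'' : State} (h : Frame p s s') (h' : Frame p s' s'') :
    Frame p s s'' :=
  ⟨fun y hy => (h'.var y hy).trans (h.var y hy), fun a ha => (h'.arr a ha).trans (h.arr a ha)⟩

theorem Frame.mono {p q : Prog} {s s' : State} (h : Frame p s s')
    (hv : ∀ y, q.wv y = false → p.wv y = false) (ha : ∀ a, q.wa a = false → p.wa a = false) :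
    Frame q s s' :=
  ⟨fun y hy => h.var y (hv y hy), fun a h' => h.arr a (ha a h')⟩

@[simp] theorem State.setVar_var (s : State) (x k y : ℕ) :
    (s.setVar x k).var y = if y = x then k else s.var y := by
  simp [State.setVar, Function.update_apply]

@[simp] theorem State.setVar_arr (s : State) (x k : ℕ) : (s.setVar x k).arr = s.arr := rfl

@[simp] theorem State.setArr_var (s : State) (a i k : ℕ) : (s.setArr a i k).var = s.var := rfl

theorem State.setArr_arr (s : State) (a i k b j : ℕ) :
    (s.setArr a i k).arr b j = if b = a ∧ j = i then k else s.arr b j := by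
  rw [State.setArr]
  by_cases hb : b = a
  · subst hb
    simp [Function.update_apply]
  · simp [hb]

@[simp] theorem State.setArr_arr_same (s : State) (a i k j : ℕ) :
    (s.setArr a i k).arr a j = if j = i then k else s.arr a j := by
  simp [State.setArr_arr]

theorem State.setArr_arr_of_ne (s : State) {a b : ℕ} (i k : ℕ) (h : b ≠ a) :
    (s.setArr a i k).arr b = s.arr b := by
  funext j
  simp [State.setArr_arr, h]

/-- `wv` and `wa` are computed from the syntax, so what a phase leaves untouched mostly follows by
`rfl`. -/
theorem Exec.frame {p : Prog} {s s' : State} {t : ℕ} (h : Exec p s t s') : Frame p s s' := by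
  induction h with
  | skip s => exact .refl _ _
  | assign x e s => exact ⟨fun y hy => by simp_all [Prog.wv], fun _ _ => rfl⟩
  | store a i e s =>
    exact ⟨fun _ _ => rfl, fun b hb => s.setArr_arr_of_ne _ _ (by simpa [Prog.wa] using hb)⟩
  | seq _ _ ih ih' =>
    exact (ih.mono (by simp_all [Prog.wv]) (by simp_all [Prog.wa])).trans
      (ih'.mono (by simp_all [Prog.wv]) (by simp_all [Prog.wa]))
  | iteTrue _ _ ih => exact ih.mono (by simp_all [Prog.wv]) (by simp_all [Prog.wa])
  | iteFalse _ _ ih => exact ih.mono (by simp_all [Prog.wv]) (by simp_all [Prog.wa])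
  | loopTrue _ _ _ ih ih' =>
    exact (ih.mono (by simp_all [Prog.wv]) (by simp_all [Prog.wa])).trans ih'
  | loopFalse _ => exact .refl _ _

/-- Programs without loops. -/
def Prog.flat : Prog → Bool
  | .skip => true
  | .assign _ _ => true
  | .store _ _ _ => true
  | .seq p q => p.flat && q.flat
  | .ite _ p q => p.flat && q.flat
  | .loop _ _ => false

/-- The result of a program without loops. -/
def Prog.run : Prog → State → State
  | .skip, s => s
  | .assign x e, s => s.setVar x (e.eval s)
  | .store a i e, s => s.setArr a (i.eval s) (e.eval s)
  | .seq p q, s => q.run (p.run s)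
  | .ite b p q, s => if b.eval s = true then p.run s else q.run s
  | .loop _ _, s => s

/-- A bound on the running time of a program without loops. -/
def Prog.maxCost : Prog → ℕ
  | .skip => 1
  | .assign _ e => e.cost + 1
  | .store _ i e => i.cost + e.cost + 1
  | .seq p q => p.maxCost + q.maxCost
  | .ite b p q => b.cost + 1 + (p.maxCost + q.maxCost)
  | .loop _ _ => 0

/-- `p`, started in `s`, halts within `T` steps in a state that satisfies `Q`. -/
def Runs (p : Prog) (s : State) (T : ℕ) (Q : State → Prop) : Prop :=
  ∃ t s', Exec p s t s' ∧ t ≤ T ∧ Q s'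

theorem runs_flat {p : Prog} (h : p.flat = true) (s : State) :
    Runs p s p.maxCost (fun s' => s' = p.run s) := by
  induction p generalizing s with
  | skip => exact ⟨_, _, .skip s, le_rfl, rfl⟩
  | assign x e => exact ⟨_, _, .assign x e s, le_rfl, rfl⟩
  | store a i e => exact ⟨_, _, .store a i e s, le_rfl, rfl⟩
  | seq p q ihp ihq =>
    simp only [Prog.flat, Bool.and_eq_true] at h
    obtain ⟨t, s', h1, h2, rfl⟩ := ihp h.1 s
    obtain ⟨t', s'', h1', h2', rfl⟩ := ihq h.2 (p.run s)
    exact ⟨_, _, .seq h1 h1', Nat.add_le_add h2 h2', rfl⟩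
  | ite b p q ihp ihq =>
    simp only [Prog.flat, Bool.and_eq_true] at h
    rw [Prog.run, Prog.maxCost]
    by_cases hb : b.eval s = true
    · obtain ⟨t, s', h1, h2, rfl⟩ := ihp h.1 s
      exact ⟨_, _, .iteTrue hb h1, by omega, by rw [if_pos hb]⟩
    · obtain ⟨t, s', h1, h2, rfl⟩ := ihq h.2 s
      exact ⟨_, _, .iteFalse (by simpa using hb) h1, by omega, by rw [if_neg hb]⟩
  | loop => simp [Prog.flat] at h

theorem Runs.mono {p : Prog} {s : State} {T T' : ℕ} {Q Q' : State → Prop} (h : Runs p s T Q)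
    (hT : T ≤ T') (hQ : ∀ s', Frame p s s' → Q s' → Q' s') : Runs p s T' Q' := by
  obtain ⟨t, s', h1, h2, h3⟩ := h
  exact ⟨t, s', h1, h2.trans hT, hQ s' h1.frame h3⟩

theorem Runs.seq {p q : Prog} {s : State} {T T' : ℕ} {Q Q' : State → Prop} (h : Runs p s T Q)
    (h' : ∀ s', Frame p s s' → Q s' → Runs q s' T' Q') : Runs (.seq p q) s (T + T') Q' := by
  obtain ⟨t, s', h1, h2, h3⟩ := h
  obtain ⟨t', s'', h1', h2', h3'⟩ := h' s' h1.frame h3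
  exact ⟨_, _, .seq h1 h1', Nat.add_le_add h2 h2', h3'⟩

/-! ### Rules for counting loops -/

/-- `for x from lo to hi - 1 do p`. -/
def forLoop (x : ℕ) (lo hi : Expr) (p : Prog) : Prog :=
  .seq (.assign x lo) (.loop (.lt (.var x) hi) (.seq p (.assign x (.succ (.var x)))))

theorem forLoop_wv {x : ℕ} {lo hi : Expr} {p : Prog} {y : ℕ} :
    (forLoop x lo hi p).wv y = false ↔ y ≠ x ∧ p.wv y = false := by
  simp only [forLoop, Prog.wv, Bool.or_eq_false_iff, beq_eq_false_iff_ne]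
  tauto

theorem forLoop_wa {x : ℕ} {lo hi : Expr} {p : Prog} {a : ℕ} :
    (forLoop x lo hi p).wa a = false ↔ p.wa a = false := by
  simp [forLoop, Prog.wa]

/-- The rule for `for` loops, with the time spent in the body as part of the invariant. -/
theorem exec_forLoop {x : ℕ} {lo hi : Expr} {p : Prog} {s : State} {a b : ℕ}
    {I : ℕ → ℕ → State → Prop} (hlo : lo.eval s = a) (hab : a ≤ b) (hx : p.wv x = false)
    (h0 : I a 0 (s.setVar x a))
    (hhi : ∀ i T s', Frame (forLoop x lo hi p) s s' → I i T s' → hi.eval s' = b)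
    (hp : ∀ i T s', a ≤ i → i < b → Frame (forLoop x lo hi p) s s' → s'.var x = i → I i T s' →
      ∃ t s'', Exec p s' t s'' ∧ I (i + 1) (T + t) (s''.setVar x (i + 1))) :
    ∃ t T s', Exec (forLoop x lo hi p) s t s' ∧
      t ≤ T + (b - a) * (hi.cost + 6) + lo.cost + hi.cost + 4 ∧ I b T s' := by
  -- Induction on the number `d` of remaining rounds, with `T` the time already spent in the body.
  -- Test and increment cost `hi.cost + 6` per round.
  have key : ∀ d i T s', i + d = b → a ≤ i → Frame (forLoop x lo hi p) s s' → s'.var x = i →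
      I i T s' → ∃ t T' s'', Exec (.loop (.lt (.var x) hi) (.seq p (.assign x (.succ (.var x)))))
        s' t s'' ∧ t + T ≤ T' + d * (hi.cost + 6) + hi.cost + 3 ∧ I b T' s'' := by
    intro d
    induction d with
    | zero =>
      rintro i T s' hib hai hf hvar hI
      obtain rfl : i = b := hib
      refine ⟨_, T, s', .loopFalse ?_, ?_, hI⟩
      · simp [Test.eval, Expr.eval, hvar, hhi _ _ _ hf hI]
      · simp only [Test.cost, Expr.cost]
        omega
    | succ d ih =>
      rintro i T s' hib hai hf hvar hI
      obtain ⟨t, s1, h1, h2⟩ := hp i T s' hai (by omega) hf hvar hI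
      have hvar1 : s1.var x = i := (h1.frame.var x hx).trans hvar
      have hexec : Exec (.seq p (.assign x (.succ (.var x)))) s' (t + 3) (s1.setVar x (i + 1)) := by
        have := Exec.seq h1 (.assign x (.succ (.var x)) s1)
        simpa [Expr.eval, Expr.cost, hvar1] using this
      have hf' : Frame (forLoop x lo hi p) s (s1.setVar x (i + 1)) := by
        refine hf.trans (hexec.frame.mono (fun y hy => ?_) fun a ha => ?_)
        · rw [forLoop_wv] at hy
          simp [Prog.wv, hy]
        · rw [forLoop_wa] at ha
          simp [Prog.wa, ha]
      obtain ⟨t', T', s2, h3, h4, h5⟩ := ih (i + 1) (T + t) _ (by omega) (by omega) hf'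
        (by simp) h2
      refine ⟨_, T', s2, .loopTrue ?_ hexec h3, ?_, h5⟩
      · simp [Test.eval, Expr.eval, hvar, hhi _ _ _ hf hI]
        omega
      · simp only [Test.cost, Expr.cost, Nat.add_mul]
        omega
  have hf0 : Frame (forLoop x lo hi p) s (s.setVar x a) := by
    refine ⟨fun y hy => ?_, fun _ _ => rfl⟩
    rw [forLoop_wv] at hy
    simp [hy.1]
  obtain ⟨t, T', s', h1, h2, h3⟩ := key (b - a) a 0 (s.setVar x a) (by omega) le_rfl hf0
    (by simp) h0
  have h4 := Exec.assign x lo s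
  rw [hlo] at h4
  exact ⟨_, T', s', .seq h4 h1, by omega, h3⟩

/-- The rule for `for` loops whose body has a time bound that depends on the round. -/
theorem runs_forLoop {x : ℕ} {lo hi : Expr} {p : Prog} {s : State} {a b : ℕ}
    {I : ℕ → State → Prop} (c : ℕ → ℕ) (hlo : lo.eval s = a) (hab : a ≤ b) (hx : p.wv x = false)
    (h0 : I a (s.setVar x a))
    (hhi : ∀ s', Frame (forLoop x lo hi p) s s' → hi.eval s' = b)
    (hp : ∀ i s', a ≤ i → i < b → Frame (forLoop x lo hi p) s s' → s'.var x = i → I i s' →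
      Runs p s' (c i) fun s'' => I (i + 1) (s''.setVar x (i + 1))) :
    Runs (forLoop x lo hi p) s
      (∑ i ∈ Finset.Ico a b, c i + (b - a) * (hi.cost + 6) + lo.cost + hi.cost + 4) (I b) := by
  obtain ⟨t, T, s', h1, h2, -, h3, h4⟩ := exec_forLoop (lo := lo) (hi := hi) (p := p)
    (I := fun i T s' => a ≤ i ∧ T ≤ ∑ j ∈ Finset.Ico a i, c j ∧ I i s') hlo hab hx
    ⟨le_rfl, by simp, h0⟩ (fun i T s' hf _ => hhi s' hf) (by
      rintro i T s' hai hib hf hvar ⟨-, hT, hI⟩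
      obtain ⟨t, s'', h1, h2, h3⟩ := hp i s' hai hib hf hvar hI
      refine ⟨t, s'', h1, by omega, ?_, h3⟩
      rw [Finset.sum_Ico_succ_top hai]
      omega)
  exact ⟨t, s', h1, by omega, h4⟩

/-- The rule for `for` loops over `0, …, b - 1` with a flat body. -/
theorem runs_forLoop_const {x : ℕ} {lo hi : Expr} {p : Prog} {s : State} {a b c : ℕ}
    {I : ℕ → State → Prop} (hlo : lo.eval s = a) (hab : a ≤ b) (hx : p.wv x = false)
    (h0 : I a (s.setVar x a))
    (hhi : ∀ s', Frame (forLoop x lo hi p) s s' → hi.eval s' = b)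
    (hp : ∀ i s', a ≤ i → i < b → Frame (forLoop x lo hi p) s s' → s'.var x = i → I i s' →
      Runs p s' c fun s'' => I (i + 1) (s''.setVar x (i + 1))) :
    Runs (forLoop x lo hi p) s
      ((c + hi.cost + 6) * (b - a) + lo.cost + hi.cost + 4) (I b) := by
  refine (runs_forLoop (I := I) (fun _ => c) hlo hab hx h0 hhi hp).mono ?_ fun _ _ h => h
  rw [Finset.sum_const, Nat.card_Ico, smul_eq_mul]
  ring_nf
  omega

end RAM

namespace RAM

/-! ### Loops over adjacency lists -/

theorem getElem?_flatten_add {α : Type*} (L : List (List α)) {i j : ℕ} (hi : i < L.length)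
    (hj : j < L[i].length) :
    L.flatten[((L.take i).map List.length).sum + j]? = some L[i][j] := by
  have h : L.flatten = (L.take i).flatten ++ (L[i] ++ (L.drop (i + 1)).flatten) := by
    conv_lhs => rw [← List.take_append_drop i L, List.drop_eq_getElem_cons hi]
    rw [List.flatten_append, List.flatten_cons]
  rw [h, ← List.length_flatten, List.getElem?_append_right (by omega), Nat.add_sub_cancel_left,
    List.getElem?_append_left hj, List.getElem?_eq_getElem hj]

section Input

variable {n : ℕ} (adj : Fin n → List (Fin n))

/-- The position at which the list of `i` starts. -/
def offset (i : ℕ) : ℕ := ∑ j : Fin n with j.val < i, (adj j).length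

/-- The memory holds the graph in its input cells. -/
structure Inp (s : State) : Prop where
  var : s.var 0 = n
  off : ∀ i ≤ n, s.arr 0 i = offset adj i
  list : s.arr 1 = (graphInput adj).arr 1

theorem inp_graphInput : Inp adj (graphInput adj) where
  var := by simp [graphInput]
  off i hi := by simp [graphInput, offset, hi]
  list := rfl

variable {adj}

theorem Inp.frame {p : Prog} {s s' : State} (h : Inp adj s) (hf : Frame p s s')
    (h0 : p.wv 0 = false) (h1 : p.wa 0 = false) (h2 : p.wa 1 = false) : Inp adj s' :=
  ⟨(hf.var 0 h0).trans h.var, fun i hi => by rw [hf.arr 0 h1, h.off i hi],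
    (hf.arr 1 h2).trans h.list⟩

theorem offset_succ (u : Fin n) : offset adj (u + 1) = offset adj u + (adj u).length := by
  have : (Finset.univ.filter fun j : Fin n => j.val < u.val + 1) =
      insert u (Finset.univ.filter fun j : Fin n => j.val < u.val) := by
    ext j
    simp only [Finset.mem_filter, Finset.mem_univ, true_and, Finset.mem_insert, Fin.ext_iff]
    omega
  rw [offset, offset, this, Finset.sum_insert (by simp), add_comm]

theorem offset_eq {i : ℕ} (hi : i ≤ n) :
    offset adj i = (((List.ofFn adj).take i).map List.length).sum := by
  induction i with
  | zero => simp [offset]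
  | succ i ih =>
    have hlen : i < (List.ofFn adj).length := by simpa using hi
    rw [offset_succ ⟨i, hi⟩, ih (by omega), List.take_succ_eq_append_getElem hlen]
    simp

theorem Inp.get {s : State} (h : Inp adj s) (u : Fin n) {j : ℕ} (hj : j < (adj u).length) :
    s.arr 1 (offset adj u + j) = (adj u)[j] := by
  have hlen : u.val < (List.ofFn adj).length := by simp
  have hj' : j < ((List.ofFn adj)[u.val]'hlen).length := by simpa using hj
  have := getElem?_flatten_add (List.ofFn adj) hlen hj'
  rw [← offset_eq u.isLt.le] at this
  rw [h.list]
  simp only [graphInput, Function.update_self, List.getD_eq_getElem?_getD, List.getElem?_map, this]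
  simp

/-- `for x in adj[y] do p`, with the current neighbour in variable `3`. -/
def arcs (y : ℕ) (p : Prog) : Prog :=
  forLoop 2 (.get 0 (.var y)) (.get 0 (.succ (.var y))) (.seq (.assign 3 (.get 1 (.var 2))) p)

theorem arcs_wv {y : ℕ} {p : Prog} {z : ℕ} :
    (arcs y p).wv z = false ↔ z ≠ 2 ∧ z ≠ 3 ∧ p.wv z = false := by
  rw [arcs, forLoop_wv]
  simp [Prog.wv]

theorem arcs_wa {y : ℕ} {p : Prog} {a : ℕ} : (arcs y p).wa a = false ↔ p.wa a = false := by
  rw [arcs, forLoop_wa]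
  simp [Prog.wa]

/-- `p` respects the input cells and the arc pointer. -/
structure Safe (p : Prog) : Prop where
  v0 : p.wv 0 = false
  v2 : p.wv 2 = false
  a0 : p.wa 0 = false
  a1 : p.wa 1 = false

/-- The invariant speaks of the part of the list already read, not of memory positions, and must
ignore variables 2 and 3, which the loop overwrites. Fetching the neighbour costs 3 per round and
the loop control 9. -/
theorem runs_arcs {y : ℕ} {p : Prog} {u : Fin n} {s : State} {c : ℕ}
    {I : List (Fin n) → State → Prop} (hs : Inp adj s) (hy : s.var y = u)
    (hyp : (arcs y p).wv y = false) (hp : Safe p)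
    (hI : ∀ l s' z v, z = 2 ∨ z = 3 → I l s' → I l (s'.setVar z v)) (h0 : I [] s)
    (hb : ∀ l (x : Fin n) s', l ++ [x] <+: adj u → Frame (arcs y p) s s' → s'.var 3 = x → I l s' →
      Runs p s' c (I (l ++ [x]))) :
    Runs (arcs y p) s ((c + 12) * (adj u).length + 9) (I (adj u)) := by
  have hinp : ∀ s', Frame (arcs y p) s s' → Inp adj s' ∧ s'.var y = u := fun s' hf =>
    ⟨hs.frame hf (arcs_wv.2 ⟨by omega, by omega, hp.v0⟩) (arcs_wa.2 hp.a0) (arcs_wa.2 hp.a1),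
      (hf.var y hyp).trans hy⟩
  have key := runs_forLoop_const (x := 2) (lo := .get 0 (.var y)) (hi := .get 0 (.succ (.var y)))
    (p := .seq (.assign 3 (.get 1 (.var 2))) p) (s := s) (a := offset adj u)
    (b := offset adj u + (adj u).length) (c := 3 + c)
    (I := fun i s' => I ((adj u).take (i - offset adj u)) s')
    (by simp [Expr.eval, hy, hs.off u u.isLt.le]) (by omega) (by simp [Prog.wv, hp.v2])
    (by simpa using hI _ _ 2 _ (.inl rfl) h0)
    (fun s' hf => by
      obtain ⟨h1, h2⟩ := hinp s' hf
      simp [Expr.eval, h2, h1.off (u + 1) u.isLt, offset_succ])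
    (by
      intro i s' hai hib hf hvar hIi
      obtain ⟨h1, h2⟩ := hinp s' hf
      have hlt : i - offset adj u < (adj u).length := by omega
      refine Runs.seq (Q := fun s'' => s'' = s'.setVar 3 (adj u)[i - offset adj u])
        ⟨3, _, .assign 3 (.get 1 (.var 2)) s', by simp, ?_⟩ ?_
      · have := h1.get u hlt
        rw [show offset adj u + (i - offset adj u) = i by omega] at this
        simp [Expr.eval, hvar, this]
      · rintro _ - rfl
        have hf' : Frame (arcs y p) s (s'.setVar 3 (adj u)[i - offset adj u]) := by
          refine hf.trans ⟨fun z hz => ?_, fun _ _ => rfl⟩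
          have := (arcs_wv.1 hz).2.1
          simp [this]
        refine (hb ((adj u).take (i - offset adj u)) (adj u)[i - offset adj u] _ ?_ hf' (by simp)
          (hI _ _ 3 _ (.inr rfl) hIi)).mono le_rfl fun s'' _ h => ?_
        · rw [← List.take_succ_eq_append_getElem hlt]
          exact List.take_prefix _ _
        · refine hI _ _ 2 _ (.inl rfl) ?_
          rw [Nat.sub_add_comm hai, List.take_succ_eq_append_getElem hlt]
          exact h)
  refine key.mono ?_ fun s' _ h => by simpa using h
  simp only [Expr.cost]
  rw [Nat.add_sub_cancel_left]
  ring_nf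
  omega

/-- `for u in 0, …, n - 1 do p`, with the current vertex in variable `1`. -/
def verts (p : Prog) : Prog := forLoop 1 (.lit 0) (.var 0) p

theorem verts_wv {p : Prog} {z : ℕ} : (verts p).wv z = false ↔ z ≠ 1 ∧ p.wv z = false :=
  forLoop_wv

theorem verts_wa {p : Prog} {a : ℕ} : (verts p).wa a = false ↔ p.wa a = false :=
  forLoop_wa

theorem runs_verts {p : Prog} {s : State} {I : ℕ → State → Prop} (c : ℕ → ℕ) (hs : s.var 0 = n)
    (hp0 : p.wv 0 = false) (hp1 : p.wv 1 = false) (h0 : I 0 (s.setVar 1 0))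
    (hp : ∀ i s', (hi : i < n) → Frame (verts p) s s' → s'.var 1 = i → I i s' →
      Runs p s' (c i) fun s'' => I (i + 1) (s''.setVar 1 (i + 1))) :
    Runs (verts p) s (∑ i ∈ Finset.range n, c i + 7 * n + 6) (I n) := by
  refine (runs_forLoop (I := I) c (a := 0) (b := n) rfl (Nat.zero_le n) hp1 h0
    (fun s' hf => (hf.var 0 (verts_wv.2 ⟨by omega, hp0⟩)).trans hs)
    (fun i s' _ hi hf hvar hI => hp i s' hi hf hvar hI)).mono ?_ fun _ _ h => h
  simp only [Expr.cost, Finset.range_eq_Ico]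
  omega

/-- The size of the input. -/
def size (adj : Fin n → List (Fin n)) : ℕ := n + ∑ u, (adj u).length + 1

theorem runs_verts_const {p : Prog} {s : State} {I : ℕ → State → Prop} {c : ℕ} (hs : s.var 0 = n)
    (hp0 : p.wv 0 = false) (hp1 : p.wv 1 = false) (h0 : I 0 (s.setVar 1 0))
    (hp : ∀ i s', (hi : i < n) → Frame (verts p) s s' → s'.var 1 = i → I i s' →
      Runs p s' c fun s'' => I (i + 1) (s''.setVar 1 (i + 1))) :
    Runs (verts p) s ((c + 13) * size adj) (I n) := by
  refine (runs_verts (fun _ => c) hs hp0 hp1 h0 hp).mono ?_ fun _ _ h => h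
  rw [Finset.sum_const, Finset.card_range, smul_eq_mul, size]
  nlinarith [Nat.zero_le ((c + 13) * ∑ u, (adj u).length)]

/-- For every vertex, run through its list. -/
def cells (p : Prog) : Prog := verts (arcs 1 p)

theorem cells_wv {p : Prog} {z : ℕ} :
    (cells p).wv z = false ↔ z ≠ 1 ∧ z ≠ 2 ∧ z ≠ 3 ∧ p.wv z = false := by
  rw [cells, verts_wv, arcs_wv]

theorem cells_wa {p : Prog} {a : ℕ} : (cells p).wa a = false ↔ p.wa a = false := by
  rw [cells, verts_wa, arcs_wa]

/-- If the body updates only the cell of the current vertex in array `a`, then the final contents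
of each cell is the fold of the update function over the list of the vertex. -/
theorem runs_cells {p : Prog} {s : State} {a : ℕ} (g : Fin n → Fin n → ℕ → ℕ) (hs : Inp adj s)
    (hflat : p.flat = true) (hp : Safe p) (hp1 : p.wv 1 = false)
    (hrun : ∀ s' u x, Frame (cells p) s s' → s'.var 1 = Fin.val u → s'.var 3 = Fin.val x →
      ∀ w, (p.run s').arr a w = if w = u then g u x (s'.arr a u) else s'.arr a w) :
    Runs (cells p) s ((p.maxCost + 30) * size adj) fun s' =>
      ∀ w : Fin n, s'.arr a w = (adj w).foldl (fun acc x => g w x acc) (s.arr a w) := by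
  have key := runs_verts (p := arcs 1 p) (s := s)
    (I := fun i s' => ∀ w : Fin n, s'.arr a w =
      if w < i then (adj w).foldl (fun acc x => g w x acc) (s.arr a w) else s.arr a w)
    (fun i => if h : i < n then (p.maxCost + 12) * (adj ⟨i, h⟩).length + 9 else 0) hs.var
    (arcs_wv.2 ⟨by omega, by omega, hp.v0⟩) (arcs_wv.2 ⟨by omega, by omega, hp1⟩) (by simp) (by
      intro i s' hi hf hvar hI
      rw [dif_pos hi]
      refine (runs_arcs (u := ⟨i, hi⟩) (c := p.maxCost)
        (I := fun l s'' => ∀ w : Fin n, s''.arr a w =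
          if w = i then l.foldl (fun acc x => g w x acc) (s.arr a w) else s'.arr a w)
        (hs.frame hf (cells_wv.2 ⟨by omega, by omega, by omega, hp.v0⟩) (cells_wa.2 hp.a0)
          (cells_wa.2 hp.a1)) hvar (arcs_wv.2 ⟨by omega, by omega, hp1⟩) hp
        (fun _ _ _ _ _ h => h) ?_ ?_).mono le_rfl ?_
      · intro w
        split_ifs with h
        · rw [hI w, if_neg (by omega), List.foldl_nil]
        · rfl
      · intro l x s2 _ hf2 hx hI2
        have hf2' : Frame (cells p) s s2 := hf.trans (hf2.mono
          (fun y hy => (verts_wv.1 hy).2) fun b hb => verts_wa.1 hb)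
        refine (runs_flat hflat s2).mono le_rfl ?_
        rintro _ - rfl w
        have hv : s2.var 1 = i := (hf2.var 1 (arcs_wv.2 ⟨by omega, by omega, hp1⟩)).trans hvar
        rw [hrun s2 ⟨i, hi⟩ x hf2' hv hx w]
        have := hI2 w
        split_ifs with h
        · rw [if_pos h] at this
          rw [List.foldl_append, ← this]
          obtain rfl : w = ⟨i, hi⟩ := Fin.ext h
          rfl
        · rw [if_neg h] at this
          exact this
      · intro s2 _ h2 w
        rw [State.setVar_arr, h2 w, hI w]
        by_cases h : w.val = i
        · obtain rfl : w = ⟨i, hi⟩ := Fin.ext h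
          simp
        · rw [if_neg h]
          split_ifs <;> first | rfl | omega)
  refine key.mono ?_ fun s' _ h w => by rw [h w, if_pos w.isLt]
  have : ∑ i ∈ Finset.range n, (if h : i < n then (p.maxCost + 12) * (adj ⟨i, h⟩).length + 9 else 0)
      = (p.maxCost + 12) * ∑ u, (adj u).length + 9 * n := by
    rw [Finset.sum_range, Finset.mul_sum]
    simp only [Fin.is_lt, dite_true, Fin.eta, Finset.sum_add_distrib, Finset.sum_const,
      Finset.card_univ, Fintype.card_fin, smul_eq_mul]
    ring
  rw [this, size]
  nlinarith [Nat.zero_le (∑ u, (adj u).length), Nat.zero_le (p.maxCost * n)]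

theorem foldl_count {α : Type*} (q : α → Prop) [DecidablePred q] (l : List α) (a : ℕ) :
    l.foldl (fun acc x => if q x then acc + 1 else acc) a = a + l.countP (fun x => decide (q x)) := by
  induction l generalizing a with
  | nil => rfl
  | cons x l ih =>
    rw [List.foldl_cons, ih, List.countP_cons]
    by_cases h : q x
    · simp [h]
      omega
    · simp [h]

theorem foldl_flag {α : Type*} (q : α → Prop) [DecidablePred q] (l : List α) (a b : ℕ)
    [hd : Decidable (∃ x ∈ l, q x)] :
    l.foldl (fun acc x => if q x then b else acc) a = if ∃ x ∈ l, q x then b else a := by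
  obtain rfl : hd = Classical.dec _ := Subsingleton.elim _ _
  induction l generalizing a with
  | nil => simp
  | cons x l ih =>
    rw [List.foldl_cons, ih]
    by_cases h : q x <;> by_cases h' : ∃ y ∈ l, q y <;> simp [h, h']

/-- Counting along an adjacency list is counting neighbours. -/
theorem countP_eq_card {G : SimpleGraph (Fin n)} (hadj : G.IsAdjLists adj) (u : Fin n)
    (q : Fin n → Prop) [DecidablePred q] {F : Finset (Fin n)} (hF : ∀ x, x ∈ F ↔ G.Adj u x ∧ q x) :
    (adj u).countP (fun x => decide (q x)) = F.card := by
  rw [List.countP_eq_length_filter, ← List.toFinset_card_of_nodup ((hadj u).1.filter _)]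
  congr 1
  ext x
  simp [hF, (hadj u).2 x]

end Input

end RAM

namespace RAM

/-! ### Breadth-first search -/

section Bfs

variable {n : ℕ} {G : SimpleGraph (Fin n)} {adj : Fin n → List (Fin n)}

/-- The queue `Q` of a breadth-first search from `r`, of which the first `h` vertices have been
processed. -/
structure BfsInv (G : SimpleGraph (Fin n)) (r : Fin n) (Q : List (Fin n)) (h : ℕ) : Prop where
  nodup : Q.Nodup
  mem : r ∈ Q
  sorted : Q.Pairwise fun x y => G.dist r x ≤ G.dist r y
  closed : ∀ j < h, ∀ u, Q[j]? = some u → ∀ x, G.Adj u x → x ∈ Q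
  near : ∀ u, Q[h]? = some u → ∀ w ∈ Q, G.dist r w ≤ G.dist r u + 1

/-- An exhausted queue is closed under adjacency, so by connectedness it holds all `n` vertices. -/
theorem BfsInv.lt_length {r : Fin n} {Q : List (Fin n)} {h : ℕ} (hQ : BfsInv G r Q h)
    (hG : G.Connected) (hh : h < n) : h < Q.length := by
  by_contra! hle
  have hcl : ∀ u ∈ Q, ∀ x, G.Adj u x → x ∈ Q := by
    intro u hu x hx
    obtain ⟨j, hj, rfl⟩ := List.mem_iff_getElem.1 hu
    exact hQ.closed j (by omega) _ (List.getElem?_eq_getElem hj) x hx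
  have hall : ∀ u, u ∈ Q := by
    intro u
    obtain ⟨p⟩ := hG.preconnected r u
    have : ∀ {a b} (p : G.Walk a b), a ∈ Q → b ∈ Q := by
      intro a b p
      induction p with
      | nil => exact id
      | cons hadj _ ih => exact fun ha => ih (hcl _ ha _ hadj)
    exact this p hQ.mem
  have h1 := List.toFinset_card_of_nodup hQ.nodup
  have h2 : Q.toFinset = Finset.univ := by
    ext u
    simp [hall u]
  rw [h2, Finset.card_univ, Fintype.card_fin] at h1
  omega

/-- All vertices up to the layer of the head are already in the queue: a neighbour one layer lower
precedes the head, the queue being sorted, and has been processed. -/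
theorem BfsInv.dist_eq {r : Fin n} {Q : List (Fin n)} {h : ℕ} (hQ : BfsInv G r Q h)
    (hG : G.Connected) {u x : Fin n} (hu : Q[h]? = some u) (hux : G.Adj u x) (hx : x ∉ Q) :
    G.dist r x = G.dist r u + 1 := by
  have h1 := hG.dist_le_succ hux r
  have hlow : ∀ d w, G.dist r w = d → d ≤ G.dist r u → w ∈ Q := by
    intro d
    induction d with
    | zero =>
      intro w hw _
      rw [hG.dist_eq_zero_iff] at hw
      exact hw ▸ hQ.mem
    | succ d ih =>
      intro w hw hd
      obtain ⟨y, hwy, hy⟩ := hG.exists_adj_dist hw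
      obtain ⟨j, hj, hjy⟩ := List.mem_iff_getElem.1 (ih y hy (by omega))
      refine hQ.closed j ?_ y (by rw [List.getElem?_eq_getElem hj, hjy]) w hwy.symm
      by_contra! hle
      obtain ⟨hh, hhu⟩ := List.getElem?_eq_some_iff.1 hu
      rcases hle.eq_or_lt with rfl | hlt
      · rw [hjy] at hhu
        subst hhu
        omega
      · have := List.pairwise_iff_getElem.1 hQ.sorted h j hh hj hlt
        rw [hjy, hhu] at this
        omega
  by_contra hne
  exact hx (hlow _ x rfl (by omega))

theorem BfsInv.append {r : Fin n} {Q : List (Fin n)} {h : ℕ} (hQ : BfsInv G r Q h)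
    (hG : G.Connected) {u x : Fin n} (hu : Q[h]? = some u) (hux : G.Adj u x) (hx : x ∉ Q) :
    BfsInv G r (Q ++ [x]) h := by
  have hd := hQ.dist_eq hG hu hux hx
  have hh := (List.getElem?_eq_some_iff.1 hu).1
  have hget : ∀ j ≤ h, (Q ++ [x])[j]? = Q[j]? := fun j hj => List.getElem?_append_left (by omega)
  refine ⟨?_, by simp [hQ.mem], ?_, ?_, ?_⟩
  · rw [List.nodup_append]
    refine ⟨hQ.nodup, by simp, ?_⟩
    rintro a ha b hb rfl
    exact hx (by simpa [List.mem_singleton.1 hb] using ha)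
  · rw [List.pairwise_append]
    refine ⟨hQ.sorted, by simp, fun a ha b hb => ?_⟩
    rw [List.mem_singleton.1 hb, hd]
    exact hQ.near u hu a ha
  · intro j hj w hw y hy
    rw [hget j hj.le] at hw
    exact List.mem_append_left _ (hQ.closed j hj w hw y hy)
  · intro w hw y hy
    rw [hget h le_rfl, hu] at hw
    obtain rfl := Option.some_inj.1 hw
    rcases List.mem_append.1 hy with hy | hy
    · exact hQ.near u hu y hy
    · rw [List.mem_singleton.1 hy, hd]

theorem BfsInv.succ {r : Fin n} {Q : List (Fin n)} {h : ℕ} (hQ : BfsInv G r Q h) {u : Fin n}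
    (hu : Q[h]? = some u) (hall : ∀ x, G.Adj u x → x ∈ Q) : BfsInv G r Q (h + 1) := by
  refine ⟨hQ.nodup, hQ.mem, hQ.sorted, fun j hj w hw => ?_, fun w hw y hy => ?_⟩
  · rcases (Nat.lt_succ_iff.1 hj).eq_or_lt with rfl | hj
    · rw [hu] at hw
      obtain rfl := Option.some_inj.1 hw
      exact hall
    · exact hQ.closed j hj w hw
  · obtain ⟨h1, h1u⟩ := List.getElem?_eq_some_iff.1 hu
    obtain ⟨h2, h2w⟩ := List.getElem?_eq_some_iff.1 hw
    have h3 := List.pairwise_iff_getElem.1 hQ.sorted h (h + 1) h1 h2 (by omega)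
    rw [h1u, h2w] at h3
    have := hQ.near u hu y hy
    omega

/-- Discover the neighbour `3` of vertex `1`. -/
def bfsStep (D q : ℕ) : Prog :=
  .ite (.eq (.get D (.var 3)) (.lit 0))
    (.seq (.store D (.var 3) (.succ (.get D (.var 1))))
      (.seq (.store q (.var 6) (.var 3)) (.assign 6 (.succ (.var 6))))) .skip

/-- Breadth-first search from the vertex in variable `4`: distances plus one go to array `D`, the
queue to array `q`. -/
def bfs (D q : ℕ) : Prog :=
  .seq (.store D (.var 4) (.lit 1)) (.seq (.store q (.lit 0) (.var 4)) (.seq (.assign 6 (.lit 1))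
    (forLoop 5 (.lit 0) (.var 0) (.seq (.assign 1 (.get q (.var 5))) (arcs 1 (bfsStep D q))))))

/-- The memory holds the queue `Q` and the distances of its members. -/
structure BfsRep (G : SimpleGraph (Fin n)) (r : Fin n) (D q : ℕ) (Q : List (Fin n)) (s : State) :
    Prop where
  tail : s.var 6 = Q.length
  queue : ∀ j u, Q[j]? = some u → s.arr q j = Fin.val u
  dist : ∀ w : Fin n, s.arr D w = if w ∈ Q then G.dist r w + 1 else 0

theorem BfsRep.setVar {r : Fin n} {D q : ℕ} {Q : List (Fin n)} {s : State}
    (h : BfsRep G r D q Q s) {x : ℕ} (k : ℕ) (hx : 6 ≠ x) : BfsRep G r D q Q (s.setVar x k) :=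
  ⟨by simpa [hx] using h.tail, h.queue, h.dist⟩

theorem BfsRep.append {r : Fin n} {D q : ℕ} (hDq : D ≠ q) {Q : List (Fin n)} {s : State} {h : ℕ}
    (hs : BfsRep G r D q Q s) (hG : G.Connected) (hQ : BfsInv G r Q h) {u x : Fin n}
    (hu : Q[h]? = some u) (hux : G.Adj u x) (hx : x ∉ Q) (h1 : s.var 1 = u) (h3 : s.var 3 = x) :
    BfsRep G r D q (Q ++ [x]) ((bfsStep D q).run s) := by
  have hx0 : s.arr D x = 0 := by rw [hs.dist, if_neg hx]
  have huQ : u ∈ Q := List.mem_of_getElem? hu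
  have hrun : (bfsStep D q).run s =
      ((s.setArr D x (G.dist r u + 2)).setArr q Q.length x).setVar 6 (Q.length + 1) := by
    simp [bfsStep, Prog.run, Test.eval, Expr.eval, h1, h3, hx0, hs.tail, hs.dist u, huQ]
  rw [hrun]
  refine ⟨by simp, fun j w hw => ?_, fun w => ?_⟩
  · rw [State.setVar_arr, State.setArr_arr_same]
    by_cases hj : j < Q.length
    · rw [List.getElem?_append_left hj] at hw
      rw [if_neg (by omega), State.setArr_arr_of_ne _ _ _ hDq.symm]
      exact hs.queue j w hw
    · have hj' := (List.getElem?_eq_some_iff.1 hw).1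
      rw [List.length_append, List.length_singleton] at hj'
      obtain rfl : j = Q.length := by omega
      simp only [List.getElem?_concat_length, Option.some.injEq] at hw
      simp [hw]
  · rw [State.setVar_arr, State.setArr_arr_of_ne _ _ _ hDq, State.setArr_arr_same, hs.dist w]
    by_cases hwx : w = x
    · subst hwx
      simp [hQ.dist_eq hG hu hux hx]
    · have : w.val ≠ x.val := fun h => hwx (Fin.ext h)
      simp [hwx, this]

/-- Distances are stored plus one, so the 0 of fresh memory means undiscovered. -/
theorem runs_bfs {D q : ℕ} {s : State} {r : Fin n} (hG : G.Connected) (hadj : G.IsAdjLists adj)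
    (hs : Inp adj s) (hD : 2 ≤ D) (hq : 2 ≤ q) (hDq : D ≠ q) (hr : s.var 4 = r)
    (h0 : ∀ w : Fin n, s.arr D w = 0) :
    Runs (bfs D q) s (40 * size adj) fun s' => (∀ w : Fin n, s'.arr D w = G.dist r w + 1) ∧
      ∃ e : Fin n → Fin n, Function.Bijective e ∧ (∀ j : Fin n, s'.arr q j = e j) ∧
        ∀ i j, i ≤ j → G.dist r (e i) ≤ G.dist r (e j) := by
  have hsafe : Safe (bfsStep D q) := by
    constructor <;> simp [bfsStep, Prog.wv, Prog.wa] <;> omega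
  have hn : 0 < n := r.pos
  set s3 := ((s.setArr D r 1).setArr q 0 r).setVar 6 1 with hs3
  have hinp3 : Inp adj s3 := by
    refine ⟨by simpa [hs3] using hs.var, fun i hi => ?_, ?_⟩
    · rw [hs3, State.setVar_arr, State.setArr_arr_of_ne _ _ _ (by omega),
        State.setArr_arr_of_ne _ _ _ (by omega), hs.off i hi]
    · rw [hs3, State.setVar_arr, State.setArr_arr_of_ne _ _ _ (by omega),
        State.setArr_arr_of_ne _ _ _ (by omega), hs.list]
  have hrep3 : BfsRep G r D q [r] s3 := by
    refine ⟨by simp [hs3], fun j u hu => ?_, fun w => ?_⟩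
    · obtain ⟨hj, hju⟩ := List.getElem?_eq_some_iff.1 hu
      rw [List.length_singleton] at hj
      obtain rfl : j = 0 := by omega
      simp only [List.getElem_cons_zero] at hju
      simp [hs3, hju]
    · rw [hs3, State.setVar_arr, State.setArr_arr_of_ne _ _ _ hDq, State.setArr_arr_same]
      by_cases hw : w = r
      · simp [hw]
      · have : w.val ≠ r.val := fun h => hw (Fin.ext h)
        simp [hw, this, h0 w]
  have hinv3 : BfsInv G r [r] 0 := by
    refine ⟨by simp, by simp, by simp, fun j hj => by omega, fun u hu w hw => ?_⟩
    simp only [List.mem_singleton] at hw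
    simp [hw]
  have key := exec_forLoop (x := 5) (lo := .lit 0) (hi := .var 0)
    (p := .seq (.assign 1 (.get q (.var 5))) (arcs 1 (bfsStep D q))) (s := s3) (a := 0) (b := n)
    -- A round costs as much as the degree of the vertex it dequeues, which is unknown beforehand.
    -- The invariant therefore carries the time; the queue ends up with every vertex once, and the
    -- total is a sum of degrees.
    (I := fun h T s' => ∃ Q, BfsInv G r Q h ∧ BfsRep G r D q Q s' ∧
      T ≤ ((Q.take h).map fun w => 29 * (adj w).length + 12).sum)
    rfl (Nat.zero_le n) (by simp [Prog.wv, arcs, forLoop, bfsStep])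
    ⟨[r], hinv3, hrep3.setVar 0 (by omega), by simp⟩
    (fun i T s' hf _ => (hf.var 0 (by simp [Prog.wv, arcs, forLoop, bfsStep])).trans hinp3.var)
    (by
      rintro h T s' - hh hf hvar ⟨Q, hQ, hrep, hT⟩
      have hlen := hQ.lt_length hG hh
      obtain ⟨u, hu⟩ : ∃ u, Q[h]? = some u := ⟨_, List.getElem?_eq_getElem hlen⟩
      have hinp' : Inp adj s' := hinp3.frame hf (by simp [Prog.wv, arcs, forLoop, bfsStep])
        (by simp [Prog.wa, arcs, forLoop, bfsStep]; omega)
        (by simp [Prog.wa, arcs, forLoop, bfsStep]; omega)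
      have h1 : Exec (.assign 1 (.get q (.var 5))) s' 3 (s'.setVar 1 u) := by
        have := Exec.assign 1 (.get q (.var 5)) s'
        simpa [Expr.eval, Expr.cost, hvar, hrep.queue h u hu] using this
      have hinp1 : Inp adj (s'.setVar 1 u) := hinp'.frame h1.frame rfl rfl rfl
      obtain ⟨t, s2, h2, ht, Q2, ⟨l2, rfl⟩, hQ2, hrep2, hmem2⟩ := runs_arcs (y := 1)
        (p := bfsStep D q) (u := u) (c := 17)
        (I := fun l s'' => ∃ Q', Q <+: Q' ∧ BfsInv G r Q' h ∧ BfsRep G r D q Q' s'' ∧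
          ∀ x ∈ l, x ∈ Q') hinp1 (by simp) (by simp [arcs, forLoop, bfsStep, Prog.wv]) hsafe
        (by
          rintro l s'' z v hz ⟨Q', hpre, h3, h4, h5⟩
          exact ⟨Q', hpre, h3, h4.setVar v (by omega), h5⟩)
        ⟨Q, List.prefix_rfl, hQ, hrep.setVar _ (by omega), by simp⟩
        (by
          rintro l x s'' hl hf' hx ⟨_, ⟨l', rfl⟩, h3, h4, h5⟩
          have hu' : (Q ++ l')[h]? = some u := by rwa [List.getElem?_append_left hlen]
          have hux : G.Adj u x := ((hadj u).2 x).1 (hl.subset (by simp))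
          have hv1 : s''.var 1 = u :=
            (hf'.var 1 (by simp [arcs, forLoop, bfsStep, Prog.wv])).trans (by simp)
          refine (runs_flat (by rfl) s'').mono
            (by simp [bfsStep, Prog.maxCost, Test.cost, Expr.cost]) ?_
          rintro _ - rfl
          by_cases hxQ : x ∈ Q ++ l'
          · have hrun : (bfsStep D q).run s'' = s'' := by
              simp [bfsStep, Prog.run, Test.eval, Expr.eval, hx, h4.dist x, hxQ]
            rw [hrun]
            refine ⟨_, ⟨l', rfl⟩, h3, h4, fun y hy => ?_⟩
            rcases List.mem_append.1 hy with hy | hy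
            · exact h5 y hy
            · rwa [List.mem_singleton.1 hy]
          · refine ⟨_, ⟨l' ++ [x], (List.append_assoc ..).symm⟩, h3.append hG hu' hux hxQ,
              h4.append hDq hG h3 hu' hux hxQ hv1 hx, fun y hy => ?_⟩
            rcases List.mem_append.1 hy with hy | hy
            · exact List.mem_append_left _ (h5 y hy)
            · exact List.mem_append_right _ hy)
      have hu2 : (Q ++ l2)[h]? = some u := by rwa [List.getElem?_append_left hlen]
      refine ⟨_, _, h1.seq h2, Q ++ l2,
        hQ2.succ hu2 fun x hx => hmem2 x (((hadj u).2 x).2 hx), hrep2.setVar _ (by omega), ?_⟩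
      rw [List.take_append_of_le_length (by omega), List.take_add_one, hu]
      simp only [Option.toList_some, List.map_append, List.sum_append, List.map_cons,
        List.map_nil, List.sum_singleton]
      omega)
  obtain ⟨t, T, s', h1, h2, Q, hQ, hrep, hT⟩ := key
  have hlen : Q.length = n := by
    have h3 := hQ.nodup.length_le_card
    rw [Fintype.card_fin] at h3
    refine le_antisymm h3 ?_
    by_contra! hlt
    have hQ' : BfsInv G r Q Q.length :=
      ⟨hQ.nodup, hQ.mem, hQ.sorted, fun j hj => hQ.closed j (by omega), fun u hu => by simp at hu⟩
    exact lt_irrefl _ (hQ'.lt_length hG hlt)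
  have hinj : Function.Injective fun j : Fin n => Q[j.val]'(by omega) := by
    intro i j hij
    exact Fin.ext ((hQ.nodup.getElem_inj_iff).1 hij)
  have hbij := Finite.injective_iff_bijective.1 hinj
  have hall : ∀ w, w ∈ Q := fun w => by
    obtain ⟨j, rfl⟩ := hbij.2 w
    exact List.getElem_mem _
  have e1 : Exec (.store D (.var 4) (.lit 1)) s 3 (s.setArr D r 1) := by
    have := Exec.store D (.var 4) (.lit 1) s
    simpa [Expr.eval, Expr.cost, hr] using this
  have e2 : Exec (.store q (.lit 0) (.var 4)) (s.setArr D r 1) 3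
      ((s.setArr D r 1).setArr q 0 r) := by
    have := Exec.store q (.lit 0) (.var 4) (s.setArr D r 1)
    simpa [Expr.eval, Expr.cost, hr] using this
  have e3 : Exec (.assign 6 (.lit 1)) ((s.setArr D r 1).setArr q 0 r) 2 s3 :=
    .assign 6 (.lit 1) _
  refine ⟨_, s', e1.seq (e2.seq (e3.seq h1)), ?_, fun w => ?_, _, hbij,
    fun j => hrep.queue _ _ (List.getElem?_eq_getElem _), fun i j hij => ?_⟩
  · have huniv : Q.toFinset = Finset.univ := by
      ext u
      simp [hall u]
    rw [List.take_of_length_le hlen.le, ← List.sum_toFinset _ hQ.nodup, huniv,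
      Finset.sum_add_distrib, ← Finset.mul_sum, Finset.sum_const, Finset.card_univ,
      Fintype.card_fin, smul_eq_mul] at hT
    simp only [Expr.cost, Nat.sub_zero] at h2
    rw [size]
    omega
  · rw [hrep.dist w, if_pos (hall w)]
  · rcases hij.eq_or_lt with rfl | hlt
    · exact le_rfl
    · exact List.pairwise_iff_getElem.1 hQ.sorted i j (by omega) (by omega) hlt

end Bfs

/-! ### Minima -/

section Argmin

variable {n : ℕ} {adj : Fin n → List (Fin n)}

/-- Among the vertices with the entries of vertex `4` in arrays `A` and `B`, find one with the
least entry in array `C`. -/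
def argmin (A B C : ℕ) : Prog :=
  verts (.ite (.and (.eq (.get A (.var 1)) (.get A (.var 4)))
    (.and (.eq (.get B (.var 1)) (.get B (.var 4))) (.lt (.get C (.var 1)) (.get C (.var 4)))))
    (.assign 4 (.var 1)) .skip)

/-- A candidate is replaced only by a vertex with the same entries in `A` and `B`, so comparing with
the current candidate amounts to comparing with `b₀`. -/
theorem runs_argmin {A B C : ℕ} {s : State} {b₀ : Fin n} (hs : s.var 0 = n)
    (hb : s.var 4 = b₀) :
    Runs (argmin A B C) s (40 * size adj) fun s' => ∃ b : Fin n, s'.var 4 = b ∧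
      s.arr A b = s.arr A b₀ ∧ s.arr B b = s.arr B b₀ ∧
      ∀ u : Fin n, s.arr A u = s.arr A b₀ → s.arr B u = s.arr B b₀ → s.arr C b ≤ s.arr C u := by
  refine (runs_verts_const (adj := adj) (c := 22) (I := fun i s' => ∃ b : Fin n, s'.var 4 = b ∧
      s.arr A b = s.arr A b₀ ∧ s.arr B b = s.arr B b₀ ∧ s.arr C b ≤ s.arr C b₀ ∧
      ∀ u : Fin n, u < i → s.arr A u = s.arr A b₀ → s.arr B u = s.arr B b₀ →
        s.arr C b ≤ s.arr C u) hs rfl rfl ⟨b₀, by simpa using hb, rfl, rfl, le_rfl, by simp⟩ ?_).mono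
    (Nat.mul_le_mul_right _ (by omega)) ?_
  · rintro i s' hi hf hvar ⟨b, h1, h2, h3, h4, h5⟩
    refine (runs_flat (by rfl) s').mono (by simp [Prog.maxCost, Test.cost, Expr.cost]) ?_
    rintro _ - rfl
    have harr : s'.arr = s.arr := by
      funext a
      exact hf.arr a rfl
    simp only [Prog.run, Test.eval, Expr.eval, hvar, h1, harr, Bool.and_eq_true, decide_eq_true_eq]
    split_ifs with hc
    · refine ⟨⟨i, hi⟩, by simp, hc.1.trans h2, hc.2.1.trans h3, hc.2.2.le.trans h4,
        fun u hu hA hB => ?_⟩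
      rcases (Nat.lt_succ_iff.1 hu).eq_or_lt with hu | hu
      · exact (congrArg _ hu.symm).le
      · exact hc.2.2.le.trans (h5 u hu hA hB)
    · refine ⟨b, by simpa using h1, h2, h3, h4, fun u hu hA hB => ?_⟩
      rcases (Nat.lt_succ_iff.1 hu).eq_or_lt with hu | hu
      · subst hu
        by_contra! hlt
        exact hc ⟨hA.trans h2.symm, hB.trans h3.symm, hlt⟩
      · exact h5 u hu hA hB
  · rintro s' - ⟨b, h1, h2, h3, -, h5⟩
    exact ⟨b, h1, h2, h3, fun u => h5 u u.isLt⟩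

end Argmin

end RAM

namespace RAM

/-! ### Loops that update one cell per vertex -/

section Cells

variable {n : ℕ} {adj : Fin n → List (Fin n)}

/-- `if b then a[u] := e` for the current vertex `u`. -/
def update (a : ℕ) (b : Test) (e : Expr) : Prog := .ite b (.store a (.var 1) e) .skip

/-- The test and the value may depend on the old entry, which covers counters, flags and running
minima alike. The time constant is 36 + 4 + 30. -/
theorem runs_update {a : ℕ} {b : Test} {e : Expr} {s : State} (q : Fin n → Fin n → ℕ → Prop)
    [∀ u x k, Decidable (q u x k)] (g : Fin n → ℕ → ℕ) (hs : Inp adj s) (ha : 2 ≤ a)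
    (hcost : b.cost + e.cost ≤ 36)
    (hb : ∀ s' (u x : Fin n), Frame (cells (update a b e)) s s' → s'.var 1 = u →
      s'.var 3 = x → (b.eval s' = true ↔ q u x (s'.arr a u)))
    (he : ∀ s' (u x : Fin n), Frame (cells (update a b e)) s s' → s'.var 1 = u →
      s'.var 3 = x → e.eval s' = g x (s'.arr a u)) :
    Runs (cells (update a b e)) s (70 * size adj) fun s' => ∀ w : Fin n,
      s'.arr a w = (adj w).foldl (fun acc x => if q w x acc then g x acc else acc) (s.arr a w) := by
  refine (runs_cells (p := update a b e) (a := a)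
    (fun u x acc => if q u x acc then g x acc else acc) hs rfl
    ⟨rfl, rfl, by simp [update, Prog.wa]; omega, by simp [update, Prog.wa]; omega⟩ rfl ?_).mono
    (Nat.mul_le_mul_right _ ?_) fun _ _ h => h
  · intro s' u x hf h1 h3 w
    have h4 := hb s' u x hf h1 h3
    have h5 := he s' u x hf h1 h3
    by_cases hq : q u x (s'.arr a u)
    · simp only [update, Prog.run, if_pos (h4.2 hq), Expr.eval, State.setArr_arr_same, h5, h1,
        if_pos hq]
    · simp only [update, Prog.run, if_neg (mt h4.1 hq), if_neg hq]
      split_ifs with hw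
      · rw [hw]
      · rfl
  · simp only [update, Prog.maxCost, Expr.cost]
    omega

theorem update_wa {a a' : ℕ} {b : Test} {e : Expr} (h : a' ≠ a) :
    (cells (update a b e)).wa a' = false := by
  rw [cells_wa]
  simpa [update, Prog.wa] using h

theorem update_wv {a z : ℕ} {b : Test} {e : Expr} (h1 : z ≠ 1) (h2 : z ≠ 2) (h3 : z ≠ 3) :
    (cells (update a b e)).wv z = false :=
  cells_wv.2 ⟨h1, h2, h3, rfl⟩

/-- Add to `a[u]` the number of neighbours of `u` with a smaller entry in `D`. -/
def countDown (D a : ℕ) : Prog :=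
  cells (update a (.lt (.get D (.var 3)) (.get D (.var 1))) (.succ (.get a (.var 1))))

theorem runs_countDown {D a : ℕ} {s : State} (hs : Inp adj s) (ha : 2 ≤ a) (hD : D ≠ a) :
    Runs (countDown D a) s (70 * size adj) fun s' => ∀ w : Fin n,
      s'.arr a w = s.arr a w + (adj w).countP fun x : Fin n => decide (s.arr D x < s.arr D w) := by
  refine (runs_update (fun u x _ => s.arr D x < s.arr D u) (fun _ k => k + 1) hs ha
    (by simp [Test.cost, Expr.cost]) (fun s' u x hf h1 h3 => ?_) fun s' u x hf h1 h3 => ?_).mono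
    le_rfl fun s' _ h w => ?_
  · simp [Test.eval, Expr.eval, h1, h3, hf.arr D (update_wa hD)]
  · simp [Expr.eval, h1]
  · rw [h w]
    exact foldl_count _ _ _

/-- Mark the lower neighbours of vertex `4` in array `6`. -/
def markDown : Prog :=
  cells (update 6 (.and (.eq (.var 3) (.var 4)) (.lt (.get 3 (.var 1)) (.get 3 (.var 3)))) (.lit 1))

theorem runs_markDown {s : State} (hs : Inp adj s) :
    Runs markDown s (70 * size adj) fun s' => ∀ w : Fin n, s'.arr 6 w =
      if ∃ x ∈ adj w, x.val = s.var 4 ∧ s.arr 3 w < s.arr 3 x then 1 else s.arr 6 w := by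
  refine (runs_update (fun u x _ => x.val = s.var 4 ∧ s.arr 3 u < s.arr 3 x) (fun _ _ => 1) hs
    (by omega) (by simp [Test.cost, Expr.cost]) (fun s' u x hf h1 h3 => ?_)
    fun s' u x hf h1 h3 => rfl).mono le_rfl fun s' _ h w => ?_
  · simp [Test.eval, Expr.eval, h1, h3, hf.arr 3 (update_wa (by omega)),
      hf.var 4 (update_wv (by omega) (by omega) (by omega))]
  · rw [h w]
    exact foldl_flag (fun x : Fin n => x.val = s.var 4 ∧ s.arr 3 w < s.arr 3 x) _ _ _

/-- Mark in array `7` the vertices with an unmarked lower neighbour. -/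
def markBad : Prog :=
  cells (update 7 (.and (.lt (.get 3 (.var 3)) (.get 3 (.var 1))) (.eq (.get 6 (.var 3)) (.lit 0)))
    (.lit 1))

theorem runs_markBad {s : State} (hs : Inp adj s) :
    Runs markBad s (70 * size adj) fun s' => ∀ w : Fin n, s'.arr 7 w =
      if ∃ x ∈ adj w, s.arr 3 x < s.arr 3 w ∧ s.arr 6 x = 0 then 1 else s.arr 7 w := by
  refine (runs_update (fun u x _ => s.arr 3 x < s.arr 3 u ∧ s.arr 6 x = 0) (fun _ _ => 1) hs
    (by omega) (by simp [Test.cost, Expr.cost]) (fun s' u x hf h1 h3 => ?_)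
    fun s' u x hf h1 h3 => rfl).mono le_rfl fun s' _ h w => ?_
  · simp [Test.eval, Expr.eval, h1, h3, hf.arr 3 (update_wa (by omega)),
      hf.arr 6 (update_wa (by omega))]
  · rw [h w]
    exact foldl_flag (fun x : Fin n => s.arr 3 x < s.arr 3 w ∧ s.arr 6 x = 0) _ _ _

/-- Count in array `8` the marked neighbours in the layer of vertex `4`. -/
def countOut : Prog :=
  cells (update 8 (.and (.eq (.get 3 (.var 3)) (.get 3 (.var 4)))
    (.not (.eq (.get 7 (.var 3)) (.lit 0)))) (.succ (.get 8 (.var 1))))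

theorem runs_countOut {s : State} (hs : Inp adj s) :
    Runs countOut s (70 * size adj) fun s' => ∀ w : Fin n, s'.arr 8 w = s.arr 8 w +
      (adj w).countP fun x : Fin n => decide (s.arr 3 x = s.arr 3 (s.var 4) ∧ s.arr 7 x ≠ 0) := by
  refine (runs_update (fun _ x _ => s.arr 3 x = s.arr 3 (s.var 4) ∧ s.arr 7 x ≠ 0)
    (fun _ k => k + 1) hs (by omega) (by simp [Test.cost, Expr.cost])
    (fun s' u x hf h1 h3 => ?_) fun s' u x hf h1 h3 => ?_).mono le_rfl fun s' _ h w => ?_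
  · simp [Test.eval, Expr.eval, h3, hf.arr 3 (update_wa (by omega)),
      hf.arr 7 (update_wa (by omega)), hf.var 4 (update_wv (by omega) (by omega) (by omega))]
  · simp [Expr.eval, h1]
  · rw [h w]
    exact foldl_count _ _ _

/-- Find for each vertex a lower neighbour (plus one) with least entry in array `11`. -/
def findParent : Prog :=
  cells (update 12 (.and (.lt (.get 9 (.var 3)) (.get 9 (.var 1)))
    (.not (.and (.not (.eq (.get 12 (.var 1)) (.lit 0)))
      (.not (.lt (.get 11 (.var 3)) (.get 11 (.pred (.get 12 (.var 1)))))))))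
    (.succ (.var 3)))

/-- The accumulator is 0 until a vertex qualifies and then a best vertex plus one, so no separate
flag is needed. -/
theorem foldl_argmin (κ : ℕ → ℕ) (q : Fin n → Prop) [DecidablePred q] (l : List (Fin n)) :
    (l.foldl (fun acc x => if q x ∧ (acc = 0 ∨ κ x < κ (acc - 1)) then x.val + 1 else acc) 0 = 0 ∧
      ∀ x ∈ l, ¬ q x) ∨
    ∃ p ∈ l, l.foldl (fun acc x => if q x ∧ (acc = 0 ∨ κ x < κ (acc - 1)) then x.val + 1 else acc)
      0 = p + 1 ∧ q p ∧ ∀ x ∈ l, q x → κ p ≤ κ x := by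
  induction l using List.reverseRecOn with
  | nil => exact .inl ⟨rfl, by simp⟩
  | append_singleton l x ih =>
    simp only [List.foldl_append, List.foldl_cons, List.foldl_nil]
    rcases ih with ⟨h1, h2⟩ | ⟨p, hp, h1, h2, h3⟩
    · rw [h1]
      by_cases hx : q x
      · right
        refine ⟨x, by simp, by simp [hx], hx, fun y hy hqy => ?_⟩
        rcases List.mem_append.1 hy with hy | hy
        · exact absurd hqy (h2 y hy)
        · rw [List.mem_singleton.1 hy]
      · left
        refine ⟨by simp [hx], fun y hy => ?_⟩
        rcases List.mem_append.1 hy with hy | hy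
        · exact h2 y hy
        · rwa [List.mem_singleton.1 hy]
    · right
      rw [h1]
      simp only [Nat.add_eq_zero_iff, one_ne_zero, and_false, false_or, Nat.add_sub_cancel]
      by_cases hx : q x ∧ κ x < κ p
      · refine ⟨x, by simp, by rw [if_pos hx], hx.1, fun y hy hqy => ?_⟩
        rcases List.mem_append.1 hy with hy | hy
        · exact hx.2.le.trans (h3 y hy hqy)
        · rw [List.mem_singleton.1 hy]
      · refine ⟨p, List.mem_append_left _ hp, by rw [if_neg hx], h2, fun y hy hqy => ?_⟩
        rcases List.mem_append.1 hy with hy | hy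
        · exact h3 y hy hqy
        · rw [List.mem_singleton.1 hy] at hqy ⊢
          by_contra! hlt
          exact hx ⟨hqy, hlt⟩

theorem runs_findParent {s : State} (hs : Inp adj s) (h0 : ∀ w : Fin n, s.arr 12 w = 0) :
    Runs findParent s (70 * size adj) fun s' => ∀ w : Fin n,
      (s'.arr 12 w = 0 ∧ ∀ x ∈ adj w, ¬ s.arr 9 x < s.arr 9 w) ∨
      ∃ p ∈ adj w, s'.arr 12 w = p + 1 ∧ s.arr 9 p < s.arr 9 w ∧
        ∀ x ∈ adj w, s.arr 9 x < s.arr 9 w → s.arr 11 p ≤ s.arr 11 x := by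
  refine (runs_update (fun u x k => s.arr 9 x < s.arr 9 u ∧ (k = 0 ∨ s.arr 11 x < s.arr 11 (k - 1)))
    (fun x _ => x + 1) hs (by omega) (by simp [Test.cost, Expr.cost])
    (fun s' u x hf h1 h3 => ?_) fun s' u x hf h1 h3 => ?_).mono le_rfl fun s' _ h w => ?_
  · simp only [Test.eval, Expr.eval, h1, h3, hf.arr 9 (update_wa (by omega)),
      hf.arr 11 (update_wa (by omega)), Bool.and_eq_true, Bool.not_eq_true', decide_eq_true_eq,
      Bool.and_eq_false_iff, Bool.not_eq_false']
  · simp [Expr.eval, h3]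
  · rw [h w, h0 w]
    exact foldl_argmin (s.arr 11) (fun x => s.arr 9 x < s.arr 9 w) (adj w)

/-- Give class `1` to the neighbours of the vertex of the path in the same layer. -/
def markNear : Prog :=
  cells (update 14 (.eq (.var 3) (.get 13 (.get 9 (.var 1)))) (.lit 1))

theorem runs_markNear {s : State} (hs : Inp adj s) :
    Runs markNear s (70 * size adj) fun s' => ∀ w : Fin n, s'.arr 14 w =
      if ∃ x ∈ adj w, x.val = s.arr 13 (s.arr 9 w) then 1 else s.arr 14 w := by
  refine (runs_update (fun u x _ => x.val = s.arr 13 (s.arr 9 u)) (fun _ _ => 1) hs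
    (by omega) (by simp [Test.cost, Expr.cost]) (fun s' u x hf h1 h3 => ?_)
    fun s' u x hf h1 h3 => rfl).mono le_rfl fun s' _ h w => ?_
  · simp [Test.eval, Expr.eval, h1, h3, hf.arr 9 (update_wa (by omega)),
      hf.arr 13 (update_wa (by omega))]
  · rw [h w]
    exact foldl_flag (fun x : Fin n => x.val = s.arr 13 (s.arr 9 w)) _ _ _

/-- Initialise the keys. -/
def initKey : Prog :=
  verts (.ite (.lt (.get 9 (.var 1)) (.lit 3)) (.store 11 (.var 1) (.get 3 (.var 1))) .skip)

theorem runs_initKey {s : State} (hs : s.var 0 = n) (h0 : ∀ w : Fin n, s.arr 11 w = 0) :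
    Runs initKey s (70 * size adj) fun s' => ∀ w : Fin n, s'.arr 11 w =
      if s.arr 9 w < 3 then s.arr 3 w else 0 := by
  refine (runs_verts_const (adj := adj) (c := 11) (I := fun i s' => ∀ w : Fin n, s'.arr 11 w =
      if w < i ∧ s.arr 9 w < 3 then s.arr 3 w else 0) hs rfl rfl (by simp [h0]) ?_).mono
    (Nat.mul_le_mul_right _ (by omega)) ?_
  · intro i s' hi hf hvar hI
    refine (runs_flat (by rfl) s').mono (by simp [Prog.maxCost, Test.cost, Expr.cost]) ?_
    rintro _ - rfl w
    have h3 : s'.arr 3 = s.arr 3 := hf.arr 3 rfl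
    have h9 : s'.arr 9 = s.arr 9 := hf.arr 9 rfl
    have := hI w
    simp only [Prog.run, Test.eval, Expr.eval, hvar, h3, h9, decide_eq_true_eq]
    by_cases hw : w.val = i
    · subst hw
      by_cases hc : s.arr 9 w < 3
      · simp [hc]
      · simpa [hc] using this
    · have : w.val < i + 1 ↔ w.val < i := by omega
      simp only [this]
      split_ifs <;> simp_all
  · intro s' _ h w
    rw [h w]
    simp

end Cells

end RAM

namespace RAM

/-! ### Tracing the path -/

section Trace

variable {n : ℕ} {adj : Fin n → List (Fin n)}

/-- Follow the parents from vertex `4`; array `13` receives the vertex of each layer, and the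
vertices of the path get class `2` in array `14`. -/
def tracePath : Prog :=
  .seq (.assign 7 (.get 9 (.var 4))) (forLoop 5 (.lit 0) (.var 7)
    (.seq (.store 13 (.get 9 (.var 4)) (.var 4)) (.seq (.store 14 (.var 4) (.lit 2))
      (.assign 4 (.pred (.get 12 (.var 4)))))))

theorem runs_tracePath {s : State} {v : ℕ → Fin n} {k : ℕ} (hk : k < n) (hv : s.var 4 = v k)
    (hd : ∀ i ≤ k, s.arr 9 (v i) = i + 1) (hp : ∀ i < k, s.arr 12 (v (i + 1)) = v i + 1)
    (h0 : ∀ w : Fin n, s.arr 14 w = 0) :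
    Runs tracePath s (70 * size adj) fun s' => (∀ i ≤ k, s'.arr 13 (i + 1) = v i) ∧
      (∀ i ≤ k, s'.arr 14 (v i) = 2) ∧ ∀ w, (∀ i ≤ k, v i ≠ w) → s'.arr 14 w = 0 := by
  have e1 : Exec (.assign 7 (.get 9 (.var 4))) s 3 (s.setVar 7 (k + 1)) := by
    have := Exec.assign 7 (.get 9 (.var 4)) s
    simpa [Expr.eval, Expr.cost, hv, hd k le_rfl] using this
  have key := runs_forLoop_const (x := 5) (lo := .lit 0) (hi := .var 7) (a := 0) (b := k + 1)
    (p := .seq (.store 13 (.get 9 (.var 4)) (.var 4)) (.seq (.store 14 (.var 4) (.lit 2))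
      (.assign 4 (.pred (.get 12 (.var 4)))))) (s := s.setVar 7 (k + 1)) (c := 11)
    -- The rounds go from `v k` down to `v 0`. After the last one variable 4 is meaningless, since
    -- `v 0` has no parent; hence the guard.
    (I := fun i s' => (i ≤ k → s'.var 4 = v (k - i)) ∧
      (∀ j ≤ k, k < j + i → s'.arr 13 (j + 1) = v j) ∧
      (∀ j ≤ k, k < j + i → s'.arr 14 (v j) = 2) ∧
      ∀ w : Fin n, (∀ j ≤ k, v j ≠ w) → s'.arr 14 w = 0)
    rfl (Nat.zero_le _) rfl
    ⟨fun _ => by simpa using hv, fun j _ _ => by omega, fun j _ _ => by omega, fun w _ => h0 w⟩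
    (fun s' hf => by simpa [Expr.eval] using hf.var 7 rfl) (by
      rintro i s' - hi hf hvar ⟨h1, h2, h3, h4⟩
      refine (runs_flat (by rfl) s').mono (by simp [Prog.maxCost, Expr.cost]) ?_
      rintro _ - rfl
      have h9 : s'.arr 9 = s.arr 9 := hf.arr 9 rfl
      have h12 : s'.arr 12 = s.arr 12 := hf.arr 12 rfl
      have hv4 := h1 (by omega)
      have hrun : (Prog.seq (.store 13 (.get 9 (.var 4)) (.var 4)) (.seq (.store 14 (.var 4)
          (.lit 2)) (.assign 4 (.pred (.get 12 (.var 4)))))).run s' =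
          ((s'.setArr 13 (k - i + 1) (v (k - i))).setArr 14 (v (k - i)) 2).setVar 4
            (s.arr 12 (v (k - i)) - 1) := by
        simp [Prog.run, Expr.eval, hv4, h9, hd (k - i) (by omega), State.setArr_arr_of_ne, h12]
      rw [hrun]
      refine ⟨fun hi' => ?_, fun j hj hj' => ?_, fun j hj hj' => ?_, fun w hw => ?_⟩
      · have := hp (k - (i + 1)) (by omega)
        rw [show k - (i + 1) + 1 = k - i by omega] at this
        simp [this]
      · have := h2 j hj
        simp only [State.setVar_arr, State.setArr_arr_of_ne _ _ _ (show 13 ≠ 14 by omega),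
          State.setArr_arr_same]
        split_ifs with h
        · rw [show j = k - i by omega]
        · exact this (by omega)
      · have := h3 j hj
        simp only [State.setVar_arr, State.setArr_arr_same]
        split_ifs with h
        · rfl
        · rw [State.setArr_arr_of_ne _ _ _ (by omega)]
          refine this ?_
          by_contra hle
          rw [show j = k - i by omega] at h
          exact h rfl
      · have h5 : w.val ≠ (v (k - i)).val := fun h => hw (k - i) (by omega) (Fin.ext h.symm)
        simp only [State.setVar_arr, State.setArr_arr_same, if_neg h5]
        rw [State.setArr_arr_of_ne _ _ _ (by omega)]
        exact h4 w hw)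
  obtain ⟨t, s', h1, h2, -, h3, h4, h5⟩ := key
  refine ⟨_, s', e1.seq h1, ?_, fun i hi => h3 i hi (by omega), fun i hi => h4 i hi (by omega), h5⟩
  simp only [Expr.cost] at h2
  rw [size]
  omega

end Trace

/-! ### Sorting -/

section Sorting

variable {n : ℕ} {adj : Fin n → List (Fin n)}

/-- Find the first place of each layer in the order. -/
def findSlots : Prog :=
  forLoop 5 (.lit 0) (.var 0) (.store 15 (.succ (.get 9 (.get 10 (.var 5)))) (.succ (.var 5)))

/-- The last vertex of a layer writes last and leaves the number of vertices up to that layer, which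
is where the next layer starts. Cell 1 is never written, since `d` is positive, and keeps its
default 0. -/
theorem runs_findSlots {s : State} {d : Fin n → ℕ} {e : Fin n → Fin n} (hs : s.var 0 = n)
    (hd : ∀ w : Fin n, s.arr 9 w = d w) (hd0 : ∀ w, d w ≠ 0) (he : Function.Bijective e)
    (hq : ∀ j : Fin n, s.arr 10 j = e j) (hmono : ∀ i j, i ≤ j → d (e i) ≤ d (e j))
    (h0 : ∀ i, s.arr 15 i = 0) :
    Runs findSlots s (70 * size adj) fun s' => s'.arr 15 1 = 0 ∧
      ∀ w, s'.arr 15 (d w + 1) = (Finset.univ.filter fun x => d x ≤ d w).card := by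
  have key := runs_forLoop_const (x := 5) (lo := .lit 0) (hi := .var 0) (a := 0) (b := n)
    (p := .store 15 (.succ (.get 9 (.get 10 (.var 5)))) (.succ (.var 5))) (s := s) (c := 7)
    (I := fun i s' => s'.arr 15 1 = 0 ∧ ∀ j : Fin n, j < i → s'.arr 15 (d (e j) + 1) =
      (Finset.univ.filter fun j' : Fin n => j' < i ∧ d (e j') ≤ d (e j)).card)
    rfl (Nat.zero_le _) rfl ⟨h0 1, by simp⟩ (fun s' hf => (hf.var 0 rfl).trans hs) (by
      rintro i s' - hi hf hvar ⟨h1, h2⟩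
      refine (runs_flat (by rfl) s').mono (by simp [Prog.maxCost, Expr.cost]) ?_
      rintro _ - rfl
      have h9 : s'.arr 9 = s.arr 9 := hf.arr 9 rfl
      have h10 : s'.arr 10 = s.arr 10 := hf.arr 10 rfl
      have hqi := hq ⟨i, hi⟩
      simp only at hqi
      have hrun : (Prog.store 15 (.succ (.get 9 (.get 10 (.var 5)))) (.succ (.var 5))).run s' =
          s'.setArr 15 (d (e ⟨i, hi⟩) + 1) (i + 1) := by
        simp [Prog.run, Expr.eval, hvar, h9, h10, hqi, hd]
      rw [hrun]
      refine ⟨?_, fun j hj => ?_⟩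
      · have := hd0 (e ⟨i, hi⟩)
        rw [State.setVar_arr, State.setArr_arr_same, if_neg (by omega), h1]
      · rw [State.setVar_arr, State.setArr_arr_same]
        have hle : d (e j) ≤ d (e ⟨i, hi⟩) := hmono _ _ (Fin.mk_le_mk.2 (by omega))
        -- In the layer of the current vertex, monotonicity makes all of the first `i + 1` vertices
        -- count; a lower layer gains nothing.
        split_ifs with h
        · have : (Finset.univ.filter fun j' : Fin n => j'.val < i + 1 ∧ d (e j') ≤ d (e j)) =
              Finset.Iic ⟨i, hi⟩ := by
            ext j'
            simp only [Finset.mem_filter, Finset.mem_univ, true_and, Finset.mem_Iic, Fin.le_def]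
            refine ⟨fun h => by omega, fun h' => ⟨by omega, ?_⟩⟩
            have := hmono j' ⟨i, hi⟩ h'
            omega
          rw [this, Fin.card_Iic]
        · have hji : j.val ≠ i := by
            intro hji
            exact h (by rw [show j = ⟨i, hi⟩ from Fin.ext hji])
          rw [h2 j (by omega)]
          congr 1
          ext j'
          simp only [Finset.mem_filter, Finset.mem_univ, true_and, and_congr_left_iff]
          intro hj'
          refine ⟨fun h => by omega, fun h' => ?_⟩
          by_contra hcon
          rw [show j' = ⟨i, hi⟩ from Fin.ext (by simp only; omega)] at hj'
          omega)
  refine key.mono ?_ fun s' _ h => ⟨h.1, fun w => ?_⟩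
  · simp only [Expr.cost]
    rw [size]
    omega
  · obtain ⟨j, rfl⟩ := he.2 w
    rw [h.2 j j.isLt]
    refine Finset.card_bij (fun j' _ => e j') (by simp) (fun a _ b _ hab => he.1 hab) ?_
    intro x hx
    obtain ⟨j', rfl⟩ := he.2 x
    exact ⟨j', by simpa using hx, rfl⟩

/-- The vertices in the order of layer, class and number. -/
def Before (d c : Fin n → ℕ) (w u : Fin n) : Prop :=
  d w < d u ∨ d w = d u ∧ (c w < c u ∨ c w = c u ∧ w.val < u.val)

instance (d c : Fin n → ℕ) (w u : Fin n) : Decidable (Before d c w u) := by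
  unfold Before
  infer_instance

/-- The place of a vertex in the order. -/
def rank (d c : Fin n → ℕ) (u : Fin n) : ℕ := (Finset.univ.filter fun w => Before d c w u).card

theorem rank_lt_rank {d c : Fin n → ℕ} {w u : Fin n} (h : Before d c w u) :
    rank d c w < rank d c u := by
  refine Finset.card_lt_card ⟨fun x hx => ?_, fun hsub => ?_⟩
  · simp only [Finset.mem_filter, Finset.mem_univ, true_and] at hx ⊢
    unfold Before at *
    omega
  · have := hsub (show w ∈ _ by simpa using h)
    simp [Before] at this

theorem rank_injective (d c : Fin n → ℕ) : Function.Injective (rank d c) := by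
  intro u w h
  by_contra hne
  have hval : u.val ≠ w.val := fun h => hne (Fin.ext h)
  have : Before d c u w ∨ Before d c w u := by
    unfold Before
    omega
  rcases this with h' | h' <;> have := rank_lt_rank h' <;> omega

theorem rank_lt (d c : Fin n → ℕ) (u : Fin n) : rank d c u < n := by
  have : rank d c u < (Finset.univ : Finset (Fin n)).card :=
    Finset.card_lt_card ⟨Finset.subset_univ _, fun hsub => by
      have := hsub (Finset.mem_univ u)
      simp [Before] at this⟩
  simpa using this

theorem exists_rank_inverse (d c : Fin n → ℕ) :
    ∃ o : Fin n → Fin n, Function.Bijective o ∧ (∀ j, rank d c (o j) = j) ∧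
      ∀ u, o ⟨rank d c u, rank_lt d c u⟩ = u := by
  have hinj : Function.Injective fun u => (⟨rank d c u, rank_lt d c u⟩ : Fin n) :=
    fun u w h => rank_injective d c (Fin.mk.inj_iff.1 h)
  set E := Equiv.ofBijective _ (Finite.injective_iff_bijective.1 hinj)
  exact ⟨E.symm, E.symm.bijective, fun j => congrArg Fin.val (E.apply_symm_apply j),
    fun u => E.symm_apply_apply u⟩

/-- Write vertex `u` to its place if it has the class in variable `7`. -/
def placeStep : Prog :=
  .ite (.eq (.get 14 (.var 1)) (.var 7))
    (.seq (.store 16 (.get 15 (.get 9 (.var 1))) (.var 1))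
      (.store 15 (.get 9 (.var 1)) (.succ (.get 15 (.get 9 (.var 1)))))) .skip

/-- Sort the vertices by layer and class into array `16`. -/
def place : Prog := forLoop 7 (.lit 0) (.lit 3) (verts placeStep)

/-- The state of the sort after the classes below `C` and the vertices of class `C` below `i`. -/
structure PlaceInv (d c : Fin n → ℕ) (C i : ℕ) (s : State) : Prop where
  slot : ∀ u, s.arr 15 (d u) = (Finset.univ.filter fun w => d w < d u).card +
    (Finset.univ.filter fun w => d w = d u ∧ (c w < C ∨ c w = C ∧ w.val < i)).card
  out : ∀ u, (c u < C ∨ c u = C ∧ u.val < i) → s.arr 16 (rank d c u) = u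

/-- When its turn comes, a vertex finds in the slot of its layer the number of vertices that precede
it: those of lower layers and those of its layer already placed. That number is its rank. -/
theorem PlaceInv.step {d c : Fin n → ℕ} {C : ℕ} {i : Fin n} {s : State}
    (h : PlaceInv d c C i s) (hd : s.arr 9 i = d i) (hc : s.arr 14 i = c i) (h1 : s.var 1 = i)
    (h7 : s.var 7 = C) : PlaceInv d c C (i + 1) (placeStep.run s) := by
  by_cases hC : c i = C
  · have hslot : s.arr 15 (d i) = rank d c i := by
      rw [h.slot, rank, ← Finset.card_union_of_disjoint]
      · congr 1
        ext w
        simp only [Finset.mem_union, Finset.mem_filter, Finset.mem_univ, true_and, Before, hC]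
      · rw [Finset.disjoint_left]
        intro w hw hw'
        simp only [Finset.mem_filter, Finset.mem_univ, true_and] at hw hw'
        omega
    have hrun : placeStep.run s =
        (s.setArr 16 (rank d c i) i).setArr 15 (d i) (rank d c i + 1) := by
      simp [placeStep, Prog.run, Test.eval, Expr.eval, h1, h7, hc, hC, hd, hslot,
        State.setArr_arr_of_ne]
    rw [hrun]
    refine ⟨fun u => ?_, fun u hu => ?_⟩
    · rw [State.setArr_arr_same]
      split_ifs with hu
      · rw [← hslot, h.slot, hu, add_assoc]
        congr 1
        have : (Finset.univ.filter fun w : Fin n =>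
            d w = d i ∧ (c w < C ∨ c w = C ∧ w.val < i.val + 1)) =
            insert i (Finset.univ.filter fun w : Fin n =>
              d w = d i ∧ (c w < C ∨ c w = C ∧ w.val < i.val)) := by
          ext w
          simp only [Finset.mem_insert, Finset.mem_filter, Finset.mem_univ, true_and, Fin.ext_iff]
          constructor
          · intro h
            omega
          · rintro (hw | h)
            · rw [Fin.ext hw]
              exact ⟨rfl, .inr ⟨hC, by omega⟩⟩
            · omega
        rw [this, Finset.card_insert_of_notMem (by simp [hC])]
      · rw [State.setArr_arr_of_ne _ _ _ (by omega), h.slot]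
        congr 2
        ext w
        simp only [Finset.mem_filter, Finset.mem_univ, true_and, and_congr_right_iff]
        intro hw
        have : w.val ≠ i.val := by
          intro hwi
          rw [Fin.ext hwi] at hw
          exact hu hw.symm
        omega
    · rw [State.setArr_arr_of_ne _ _ _ (by omega), State.setArr_arr_same]
      split_ifs with hr
      · rw [rank_injective d c hr]
      · refine h.out u ?_
        have : u.val ≠ i.val := fun h => hr (by rw [Fin.ext h])
        omega
  · have hrun : placeStep.run s = s := by
      simp [placeStep, Prog.run, Test.eval, Expr.eval, h1, h7, hc, hC]
    rw [hrun]
    have hiff : ∀ w : Fin n, (c w < C ∨ c w = C ∧ w.val < i.val + 1) ↔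
        (c w < C ∨ c w = C ∧ w.val < i.val) := by
      intro w
      by_cases hw : w = i
      · subst hw
        simp [hC]
      · have : w.val ≠ i.val := fun h => hw (Fin.ext h)
        omega
    refine ⟨fun u => ?_, fun u hu => h.out u ((hiff u).1 hu)⟩
    simp only [h.slot, hiff]

theorem runs_place {s : State} {d c : Fin n → ℕ} (hs : s.var 0 = n)
    (hd : ∀ w : Fin n, s.arr 9 w = d w) (hc : ∀ w : Fin n, s.arr 14 w = c w) (hc3 : ∀ w, c w < 3)
    (hslot : ∀ u, s.arr 15 (d u) = (Finset.univ.filter fun w => d w < d u).card) :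
    Runs place s (120 * size adj) fun s' => ∀ u : Fin n, s'.arr 16 (rank d c u) = u := by
  have key := runs_forLoop_const (x := 7) (lo := .lit 0) (hi := .lit 3) (a := 0) (b := 3)
    (p := verts placeStep) (s := s) (c := 31 * size adj)
    (I := fun C s' => PlaceInv d c C 0 s') rfl (by omega) rfl
    ⟨fun u => by simp [hslot], fun u hu => by simp at hu⟩ (fun s' _ => rfl) (by
      rintro C s' - hC hf hvar hI
      refine (runs_verts_const (adj := adj) (c := 18) (I := fun i s' => PlaceInv d c C i s')
        ((hf.var 0 rfl).trans hs) rfl rfl ⟨hI.slot, hI.out⟩ ?_).mono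
        (Nat.mul_le_mul_right _ (by omega)) ?_
      · intro i s'' hi hf' hvar' hI'
        refine (runs_flat (by rfl) s'').mono
          (by simp [placeStep, Prog.maxCost, Test.cost, Expr.cost]) ?_
        rintro _ - rfl
        have hf9 : s''.arr 9 = s.arr 9 := (hf'.arr 9 rfl).trans (hf.arr 9 rfl)
        have hf14 : s''.arr 14 = s.arr 14 := (hf'.arr 14 rfl).trans (hf.arr 14 rfl)
        have h := PlaceInv.step (i := ⟨i, hi⟩) hI' (by rw [hf9, hd]) (by rw [hf14, hc]) hvar'
          ((hf'.var 7 rfl).trans hvar)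
        exact ⟨h.slot, h.out⟩
      · intro s'' _ h
        -- The end of one pass over the vertices is the beginning of the pass for the next class.
        have hiff : ∀ w : Fin n, (c w < C + 1 ∨ c w = C + 1 ∧ w.val < 0) ↔
            (c w < C ∨ c w = C ∧ w.val < n) := by
          intro w
          have := w.isLt
          omega
        exact ⟨fun u => by simp only [hiff]; exact h.slot u, fun u hu => h.out u ((hiff u).1 hu)⟩)
  refine key.mono ?_ fun s' _ h u => h.out u (.inl (hc3 u))
  simp only [Expr.cost]
  have : 1 ≤ size adj := by
    rw [size]
    omega
  omega

end Sorting

end RAM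

namespace RAM

/-! ### Placing the vertices on the line -/

section Line

variable {n : ℕ} {adj : Fin n → List (Fin n)}

/-- Mark the neighbours of vertex `10` with the current round. -/
def stampStep : Prog := .store 17 (.var 3) (.var 5)

/-- Update the candidate position of vertex `10`, given the neighbour `3` of vertex `9`. -/
def gapStep : Prog :=
  .ite (.eq (.var 3) (.var 10)) (.assign 7 (.succ (.var 8)))
    (.ite (.and (.eq (.get 17 (.var 3)) (.var 5)) (.not (.eq (.var 7) (.succ (.var 8)))))
      (.assign 7 (.succ (.succ (.var 8)))) .skip)

/-- Place one vertex. -/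
def lineStep : Prog :=
  .seq (.assign 9 (.get 16 (.pred (.var 5)))) (.seq (.assign 10 (.get 16 (.var 5)))
    (.seq (arcs 10 stampStep) (.seq (.assign 7 (.succ (.succ (.succ (.var 8)))))
      (.seq (arcs 9 gapStep) (.seq (.assign 8 (.var 7)) (.store 2 (.var 10) (.var 8)))))))

/-- The distance of two vertices if it is at most three. -/
def gap (adj : Fin n → List (Fin n)) (u w : Fin n) : ℕ :=
  if w ∈ adj u then 1 else if ∃ z ∈ adj u, z ∈ adj w then 2 else 3

theorem runs_stamp {s : State} {w : Fin n} (hs : Inp adj s) (hw : s.var 10 = w) :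
    Runs (arcs 10 stampStep) s (15 * (adj w).length + 9) fun s' => ∀ x : Fin n,
      s'.arr 17 x = if x ∈ adj w then s.var 5 else s.arr 17 x := by
  refine (runs_arcs (y := 10) (u := w) (c := 3) (I := fun l s' => ∀ x : Fin n,
    s'.arr 17 x = if x ∈ l then s.var 5 else s.arr 17 x) hs hw rfl ⟨rfl, rfl, rfl, rfl⟩
    (fun _ _ _ _ _ h => h) (by simp) ?_).mono le_rfl fun _ _ h => h
  intro l x s' _ hf hx hI
  refine (runs_flat (by rfl) s').mono (by simp [stampStep, Prog.maxCost, Expr.cost]) ?_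
  rintro _ - rfl y
  have h5 : s'.var 5 = s.var 5 := hf.var 5 rfl
  simp only [stampStep, Prog.run, Expr.eval, State.setArr_arr_same, hx, h5, hI y]
  by_cases hy : y = x
  · simp [hy]
  · have : y.val ≠ x.val := fun h => hy (Fin.ext h)
    simp [hy, this]

/-- Exactly the neighbours of `w` carry the current stamp, so a stamped neighbour of `u` is a common
one. The guard in `gapStep` keeps a distance of one from being overwritten by two. -/
theorem runs_gap {s : State} {u w : Fin n} {i : ℕ} (hs : Inp adj s) (hu : s.var 9 = u)
    (hw : s.var 10 = w) (h5 : s.var 5 = i) (h7 : s.var 7 = s.var 8 + 3)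
    (hst : ∀ x : Fin n, s.arr 17 x = i ↔ x ∈ adj w) :
    Runs (arcs 9 gapStep) s (35 * (adj u).length + 9) fun s' =>
      s'.var 7 = s.var 8 + gap adj u w := by
  refine (runs_arcs (y := 9) (u := u) (c := 23) (I := fun l s' =>
    s'.var 7 = s.var 8 + if w ∈ l then 1 else if ∃ z ∈ l, z ∈ adj w then 2 else 3) hs hu rfl
    ⟨rfl, rfl, rfl, rfl⟩ (fun l s' z v hz h => ?_) (by simpa using h7) ?_).mono le_rfl fun _ _ h => h
  · rcases hz with rfl | rfl <;> simpa using h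
  intro l x s' _ hf hx hI
  refine (runs_flat (by rfl) s').mono
    (by simp [gapStep, Prog.maxCost, Test.cost, Expr.cost]) ?_
  rintro _ - rfl
  have h5' : s'.var 5 = i := (hf.var 5 rfl).trans h5
  have h8' : s'.var 8 = s.var 8 := hf.var 8 rfl
  have h10' : s'.var 10 = w := (hf.var 10 rfl).trans hw
  have h17' : s'.arr 17 = s.arr 17 := hf.arr 17 rfl
  simp only [gapStep, Prog.run, Test.eval, Expr.eval, hx, h5', h8', h10', h17',
    Bool.and_eq_true, decide_eq_true_eq, Bool.not_eq_true', decide_eq_false_iff_not, hst, hI]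
  by_cases hxw : x = w
  · subst hxw
    simp
  have hxw' : x.val ≠ w.val := fun h => hxw (Fin.ext h)
  rw [if_neg hxw']
  by_cases hwl : w ∈ l
  · simp [hwl, hI]
  by_cases hxa : x ∈ adj w
  · have : ∃ z ∈ l ++ [x], z ∈ adj w := ⟨x, by simp, hxa⟩
    have hne : s.var 8 + (if ∃ z ∈ l, z ∈ adj w then 2 else 3) ≠ s.var 8 + 1 := by
      split_ifs <;> omega
    rw [if_neg hwl, if_pos ⟨hxa, hne⟩, if_neg (by simp [hwl, Ne.symm hxw]), if_pos this]
    simp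
  · have hiff : (∃ z ∈ l ++ [x], z ∈ adj w) ↔ ∃ z ∈ l, z ∈ adj w := by
      constructor
      · rintro ⟨z, hz, hzw⟩
        rcases List.mem_append.1 hz with hz | hz
        · exact ⟨z, hz, hzw⟩
        · exact absurd (List.mem_singleton.1 hz ▸ hzw) hxa
      · rintro ⟨z, hz, hzw⟩
        exact ⟨z, List.mem_append_left _ hz, hzw⟩
    have hwl' : w ∉ l ++ [x] := by simp [hwl, Ne.symm hxw]
    simp only [hxa, false_and, if_false, hI, hwl, hwl', hiff]

theorem runs_lineStep {s : State} {o : Fin n → Fin n} {i : ℕ} (hi : i + 1 < n) (hs : Inp adj s)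
    (h5 : s.var 5 = i + 1) (ho : ∀ j : Fin n, s.arr 16 j = o j)
    (hst : ∀ x : Fin n, s.arr 17 x < i + 1) :
    Runs lineStep s
      (15 * (adj (o ⟨i + 1, hi⟩)).length + 35 * (adj (o ⟨i, by omega⟩)).length + 35) fun s' =>
      s'.var 8 = s.var 8 + gap adj (o ⟨i, by omega⟩) (o ⟨i + 1, hi⟩) ∧
      (∀ x : Fin n, s'.arr 17 x < i + 2) ∧
      ∀ x, s'.arr 2 x = if x = (o ⟨i + 1, hi⟩).val then s'.var 8 else s.arr 2 x := by
  set u := o ⟨i, by omega⟩ with hu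
  set w := o ⟨i + 1, hi⟩ with hw
  have hou : s.arr 16 i = u := ho ⟨i, by omega⟩
  have how : s.arr 16 (i + 1) = w := ho ⟨i + 1, hi⟩
  set s2 := (s.setVar 9 u).setVar 10 w with hs2
  have e1 : Exec (.assign 9 (.get 16 (.pred (.var 5)))) s 4 (s.setVar 9 u) := by
    have := Exec.assign 9 (.get 16 (.pred (.var 5))) s
    simpa [Expr.eval, Expr.cost, h5, hou] using this
  have e2 : Exec (.assign 10 (.get 16 (.var 5))) (s.setVar 9 u) 3 s2 := by
    have := Exec.assign 10 (.get 16 (.var 5)) (s.setVar 9 u)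
    simpa [Expr.eval, Expr.cost, h5, how] using this
  have hinp2 : Inp adj s2 := (hs.frame e1.frame rfl rfl rfl).frame e2.frame rfl rfl rfl
  obtain ⟨t3, s3, e3, ht3, h3⟩ := runs_stamp (w := w) hinp2 (by simp [hs2])
  have hinp3 : Inp adj s3 := hinp2.frame e3.frame rfl rfl rfl
  have h8 : s3.var 8 = s.var 8 := (e3.frame.var 8 rfl).trans (by simp [hs2])
  have e4 : Exec (.assign 7 (.succ (.succ (.succ (.var 8))))) s3 5
      (s3.setVar 7 (s.var 8 + 3)) := by
    have := Exec.assign 7 (.succ (.succ (.succ (.var 8)))) s3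
    simpa [Expr.eval, Expr.cost, h8] using this
  have hinp4 := hinp3.frame e4.frame rfl rfl rfl
  have h25 : s2.var 5 = i + 1 := by simp [hs2, h5]
  have h217 : s2.arr 17 = s.arr 17 := rfl
  obtain ⟨t5, s5, e5, ht5, h55⟩ := runs_gap (s := s3.setVar 7 (s.var 8 + 3)) (u := u) (w := w)
    (i := i + 1) hinp4
    (by simpa using (e3.frame.var 9 rfl).trans (by simp [hs2]))
    (by simpa using (e3.frame.var 10 rfl).trans (by simp [hs2]))
    (by simpa using (e3.frame.var 5 rfl).trans h25)
    (by simp [h8])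
    -- Stamps of earlier rounds are smaller than `i + 1`, so the array never needs clearing.
    (fun x => by
      rw [State.setVar_arr, h3 x, h25, h217]
      have := hst x
      split_ifs with h
      · simp [h]
      · simp only [h, iff_false]
        omega)
  have h57 : s5.var 7 = s.var 8 + gap adj u w := by simpa [h8] using h55
  have e6 : Exec (.assign 8 (.var 7)) s5 2 (s5.setVar 8 (s.var 8 + gap adj u w)) := by
    have := Exec.assign 8 (.var 7) s5
    simpa [Expr.eval, Expr.cost, h57] using this
  have h510 : s5.var 10 = w := (e5.frame.var 10 rfl).trans
    (by simpa using (e3.frame.var 10 rfl).trans (by simp [hs2]))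
  have e7 : Exec (.store 2 (.var 10) (.var 8)) (s5.setVar 8 (s.var 8 + gap adj u w)) 3
      ((s5.setVar 8 (s.var 8 + gap adj u w)).setArr 2 w (s.var 8 + gap adj u w)) := by
    have := Exec.store 2 (.var 10) (.var 8) (s5.setVar 8 (s.var 8 + gap adj u w))
    simpa [Expr.eval, Expr.cost, h510] using this
  refine ⟨_, _, e1.seq (e2.seq (e3.seq (e4.seq (e5.seq (e6.seq e7))))), by omega, by simp,
    fun x => ?_, fun x => ?_⟩
  · have h517 : s5.arr 17 = s3.arr 17 := e5.frame.arr 17 rfl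
    rw [State.setArr_arr_of_ne _ _ _ (by omega), State.setVar_arr, h517, h3 x, h25, h217]
    have := hst x
    split_ifs <;> omega
  · have h52 : s5.arr 2 = s.arr 2 := (e5.frame.arr 2 rfl).trans (e3.frame.arr 2 rfl)
    simp [h52]

/-- Place the vertices on the line, in the order of array `16`. -/
def line : Prog := .seq (.assign 8 (.lit 0)) (forLoop 5 (.lit 1) (.var 0) lineStep)

/-- Each vertex is placed at most once and is a predecessor at most once, so the lists read have
total length linear in the input. Rounds count from 1: the first vertex keeps the default position
0, and the default stamp 0 is never current. -/
theorem runs_line {s : State} {o : Fin n → Fin n} (hn : 0 < n) (hs : Inp adj s)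
    (hbij : Function.Bijective o) (ho : ∀ j : Fin n, s.arr 16 j = o j)
    (hst : ∀ x : Fin n, s.arr 17 x = 0) (h0 : ∀ x : Fin n, s.arr 2 x = 0) :
    Runs line s (70 * size adj) fun s' => ∀ j, ∀ h : j + 1 < n,
      s'.arr 2 (o ⟨j + 1, h⟩) = s'.arr 2 (o ⟨j, by omega⟩) +
        gap adj (o ⟨j, by omega⟩) (o ⟨j + 1, h⟩) := by
  set deg : ℕ → ℕ := fun j => if h : j < n then (adj (o ⟨j, h⟩)).length else 0 with hdeg
  have hdegsum : ∑ j ∈ Finset.range n, deg j = ∑ u, (adj u).length := by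
    rw [Finset.sum_range, ← Function.Bijective.sum_comp hbij fun u => (adj u).length]
    simp [hdeg]
  have key := runs_forLoop (x := 5) (lo := .lit 1) (hi := .var 0) (a := 1) (b := n)
    (p := lineStep) (s := s.setVar 8 0)
    (I := fun i s' => (∀ x : Fin n, s'.arr 17 x < i) ∧
      (∀ h : i - 1 < n, s'.arr 2 (o ⟨i - 1, h⟩) = s'.var 8) ∧
      ∀ j, ∀ h : j + 1 < n, j + 1 < i → s'.arr 2 (o ⟨j + 1, h⟩) = s'.arr 2 (o ⟨j, by omega⟩) +
        gap adj (o ⟨j, by omega⟩) (o ⟨j + 1, h⟩)) (fun i => 15 * deg i + 35 * deg (i - 1) + 35)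
    rfl hn rfl ⟨by simp [hst], by simp [h0], fun j _ hj => by omega⟩
    (fun s' hf => (hf.var 0 rfl).trans (by simpa using hs.var)) (by
      rintro i s' hi0 hin hf hvar ⟨h1, h2, h3⟩
      obtain ⟨i, rfl⟩ : ∃ i', i = i' + 1 := ⟨i - 1, by omega⟩
      have hinp0 : Inp adj (s.setVar 8 0) := hs.frame (Exec.assign 8 (.lit 0) s).frame rfl rfl rfl
      have h16 : s'.arr 16 = s.arr 16 := hf.arr 16 rfl
      refine (runs_lineStep hin (hinp0.frame hf rfl rfl rfl) hvar
        (fun j => (congrFun h16 _).trans (ho j)) h1).mono ?_ ?_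
      · simp [hdeg, hin, show i < n by omega]
      · rintro s'' - ⟨h4, h5, h6⟩
        refine ⟨h5, fun h => ?_, fun j hj hji => ?_⟩
        · simp [h6]
        · have hold : ∀ j' (h : j' < n), j' < i + 1 →
              s''.arr 2 (o ⟨j', h⟩) = s'.arr 2 (o ⟨j', h⟩) := by
            intro j' h hj'
            rw [h6, if_neg]
            intro heq
            have := Fin.mk.inj_iff.1 (hbij.1 (Fin.ext heq))
            omega
          rw [State.setVar_arr, hold j (by omega) (by omega)]
          by_cases hji' : j = i
          · subst hji'
            rw [h6, if_pos rfl, h4, ← h2 (by omega)]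
            rfl
          · rw [hold (j + 1) hj (by omega)]
            exact h3 j hj (by omega))
  obtain ⟨t, s', e, ht, -, -, h⟩ := key
  refine ⟨_, s', (Exec.assign 8 (.lit 0) s).seq e, ?_, fun j hj => h j hj hj⟩
  have hsum1 : ∑ i ∈ Finset.Ico 1 n, deg i ≤ ∑ u, (adj u).length := by
    rw [← hdegsum, Finset.range_eq_Ico]
    exact Finset.sum_le_sum_of_subset (Finset.Ico_subset_Ico_left (by omega))
  have hsum2 : ∑ i ∈ Finset.Ico 1 n, deg (i - 1) ≤ ∑ u, (adj u).length := by
    rw [← hdegsum, Finset.sum_Ico_eq_sum_range]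
    simp only [Nat.add_sub_cancel_left]
    exact Finset.sum_le_sum_of_subset (Finset.range_subset_range.2 (by omega))
  rw [Finset.sum_add_distrib, Finset.sum_add_distrib, ← Finset.mul_sum, ← Finset.mul_sum,
    Finset.sum_const, Nat.card_Ico, smul_eq_mul] at ht
  simp only [Expr.cost] at ht ⊢
  rw [size]
  omega

end Line

end RAM

namespace RAM

open SimpleGraph

/-! ### The algorithm -/

section Algorithm

variable {n : ℕ} {G : SimpleGraph (Fin n)} {adj : Fin n → List (Fin n)}

/-- Find the start vertex of the path. -/
def findStart : Prog :=
  .seq (bfs 3 4) (.seq (.assign 4 (.get 4 (.pred (.var 0)))) (.seq (countDown 3 5)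
    (.seq (argmin 3 18 5) (.seq markDown (.seq markBad (.seq countOut (argmin 3 7 8)))))))

theorem exec_assign_last {q : ℕ} {s : State} {e : Fin n → Fin n} (hn : 0 < n) (hs : s.var 0 = n)
    (hq : ∀ j : Fin n, s.arr q j = e j) :
    Exec (.assign 4 (.get q (.pred (.var 0)))) s 4 (s.setVar 4 (e ⟨n - 1, by omega⟩)) := by
  have h1 := Exec.assign 4 (.get q (.pred (.var 0))) s
  have h2 := hq ⟨n - 1, by omega⟩
  simp only at h2
  simpa [Expr.eval, Expr.cost, hs, h2] using h1

theorem le_dist_last {r : Fin n} {e : Fin n → Fin n} (hn : 0 < n) (he : Function.Bijective e)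
    (hmono : ∀ i j, i ≤ j → G.dist r (e i) ≤ G.dist r (e j)) (u : Fin n) :
    G.dist r u ≤ G.dist r (e ⟨n - 1, by omega⟩) := by
  obtain ⟨j, rfl⟩ := he.2 u
  exact hmono _ _ (Fin.mk_le_mk.2 (by omega))

theorem runs_findStart {s : State} (hG : G.Connected) (hadj : G.IsAdjLists adj) (hn : 1 < n)
    (hs : Inp adj s) (h4 : s.var 4 = 0) (h0 : ∀ a, 2 ≤ a → ∀ i, s.arr a i = 0) :
    Runs findStart s (500 * size adj) fun s' => ∃ m r : Fin n,
      G.IsStart ⟨0, by omega⟩ m r ∧ s'.var 4 = r ∧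
        ∀ w : Fin n, s'.arr 3 w = G.dist ⟨0, by omega⟩ w + 1 := by
  set b : Fin n := ⟨0, by omega⟩ with hb
  obtain ⟨t1, s1, e1, ht1, hD1, e, he, hq1, hmono⟩ := runs_bfs (r := b) hG hadj hs
    (by omega : 2 ≤ 3) (by omega : 2 ≤ 4) (by omega) (by simp [h4, hb]) fun w => h0 3 (by omega) w
  have i1 : Inp adj s1 := hs.frame e1.frame rfl rfl rfl
  have e2 := exec_assign_last (by omega) i1.var hq1
  set l := e ⟨n - 1, by omega⟩ with hl
  have hfar := le_dist_last (by omega) he hmono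
  rw [← hl] at hfar
  have i2 : Inp adj (s1.setVar 4 l) := i1.frame e2.frame rfl rfl rfl
  obtain ⟨t3, s3, e3, ht3, h3⟩ := runs_countDown (D := 3) (a := 5) i2 (by omega) (by omega)
  have i3 : Inp adj s3 := i2.frame e3.frame rfl rfl rfl
  have hD3 : ∀ w : Fin n, s3.arr 3 w = G.dist b w + 1 := fun w => by
    rw [e3.frame.arr 3 rfl]
    exact hD1 w
  have hz3 : ∀ a, 6 ≤ a → ∀ i, s3.arr a i = 0 := by
    intro a ha i
    have h1 : (countDown 3 5).wa a = false := update_wa (by omega)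
    have h2 : (bfs 3 4).wa a = false := by
      simp [bfs, Prog.wa, forLoop, arcs, bfsStep]
      omega
    rw [e3.frame.arr a h1, State.setVar_arr, e1.frame.arr a h2, h0 a (by omega)]
  have hc3 : ∀ w : Fin n, s3.arr 5 w = (G.downSet b w).card := by
    intro w
    have h5 : s1.arr 5 w = 0 := by rw [e1.frame.arr 5 rfl, h0 5 (by omega)]
    rw [h3 w]
    simp only [State.setVar_arr, h5, zero_add, hD1]
    refine countP_eq_card hadj w (fun x => G.dist b x + 1 < G.dist b w + 1) fun x => ?_
    rw [mem_downSet, Nat.add_lt_add_iff_right]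
  -- Array 18 is never written; its zeros make the second condition void, so the whole last layer
  -- competes.
  obtain ⟨t4, s4, e4, ht4, m, hm4, hmD, -, hmin⟩ := runs_argmin (adj := adj) (A := 3) (B := 18)
    (C := 5) (s := s3) (b₀ := l) i3.var ((e3.frame.var 4 rfl).trans (by simp))
  have i4 : Inp adj s4 := i3.frame e4.frame rfl rfl rfl
  simp only [hD3, hc3, hz3 18 (by omega), Nat.add_right_cancel_iff, forall_const] at hmD hmin
  have ha4 : s4.arr = s3.arr := by
    funext a
    exact e4.frame.arr a rfl
  obtain ⟨t5, s5, e5, ht5, h5⟩ := runs_markDown i4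
  have i5 : Inp adj s5 := i4.frame e5.frame rfl rfl rfl
  have hD5 : s5.arr 3 = s3.arr 3 := by rw [e5.frame.arr 3 rfl, ha4]
  have hmark : ∀ w : Fin n, s5.arr 6 w = 0 ↔ w ∉ G.downSet b m := by
    intro w
    rw [h5 w, ha4, hz3 6 (by omega), mem_downSet]
    rw [ite_eq_right_iff]
    simp only [hD3, hm4, (hadj w).2]
    simp only [one_ne_zero, imp_false, not_iff_not]
    constructor
    · rintro ⟨x, hx, hxm, hlt⟩
      obtain rfl := Fin.ext hxm
      exact ⟨hx.symm, by omega⟩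
    · rintro ⟨hx, hlt⟩
      exact ⟨m, hx.symm, rfl, by omega⟩
  obtain ⟨t6, s6, e6, ht6, h6⟩ := runs_markBad i5
  have i6 : Inp adj s6 := i5.frame e6.frame rfl rfl rfl
  have hD6 : s6.arr 3 = s3.arr 3 := by rw [e6.frame.arr 3 rfl, hD5]
  -- Array 7 gives only half of the end class; membership in the last layer is tested through array
  -- 3 in `countOut` and in the second `argmin`.
  have hbad : ∀ w : Fin n, s6.arr 7 w = 0 ↔ ∀ x ∈ G.downSet b w, x ∈ G.downSet b m := by
    intro w
    rw [h6 w, e5.frame.arr 7 rfl, ha4, hz3 7 (by omega), hD5]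
    rw [ite_eq_right_iff]
    simp only [hD3, hmark, (hadj w).2]
    simp only [one_ne_zero, imp_false, mem_downSet]
    push Not
    constructor
    · intro h x hx
      exact h x hx.1 (by omega)
    · intro h x hx hlt
      exact h x ⟨hx, by omega⟩
  have hm6 : s6.var 4 = m := (e6.frame.var 4 rfl).trans ((e5.frame.var 4 rfl).trans hm4)
  obtain ⟨t7, s7, e7, ht7, h7⟩ := runs_countOut i6
  have i7 : Inp adj s7 := i6.frame e7.frame rfl rfl rfl
  have hD7 : s7.arr 3 = s3.arr 3 := by rw [e7.frame.arr 3 rfl, hD6]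
  have hb7 : s7.arr 7 = s6.arr 7 := e7.frame.arr 7 rfl
  have hm7 : s7.var 4 = m := (e7.frame.var 4 rfl).trans hm6
  have hout : ∀ w : Fin n, s7.arr 8 w = (G.outSet b m w).card := by
    intro w
    rw [h7 w, e6.frame.arr 8 rfl, e5.frame.arr 8 rfl, ha4, hz3 8 (by omega), zero_add, hD6, hm6]
    simp only [hD3]
    refine countP_eq_card hadj w
      (fun x => G.dist b x + 1 = G.dist b m + 1 ∧ s6.arr 7 x ≠ 0) fun x => ?_
    rw [mem_outSet, Nat.add_right_cancel_iff, Ne, hbad, endClass, Set.mem_ofPred_eq]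
    tauto
  obtain ⟨t8, s8, e8, ht8, r, hr8, hrD, hrB, hrmin⟩ := runs_argmin (adj := adj) (A := 3) (B := 7)
    (C := 8) (s := s7) (b₀ := m) i7.var hm7
  have hbm : s7.arr 7 m = 0 := by
    rw [hb7, hbad]
    exact fun x hx => hx
  rw [hbm, hb7, hbad] at hrB
  simp only [hbm, hb7, hD7, hD3, hbad, hout, Nat.add_right_cancel_iff] at hrD hrmin
  refine ⟨_, s8, e1.seq (e2.seq (e3.seq (e4.seq (e5.seq (e6.seq (e7.seq e8)))))), ?_, m, r,
    ⟨fun u => hmD ▸ hfar u, ?_, fun u hu => hmin u (hu.trans hmD), ⟨hrD, hrB⟩,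
      fun u hu => hrmin u hu.1 hu.2⟩, hr8, fun w => ?_⟩
  · have : 1 ≤ size adj := by
      rw [size]
      omega
    omega
  · have h1 := hfar ⟨1, hn⟩
    have h2 := hG.pos_dist_of_ne (u := b) (v := ⟨1, hn⟩) (by simp [hb])
    omega
  · rw [e8.frame.arr 3 rfl, hD7, hD3]

/-- Find the path and the classes. -/
def findPath : Prog :=
  .seq (bfs 9 10) (.seq initKey (.seq (countDown 9 11) (.seq findParent
    (.seq (.assign 4 (.get 10 (.pred (.var 0)))) (.seq (argmin 9 18 11)
      (.seq tracePath markNear))))))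

theorem runs_findPath {s : State} {b r : Fin n} (hG : G.Connected) (hadj : G.IsAdjLists adj)
    (hs : Inp adj s) (h4 : s.var 4 = r) (h3 : ∀ w : Fin n, s.arr 3 w = G.dist b w + 1)
    (h0 : ∀ a, 9 ≤ a → ∀ i, s.arr a i = 0) :
    Runs findPath s (500 * size adj) fun s' => ∃ (k : ℕ) (v : ℕ → Fin n),
      IsStart.IsKeyPath G b r k v ∧ IsSpine.IsClass G v (fun u => s'.arr 14 u) ∧
        (∀ w : Fin n, s'.arr 9 w = G.dist (v 0) w + 1) ∧
        ∃ e : Fin n → Fin n, Function.Bijective e ∧ (∀ j : Fin n, s'.arr 10 j = e j) ∧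
          ∀ i j, i ≤ j → G.dist (v 0) (e i) ≤ G.dist (v 0) (e j) := by
  have hn : 0 < n := r.pos
  obtain ⟨t1, s1, e1, ht1, hD1, e, he, hq1, hmono⟩ := runs_bfs (r := r) hG hadj hs
    (by omega : 2 ≤ 9) (by omega : 2 ≤ 10) (by omega) h4 fun w => h0 9 (by omega) w
  have i1 : Inp adj s1 := hs.frame e1.frame rfl rfl rfl
  have hz1 : ∀ a, 11 ≤ a → ∀ i, s1.arr a i = 0 := by
    intro a ha i
    have h2 : (bfs 9 10).wa a = false := by
      simp [bfs, Prog.wa, forLoop, arcs, bfsStep]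
      omega
    rw [e1.frame.arr a h2, h0 a (by omega)]
  obtain ⟨t2, s2, e2, ht2, hk2⟩ := runs_initKey (adj := adj) i1.var
    fun w => hz1 11 (by omega) w
  have i2 : Inp adj s2 := i1.frame e2.frame rfl rfl rfl
  obtain ⟨t3, s3, e3, ht3, hk3⟩ := runs_countDown (D := 9) (a := 11) i2 (by omega) (by omega)
  have i3 : Inp adj s3 := i2.frame e3.frame rfl rfl rfl
  have hD2 : s2.arr 9 = s1.arr 9 := e2.frame.arr 9 rfl
  have hD3 : s3.arr 9 = s1.arr 9 := (e3.frame.arr 9 rfl).trans hD2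
  have hz3 : ∀ a, 12 ≤ a → ∀ i, s3.arr a i = 0 := by
    intro a ha i
    have h1 : (countDown 9 11).wa a = false := update_wa (by omega)
    have h2 : initKey.wa a = false := verts_wa.2 (by
      simp [Prog.wa]
      omega)
    rw [e3.frame.arr a h1, e2.frame.arr a h2, hz1 a (by omega)]
  have hkey : ∀ w : Fin n, s3.arr 11 w = IsStart.key G b r w := by
    intro w
    rw [hk3 w, hk2 w, e1.frame.arr 3 rfl, hD2, add_comm, IsStart.key]
    simp only [hD1, h3]
    congr 1
    · refine countP_eq_card hadj w (fun x => G.dist r x + 1 < G.dist r w + 1) fun x => ?_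
      rw [mem_downSet, Nat.add_lt_add_iff_right]
    · have : G.dist r w + 1 < 3 ↔ G.dist r w ≤ 1 := by omega
      simp only [this]
  obtain ⟨t4, s4, e4, ht4, hp4⟩ := runs_findParent i3 fun w => hz3 12 (by omega) w
  have i4 : Inp adj s4 := i3.frame e4.frame rfl rfl rfl
  have hz4 : ∀ a, 13 ≤ a → ∀ i, s4.arr a i = 0 := by
    intro a ha i
    have h1 : findParent.wa a = false := update_wa (by omega)
    rw [e4.frame.arr a h1, hz3 a (by omega)]
  have hD4 : s4.arr 9 = s1.arr 9 := (e4.frame.arr 9 rfl).trans hD3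
  have hkey4 : s4.arr 11 = s3.arr 11 := e4.frame.arr 11 rfl
  -- The condition sits behind the existential so that a parent can be chosen for every vertex;
  -- where it fails, the value is irrelevant.
  have hpar : ∀ w : Fin n, ∃ p : Fin n, G.dist r w ≠ 0 → p ∈ G.downSet r w ∧
      s4.arr 12 w = p + 1 ∧
      ∀ x ∈ G.downSet r w, IsStart.key G b r p ≤ IsStart.key G b r x := by
    intro w
    have := hp4 w
    simp only [hD3, hD1, hkey, (hadj w).2, Nat.add_lt_add_iff_right] at this
    rcases this with ⟨-, hno⟩ | ⟨p, hp, hp12, hlt, hmin⟩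
    · refine ⟨w, fun hw => ?_⟩
      obtain ⟨j, hj⟩ := Nat.exists_eq_succ_of_ne_zero hw
      obtain ⟨x, hx, hxj⟩ := hG.exists_adj_dist hj
      exact absurd (by omega) (hno x hx)
    · refine ⟨p, fun _ => ⟨mem_downSet.2 ⟨hp, hlt⟩, hp12, fun x hx => ?_⟩⟩
      rw [mem_downSet] at hx
      exact hmin x hx.1 hx.2
  choose par hpar using hpar
  have hq4 : ∀ j : Fin n, s4.arr 10 j = e j := fun j => by
    rw [e4.frame.arr 10 rfl, e3.frame.arr 10 rfl, e2.frame.arr 10 rfl, hq1]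
  have e5 := exec_assign_last hn i4.var hq4
  set l := e ⟨n - 1, by omega⟩ with hl
  have hfar := le_dist_last hn he hmono
  rw [← hl] at hfar
  have i5 : Inp adj (s4.setVar 4 l) := i4.frame e5.frame rfl rfl rfl
  obtain ⟨t6, s6, e6, ht6, y, hy6, hyD, -, hymin⟩ := runs_argmin (adj := adj) (A := 9) (B := 18)
    (C := 11) (s := s4.setVar 4 l) (b₀ := l) i5.var (by simp)
  have i6 : Inp adj s6 := i5.frame e6.frame rfl rfl rfl
  simp only [State.setVar_arr, hD4, hD1, hkey4, hkey, hz4 18 (by omega),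
    Nat.add_right_cancel_iff, forall_const] at hyD hymin
  have ha6 : s6.arr = s4.arr := by
    funext a
    exact e6.frame.arr a rfl
  set k := G.dist r y with hk
  -- Parents lead from `y` down to `r`, while the path is numbered from `r`: `v i` is the ancestor
  -- of `y` after `k - i` steps.
  set v : ℕ → Fin n := fun i => par^[k - i] y with hv
  have hvk : v k = y := by simp [hv]
  have hvs : ∀ i < k, v i = par (v (i + 1)) := by
    intro i hi
    simp only [hv]
    rw [show k - i = k - (i + 1) + 1 by omega, Function.iterate_succ_apply']
  have hvd : ∀ i ≤ k, G.dist r (v i) = i := by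
    intro i hi
    induction hi using Nat.decreasingInduction with
    | self => rw [hvk]
    | of_succ j hj ih =>
      have := hG.dist_of_mem_downSet (hpar (v (j + 1)) (by omega)).1
      rw [← hvs j hj] at this
      omega
  have hpath : IsStart.IsKeyPath G b r k v := by
    refine ⟨fun u => by rw [hyD]; exact hfar u, by rw [hvk], fun u hu => ?_, fun i hi => ?_,
      fun i hi => ?_⟩
    · rw [hvk]
      exact hymin u (hu.trans hyD)
    · rw [hvs i hi]
      exact (hpar (v (i + 1)) (by rw [hvd _ hi]; omega)).1
    · rw [hvs i hi]
      exact (hpar (v (i + 1)) (by rw [hvd _ hi]; omega)).2.2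
  have hv0 : v 0 = r := by
    have := hvd 0 (Nat.zero_le k)
    rw [hG.dist_eq_zero_iff] at this
    exact this.symm
  have hinj : ∀ i ≤ k, ∀ j ≤ k, v i = v j → i = j := fun i hi j hj hij => by
    rw [← hvd i hi, hij, hvd j hj]
  have hkn : k < n := by
    have h1 : (Finset.range (k + 1)).card ≤ (Finset.univ : Finset (Fin n)).card :=
      Finset.card_le_card_of_injOn v (fun _ _ => Finset.mem_coe.2 (Finset.mem_univ _))
        fun i hi j hj => hinj i (by simpa [Nat.lt_succ_iff] using hi) j
          (by simpa [Nat.lt_succ_iff] using hj)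
    rw [Finset.card_range, Finset.card_univ, Fintype.card_fin] at h1
    omega
  obtain ⟨t7, s7, e7, ht7, h71, h72, h73⟩ := runs_tracePath (adj := adj) (s := s6) (v := v)
    (k := k) hkn (by rw [hvk, hy6]) (fun i hi => by rw [ha6, hD4, hD1, hvd i hi])
    (fun i hi => by
      rw [ha6, hvs i hi]
      exact (hpar (v (i + 1)) (by rw [hvd _ hi]; omega)).2.1)
    (fun w => by rw [ha6, hz4 14 (by omega)])
  have i7 : Inp adj s7 := i6.frame e7.frame rfl rfl rfl
  obtain ⟨t8, s8, e8, ht8, h8⟩ := runs_markNear i7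
  have hD7 : s7.arr 9 = s1.arr 9 := by rw [e7.frame.arr 9 rfl, ha6, hD4]
  refine ⟨_, s8, e1.seq (e2.seq (e3.seq (e4.seq (e5.seq (e6.seq (e7.seq e8)))))), ?_, k, v, hpath,
    fun u => ?_, fun w => ?_, e, he, fun j => ?_, ?_⟩
  · have : 1 ≤ size adj := by
      rw [size]
      omega
    omega
  · classical
    rw [hv0]
    have hul := hpath.far u
    have hcls : s8.arr 14 u = if G.Adj (v (G.dist r u)) u then 1 else s7.arr 14 u := by
      rw [h8 u, hD7, hD1, h71 _ hul]
      congr 1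
      rw [eq_iff_iff]
      constructor
      · rintro ⟨x, hx, hxv⟩
        rw [← Fin.ext hxv]
        exact (((hadj u).2 x).1 hx).symm
      · exact fun h => ⟨_, ((hadj u).2 _).2 h.symm, rfl⟩
    simp only [hcls]
    by_cases huv : u = v (G.dist r u)
    · left
      refine ⟨?_, huv⟩
      -- No vertex is its own neighbour, so `markNear` leaves the class 2 of the path vertices
      -- alone.
      rw [← huv, if_neg (G.irrefl)]
      rw [huv]
      exact h72 _ hul
    · right
      by_cases hadj' : G.Adj (v (G.dist r u)) u
      · left
        exact ⟨if_pos hadj', huv, hadj'⟩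
      · right
        refine ⟨?_, huv, hadj'⟩
        rw [if_neg hadj']
        refine h73 u fun i hi hvi => huv ?_
        rw [← hvi, hvd i hi]
  · rw [hv0, e8.frame.arr 9 rfl, hD7, hD1]
  · rw [e8.frame.arr 10 rfl, e7.frame.arr 10 rfl, ha6, hq4]
  · rw [hv0]
    exact hmono

/-- Place the vertices by layer and class. -/
def arrange : Prog := .seq findSlots (.seq place line)

theorem runs_arrange {s : State} {k : ℕ} {v : ℕ → Fin n} {c : Fin n → ℕ} {e : Fin n → Fin n}
    (hG : G.Connected) (hadj : G.IsAdjLists adj) (hs : Inp adj s) (hv : G.IsSpine k v)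
    (hc : IsSpine.IsClass G v c) (h14 : ∀ w : Fin n, s.arr 14 w = c w)
    (h9 : ∀ w : Fin n, s.arr 9 w = G.dist (v 0) w + 1) (he : Function.Bijective e)
    (h10 : ∀ j : Fin n, s.arr 10 j = e j)
    (hmono : ∀ i j, i ≤ j → G.dist (v 0) (e i) ≤ G.dist (v 0) (e j))
    (h2 : ∀ i, s.arr 2 i = 0) (h0 : ∀ a, 15 ≤ a → ∀ i, s.arr a i = 0) :
    Runs arrange s (500 * size adj) fun s' => ∃ rk : Fin n → ℕ,
      IsSpine.IsRanking G v c rk ∧ IsSpine.IsPlacement G rk (fun u => s'.arr 2 u) := by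
  have hn : 0 < n := (v 0).pos
  set d : Fin n → ℕ := fun w => G.dist (v 0) w + 1 with hd
  obtain ⟨t1, s1, e1, ht1, h11, h12⟩ := runs_findSlots (adj := adj) (d := d) hs.var h9
    (fun w => by simp [hd]) he h10 (fun i j hij => by simpa [hd] using hmono i j hij)
    (h0 15 le_rfl)
  have i1 : Inp adj s1 := hs.frame e1.frame rfl rfl rfl
  obtain ⟨t2, s2, e2, ht2, hrk⟩ := runs_place (adj := adj) (s := s1) (d := d) (c := c) i1.var
    (fun w => by rw [e1.frame.arr 9 rfl]; exact h9 w)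
    (fun w => by rw [e1.frame.arr 14 rfl]; exact h14 w)
    (fun w => by rcases hc w with h | h | h <;> omega) (fun u => by
      -- The start of a layer was written by the layer below it, which is non-empty because `u` has
      -- a lower neighbour; layer zero relies on the default 0.
      rcases Nat.eq_zero_or_eq_succ_pred (G.dist (v 0) u) with hu | hu
      · rw [show d u = 1 by simp [hd, hu], h11]
        symm
        rw [Finset.card_eq_zero, Finset.filter_eq_empty_iff]
        intro w _
        simp [hd]
      · obtain ⟨x, -, hx⟩ := hG.exists_adj_dist hu
        have hxu : d u = d x + 1 := by
          simp only [hd]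
          omega
        rw [hxu, h12 x]
        congr 1
        ext w
        simp only [Finset.mem_filter, Finset.mem_univ, true_and]
        omega)
  have i2 : Inp adj s2 := i1.frame e2.frame rfl rfl rfl
  obtain ⟨o, ho, hro, hor⟩ := exists_rank_inverse d c
  have hz : ∀ a, a = 2 ∨ a = 17 → ∀ i, s2.arr a i = 0 := by
    rintro a ha i
    have h1 : s2.arr a = s.arr a := by
      rcases ha with rfl | rfl <;> exact (e2.frame.arr _ rfl).trans (e1.frame.arr _ rfl)
    rw [h1]
    rcases ha with rfl | rfl
    exacts [h2 i, h0 17 (by omega) i]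
  obtain ⟨t3, s3, e3, ht3, h3⟩ := runs_line (o := o) hn i2 ho
    (fun j => by
      have := hrk (o j)
      rwa [hro] at this)
    (fun x => hz 17 (.inr rfl) x) (fun x => hz 2 (.inl rfl) x)
  have hranking : IsSpine.IsRanking G v c (rank d c) := by
    refine ⟨rank_injective d c, fun u j hj => ?_, fun x y hxy => ?_, fun x y hxy hcxy => ?_⟩
    · have := rank_lt d c u
      exact ⟨o ⟨j, by omega⟩, hro _⟩
    · refine rank_lt_rank (.inl ?_)
      simp only [hd]
      omega
    · exact rank_lt_rank (.inr ⟨by simp only [hd, hxy], .inl hcxy⟩)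
  refine ⟨_, s3, e1.seq (e2.seq e3), by omega, rank d c, hranking, fun x y hxy => ?_⟩
  have hlt := rank_lt d c y
  have hy : o ⟨rank d c x + 1, by omega⟩ = y := by
    refine (congrArg o ?_).trans (hor y)
    exact Fin.ext hxy.symm
  have := h3 (rank d c x) (by omega)
  rw [hy, hor x] at this
  have hne : x ≠ y := by
    rintro rfl
    omega
  classical
  simp only [this]
  -- Here the path property enters the correctness of the program: distances of consecutive vertices
  -- are at most three, so the default 3 is right.
  rw [hG.dist_eq_ite hne (hv.dist_le_three hG hc hranking hxy), gap]
  simp only [(hadj _).2]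

/-- The algorithm. -/
def lineEmbedding : Prog := .seq findStart (.seq findPath arrange)

theorem size_le (hadj : G.IsAdjLists adj) (hn : 1 < n) :
    size adj ≤ 2 * (n + G.edgeSet.ncard) := by
  classical
  have h1 : ∀ u, (adj u).length = G.degree u := by
    intro u
    rw [← List.toFinset_card_of_nodup (hadj u).1, ← G.card_neighborFinset_eq_degree]
    congr 1
    ext x
    simp [(hadj u).2 x]
  have h2 := G.sum_degrees_eq_twice_card_edges
  rw [size, Finset.sum_congr rfl fun u _ => h1 u, h2, ← G.coe_edgeFinset, Set.ncard_coe_finset]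
  omega

end Algorithm

end RAM

theorem theorem7p2 :
    ∃ (P : RAM.Prog) (C : ℕ), ∀ (n : ℕ), 1 < n →
      ∀ G : SimpleGraph (Fin n), G.Connected → G.IsATFree →
      ∀ adj : Fin n → List (Fin n), G.IsAdjLists adj →
        ∃ (t : ℕ) (s : RAM.State), RAM.Exec P (RAM.graphInput adj) t s ∧
          t ≤ C * (n + G.edgeSet.ncard) ∧
          G.IsLineEmbedding (fun u => (RAM.positions s u : ℝ)) (8 * G.lineDistortion) ∧
          ∃ (a b : Fin n) (π : G.Walk a b), G.IsLayeredDominatingPath π ∧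
            G.IsLayeredArrangement π (RAM.positions s) := by
  -- Three phases take at most 500 times the size each, and the size n + 2|E| + 1 is at most 2(n +
  -- |E|).
  refine ⟨RAM.lineEmbedding, 3000, fun n hn G hG hAT adj hadj => ?_⟩
  have hs := RAM.inp_graphInput adj
  have hz : ∀ a, 2 ≤ a → ∀ i, (RAM.graphInput adj).arr a i = 0 := by
    intro a ha i
    simp [RAM.graphInput, show a ≠ 1 by omega, show a ≠ 0 by omega]
  obtain ⟨t1, s1, e1, ht1, m, r, hstart, h14, h13⟩ := RAM.runs_findStart hG hadj hn hs rfl hz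
  have i1 := hs.frame e1.frame rfl rfl rfl
  have hz1 : ∀ a, 9 ≤ a ∨ a = 2 → ∀ i, s1.arr a i = 0 := by
    intro a ha i
    have : RAM.findStart.wa a = false := by
      simp [RAM.findStart, RAM.bfs, RAM.countDown, RAM.argmin, RAM.markDown, RAM.markBad,
        RAM.countOut, RAM.Prog.wa, RAM.cells, RAM.verts, RAM.arcs, RAM.forLoop, RAM.bfsStep,
        RAM.update]
      omega
    rw [e1.frame.arr a this, hz a (by omega)]
  obtain ⟨t2, s2, e2, ht2, k, v, hpath, hcls, h29, e, he, h210, hmono⟩ :=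
    RAM.runs_findPath hG hadj i1 h14 h13 fun a ha => hz1 a (.inl ha)
  have i2 := i1.frame e2.frame rfl rfl rfl
  have hz2 : ∀ a, 15 ≤ a ∨ a = 2 → ∀ i, s2.arr a i = 0 := by
    intro a ha i
    have : RAM.findPath.wa a = false := by
      simp [RAM.findPath, RAM.bfs, RAM.countDown, RAM.argmin, RAM.initKey, RAM.findParent,
        RAM.tracePath, RAM.markNear, RAM.Prog.wa, RAM.cells, RAM.verts, RAM.arcs, RAM.forLoop,
        RAM.bfsStep, RAM.update]
      omega
    rw [e2.frame.arr a this, hz1 a (by omega)]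
  have hspine := SimpleGraph.IsStart.IsKeyPath.isSpine hstart hG hAT hpath
  obtain ⟨t3, s3, e3, ht3, rk, hrk, hf⟩ := RAM.runs_arrange hG hadj i2 hspine hcls
    (fun _ => rfl) h29 he h210 hmono (hz2 2 (.inr rfl)) fun a ha => hz2 a (.inl ha)
  obtain ⟨π, hl, hπ⟩ := SimpleGraph.exists_walk_of_adj hspine.adj_succ
  refine ⟨_, s3, e1.seq (e2.seq e3), ?_, hspine.isLineEmbedding hG hcls hrk hf, _, _, π,
    hspine.isLayeredDominatingPath hG hl hπ,
    hspine.isLayeredArrangement hG hcls hrk hf hl hπ⟩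
  have := RAM.size_le hadj hn
  omega
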